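/- Let $k$ be a positive integer. An instance of the $k$-local Hamiltonian problem on $n\ge 1$ qubits with $m\ge 1$ terms is $H=\sum_{j=1}^m H_j$, where each $H_j$ is an operator with $0\le H_j\le \mathrm{Id}$ acting on a set $S_j$ of at most $k$ of the $n$ qubits (and tensored with the identity on the others). There are constants $C,c>0$ depending only on $k$, and a one-round interactive protocol between a quantum polynomial-time verifier and $5$ entangled quantum provers, in which the verifier receives $n$, $m$ and the sets $S_j$ as classical input and can perform the two-outcome measurements $\{H_j,\mathrm{Id}-H_j\}$ on $|S_j|$ qubits in its possession, such that for all $n,m\ge 1$ and every instance $H$: 1. the verifier runs in time polynomial in $n$ and $m$ (hence in time $\mathrm{poly}(n)$ if $m=\mathrm{poly}(n)$), and it sends each prover a classical question of $O(\log n)$ bits (at most $K(1+\lfloor\log_2 n\rfloor)$ bits, with $K$ depending only on $k$); 2. each prover answers with (at most) $k$ qubits; 3. if $a$ is real and $|\Gamma\rangle$ is an $n$-qubit state with $\langle\Gamma|H|\Gamma\rangle\le am$, then the following strategy is accepted with probability at least $1-a/2$: the provers share the state obtained from $|\Gamma\rangle$ by encoding each of its qubits in the $5$-qubit stabilizer code,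 prover $t$ holding the $t$-th qubit of each of the $n$ blocks, and each prover answers a question by sending its shares of the logical qubits (at most $k$ of them) that the question designates; 4. if $b$ is real and $\langle\Psi|H|\Psi\rangle\ge bm$ for every $n$-qubit state $|\Psi\rangle$, then every strategy of the provers (a shared entangled state of arbitrary finite dimension and, for each prover and each question, an arbitrary isometry of its register into $k$ answer qubits and a private register) is accepted with probability at most $1-Cb/n^c$. -/

import Mathlib

open scoped ComplexOrder

namespace LHGame

/-! ### Qubits and local operators -/

/-- Operators on the qubits labelled by `ι`, in the computational basis `ι → Bool`. -/
abbrev Op (ι : Type) : Type := Matrix (ι → Bool) (ι → Bool) ℂ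

/-- A unit vector in the space with orthonormal basis `B`. -/
def IsState {B : Type} [Fintype B] (ψ : B → ℂ) : Prop := ∑ x, ‖ψ x‖ ^ 2 = 1

open Classical in
/-- The operator `A` applied to the qubits `f 0, f 1, …`, tensored with the identity on all
the other qubits. -/
noncomputable def lift {κ ι : Type} (f : κ ↪ ι) (A : Op κ) : Op ι :=
  fun x y => if ∀ i, i ∉ Set.range f → x i = y i then A (x ∘ f) (y ∘ f) else 0

/-- The expectation value of `A` in the vector `ψ`. -/
noncomputable def expect {B : Type} [Fintype B] (A : Matrix B B ℂ) (ψ : B → ℂ) : ℝ :=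
  (star ψ ⬝ᵥ A.mulVec ψ).re

/-! ### The local Hamiltonian problem -/

/-- An instance of the `k`-local Hamiltonian problem on `n` qubits with `m` terms. The `j`-th term
acts on a set of `size j ≤ k` qubits, listed in increasing order by `supp j`. It is a positive
semidefinite matrix of operator norm at most one, that is `0 ≤ term j ≤ 1`. -/
structure LocalHamiltonian (k n m : ℕ) where
  size : Fin m → ℕ
  size_le : ∀ j, size j ≤ k
  supp : ∀ j, Fin (size j) ↪o Fin n
  term : ∀ j, Op (Fin (size j))
  term_nonneg : ∀ j, (term j).PosSemidef
  term_le_one : ∀ j, (1 - term j).PosSemidef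

/-- The Hamiltonian `H = ∑ j, H_j`, as an operator on `n` qubits. -/
noncomputable def LocalHamiltonian.op {k n m : ℕ} (H : LocalHamiltonian k n m) : Op (Fin n) :=
  ∑ j, lift (H.supp j).toEmbedding (H.term j)

/-! ### The verifier: a probabilistic random access machine that prepares a quantum circuit -/

/-- The qubits that the verifier receives: `(t, l)` is the `l`-th qubit sent by prover `t`. -/
abbrev Wire (k : ℕ) : Type := Fin 5 × Fin k

/-- A self-delimiting binary encoding of a natural number: each binary digit is preceded by
`true`, and the end is marked by `false`. -/
def encodeNat (a : ℕ) : List Bool := (Nat.bits a).flatMap (fun b => [true, b]) ++ [false]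

/-- The measurement performed at the end. `accept`: accept unconditionally. `zeros ws`: measure
the qubits `ws` in the computational basis and accept iff all outcomes are `0`.
`energy j ws`: measure `{H_j, 1 - H_j}` on the first `size j` qubits among `ws 0, ws 1, …`
and reject iff the outcome is `H_j`. -/
inductive Verdict (k : ℕ) where
  | accept : Verdict k
  | zeros (ws : Finset (Wire k)) : Verdict k
  | energy (j : ℕ) (ws : Fin k ↪ Wire k) : Verdict k

/-- Configurations of the verifier: its memory of natural numbers, the bits sent so far to each
prover, the circuit to be applied to the answers, the final measurement, and the number of
elementary steps made so far. -/
structure Config (k : ℕ) where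
  mem : ℕ → ℕ
  msg : Fin 5 → List Bool
  circuit : Op (Wire k)
  verdict : Verdict k
  time : ℕ

/-- Programs of the verifier. Registers are natural numbers; below `[x]` is the content of `x`.
* `const x c`, `add x y z`, `sub x y z`, `load x y`, `store x y` perform `[x] := c`,
  `[x] := [y] + [z]`, `[x] := [y] - [z]` (truncated), `[x] := [[y]]` and `[[x]] := [y]`.
* `termSize x y` and `termQubit x y l` read the input: the number of qubits of the term number
  `[y]`, and the `l`-th of these qubits. The entries of the terms are not accessible.
* `rand x y` sets `[x]` to a uniformly random element of `{0, …, [y]}`.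
* `send t x` sends the number `[x]` to prover `t`.
* `gate a U _ _ ws` adds a gate to the circuit. A program being a fixed finite object, only
  finitely many gates, each on a fixed number of qubits, are available to it.
* `measureZeros ws` and `measureEnergy x ws` select the final measurement.
* `ite x y p q` runs `p` if `[x] ≤ [y]` and `q` otherwise; `loop x p` repeats `p` as many times
  as the value of `[x]` at the start says. -/
inductive Prog (k : ℕ) where
  | skip : Prog k
  | const (x c : ℕ) : Prog k
  | add (x y z : ℕ) : Prog k
  | sub (x y z : ℕ) : Prog k
  | load (x y : ℕ) : Prog k
  | store (x y : ℕ) : Prog k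
  | termSize (x y : ℕ) : Prog k
  | termQubit (x y : ℕ) (l : Fin k) : Prog k
  | rand (x y : ℕ) : Prog k
  | send (t : Fin 5) (x : ℕ) : Prog k
  | gate (a : ℕ) (U : Op (Fin a)) (unitary : U ∈ Matrix.unitaryGroup (Fin a → Bool) ℂ)
      (algebraic : ∀ x y, IsAlgebraic ℚ (U x y)) (ws : Fin a ↪ Wire k) : Prog k
  | measureZeros (ws : Finset (Wire k)) : Prog k
  | measureEnergy (x : ℕ) (ws : Fin k ↪ Wire k) : Prog k
  | seq (p q : Prog k) : Prog k
  | ite (x y : ℕ) (p q : Prog k) : Prog k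
  | loop (x : ℕ) (p : Prog k) : Prog k

/-- Let `c` further steps pass. -/
def Config.tick {k : ℕ} (s : Config k) (c : ℕ) : Config k := { s with time := s.time + c }

/-- Write `v` into register `x`, in one step. -/
def Config.write {k : ℕ} (s : Config k) (x v : ℕ) : Config k :=
  { s with mem := Function.update s.mem x v, time := s.time + 1 }

/-- The number of qubits of term number `j` (zero if there is no such term). -/
def LocalHamiltonian.readSize {k n m : ℕ} (H : LocalHamiltonian k n m) (j : ℕ) : ℕ :=
  if h : j < m then H.size ⟨j, h⟩ else 0

/-- The `l`-th qubit of term number `j` (zero if there is no such qubit). -/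
def LocalHamiltonian.readQubit {k n m : ℕ} (H : LocalHamiltonian k n m) (j l : ℕ) : ℕ :=
  if h : j < m then
    if hl : l < H.size ⟨j, h⟩ then (H.supp ⟨j, h⟩ ⟨l, hl⟩ : ℕ) else 0
  else 0

/-- The distribution of the configuration reached by a program. -/
noncomputable def Prog.run {k n m : ℕ} (H : LocalHamiltonian k n m) :
    Prog k → Config k → PMF (Config k)
  | .skip, s => PMF.pure (s.tick 1)
  | .const x c, s => PMF.pure (s.write x c)
  | .add x y z, s => PMF.pure (s.write x (s.mem y + s.mem z))
  | .sub x y z, s => PMF.pure (s.write x (s.mem y - s.mem z))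
  | .load x y, s => PMF.pure (s.write x (s.mem (s.mem y)))
  | .store x y, s => PMF.pure (s.write (s.mem x) (s.mem y))
  | .termSize x y, s => PMF.pure (s.write x (H.readSize (s.mem y)))
  | .termQubit x y l, s => PMF.pure (s.write x (H.readQubit (s.mem y) l))
  | .rand x y, s => (PMF.uniformOfFintype (Fin (s.mem y + 1))).map (fun v => s.write x v)
  | .send t x, s => PMF.pure
      { s.tick (1 + (encodeNat (s.mem x)).length) with
        msg := Function.update s.msg t (s.msg t ++ encodeNat (s.mem x)) }
  | .gate _ U _ _ ws, s => PMF.pure { s.tick 1 with circuit := lift ws U * s.circuit }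
  | .measureZeros ws, s => PMF.pure { s.tick 1 with verdict := .zeros ws }
  | .measureEnergy x ws, s => PMF.pure { s.tick 1 with verdict := .energy (s.mem x) ws }
  | .seq p q, s => (p.run H s).bind (q.run H)
  | .ite x y p q, s => if s.mem x ≤ s.mem y then p.run H (s.tick 1) else q.run H (s.tick 1)
  | .loop x p, s =>
      Nat.rec (PMF.pure (s.tick 1)) (fun _ μ => μ.bind (fun s' => p.run H (s'.tick 1))) (s.mem x)

/-- The initial configuration: registers `0` and `1` hold `n` and `m`, all others are zero, no
bit has been sent, and the circuit is empty. -/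
noncomputable def Config.start (k n m : ℕ) : Config k where
  mem := fun x => if x = 0 then n else if x = 1 then m else 0
  msg := fun _ => []
  circuit := 1
  verdict := .accept
  time := 0

/-- The distribution of the final configuration of the program `V` on the instance `H`. -/
noncomputable def Prog.outcome {k n m : ℕ} (V : Prog k) (H : LocalHamiltonian k n m) :
    PMF (Config k) :=
  V.run H (Config.start k n m)

/-- The measurement operator for the answer "accept". -/
noncomputable def LocalHamiltonian.effect {k n m : ℕ} (H : LocalHamiltonian k n m) :
    Verdict k → Op (Wire k)
  | .accept => 1
  | .zeros ws => Matrix.diagonal (fun x => if ∀ w ∈ ws, x w = false then 1 else 0)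
  | .energy j ws =>
      if h : j < m then
        1 - lift ((Fin.castLEEmb (H.size_le ⟨j, h⟩)).trans ws) (H.term ⟨j, h⟩)
      else 1

/-! ### The provers -/

/-- A strategy of five entangled provers who receive bit strings and answer with `k` qubits each.
Prover `t` holds a register with basis `P t`; the provers share the vector `state`. On question
`q`, prover `t` applies `W t q`, which turns its register into `k` answer qubits and a private
register with basis `A t`. -/
structure Strategy (k : ℕ) where
  P : Fin 5 → Type
  A : Fin 5 → Type
  [fintypeP : ∀ t, Fintype (P t)]
  [fintypeA : ∀ t, Fintype (A t)]
  [decEqP : ∀ t, DecidableEq (P t)]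
  state : (∀ t, P t) → ℂ
  W : ∀ t, List Bool → Matrix ((Fin k → Bool) × A t) (P t) ℂ

attribute [instance] Strategy.fintypeP Strategy.fintypeA Strategy.decEqP

/-- The shared vector is a state and the maps applied by the provers are isometries. -/
def Strategy.IsQuantum {k : ℕ} (σ : Strategy k) : Prop :=
  IsState σ.state ∧ ∀ t q, (σ.W t q).conjTranspose * σ.W t q = 1

/-- The joint vector after the provers have answered the questions `q`, as a vector on the answer
qubits for each basis element `e` of the private registers. -/
noncomputable def Strategy.answer {k : ℕ} (σ : Strategy k) (q : Fin 5 → List Bool)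
    (e : ∀ t, σ.A t) : (Wire k → Bool) → ℂ :=
  fun x => ∑ y : (∀ t, σ.P t), (∏ t, σ.W t (q t) (fun l => x (t, l), e t) (y t)) * σ.state y

/-- The probability of acceptance when the verifier has reached the final configuration `s`: its
circuit is applied to the answers to the questions it sent, and then measured. -/
noncomputable def acceptIn {k n m : ℕ} (H : LocalHamiltonian k n m) (σ : Strategy k)
    (s : Config k) : ℝ :=
  ∑ e : (∀ t, σ.A t), expect (H.effect s.verdict) (s.circuit.mulVec (σ.answer s.msg e))

/-- The probability that the verifier `V` accepts the strategy `σ` on the instance `H`. -/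
noncomputable def acceptProb {k n m : ℕ} (V : Prog k) (H : LocalHamiltonian k n m)
    (σ : Strategy k) : ℝ :=
  (∑' s, V.outcome H s * ENNReal.ofReal (acceptIn H σ s)).toReal

/-! ### The five-qubit code and the honest provers -/

/-- The logical basis states of the five-qubit code, with stabilizers the cyclic shifts of
`X Z Z X I`: `|0⟩ ↦ ¼ ∑ (-1)^(∑ i, x i * x (i+1)) |x⟩` over the strings `x` of even weight, and
`|1⟩ ↦ X X X X X` applied to the image of `|0⟩`. -/
noncomputable def codeword (b : Bool) (x : Fin 5 → Bool) : ℂ :=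
  if (Finset.univ.filter (fun i => x i = true)).card % 2 = b.toNat then
    (-1) ^ (b.toNat + (Finset.univ.filter (fun i => x i = true ∧ x (i + 1) = true)).card) / 4
  else 0

/-- The `n`-qubit vector `Γ` with each qubit encoded in the five-qubit code; the `t`-th qubits of
all the blocks are held by prover `t`. -/
noncomputable def encode {n : ℕ} (Γ : (Fin n → Bool) → ℂ) : (Fin 5 → Fin n → Bool) → ℂ :=
  fun x => ∑ y : Fin n → Bool, (∏ i, codeword (y i) (fun t => x t i)) * Γ y

/-- The honest strategy for `Γ`. The question `q` asks for the shares of the logical qubits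
`ask q 0, ask q 1, …`; each prover sends these qubits of its register and keeps the others
(answer qubits that are not asked for, and emptied places, are filled with `|0⟩`). -/
noncomputable abbrev honest {k n : ℕ} (ask : List Bool → Fin k → Option (Fin n))
    (Γ : (Fin n → Bool) → ℂ) : Strategy k where
  P := fun _ => Fin n → Bool
  A := fun _ => Fin n → Bool
  state := encode Γ
  W := fun _ q z x =>
    if z.1 = (fun l => ((ask q l).map x).getD false) ∧
        z.2 = (fun i => if ∃ l, ask q l = some i then false else x i) then 1 else 0

end LHGame

/-!
The verifier tosses a coin. In an energy test it draws a random term of the Hamiltonian, asks all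
five provers for their shares of its qubits, decodes all blocks and measures the term on the decoded
qubits. In a code test it draws a tuple of at most `k` qubits, a qubit `i` in the tuple and a
prover, asks this prover for the tuple and the others only for `i`, and checks that the five shares
of `i` form a block of the five-qubit code.

*Completeness.* The isometries of the honest provers carry Pauli operators on the asked qubits to
the same operators on the answers, and the encoding turns Pauli operators on the `n` qubits into the
logical operators `X ⊗ ⋯ ⊗ X` and `Z ⊗ ⋯ ⊗ Z`. So the code tests are passed with certainty, and the
energy test of a term is failed with the expectation value of this term in `Γ`
(`energyRej_honest`); as energy tests are made half of the time, this gives `1 - a / 2`.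

*Soundness.* Let `ρ` be a bound for the probability of failing a code test. Every nontrivial Pauli
operator on a qubit of the code is contained in a stabilizer. If the code test is passed, then the
observable that a prover measures for a Pauli operator on an asked qubit can be replaced, on the
shared state `ψ`, by an operator of the other provers, which does not depend on the question that
the first prover is asked (`obs_near`, `Mirrored`). Operators of different provers commute; hence
products of observables behave, up to errors of order `√ρ` for every factor, as if each prover had a
single set of `2 * n` observables with the commutation relations of the Pauli operators
(`letters_comm`, `Mirrored.filter_mul`). Products over the five provers yield logical operators
`logical g`, for `g` in the Pauli group modulo signs, such that the family of vectors `logical g ψ`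
is nearly a copy of the regular representation: Pauli words on the answers to a question permute it
up to signs (`logical_mul_word`). A Fourier transform (`transf`) turns such a family into a state of
`n` qubits and an environment, on which the Pauli operators act as usual (`actFirst_lift`), with the
same norm up to a factor (`sum_norm_transf`). Writing a term as `Aᴴ * A` and expanding `A` in Pauli
operators, one sees that the energy of this state is bounded by a multiple of the probability of
failing the energy tests, up to an error of order `n ^ 2 * ρ` (`energy_le_of_stabBound`). The answers
in an energy test need not be compared with code states: the decoder is chosen such that it turns
`X ⊗ ⋯ ⊗ X` and `Z ⊗ ⋯ ⊗ Z` into Pauli operators on one qubit on the whole space, not just on the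
code (`pauli_mul_decodeAll`).

For `k = 1` no question concerns two qubits, so that no commutation relation between observables on
different qubits can be tested. But then every term acts on a single qubit, and a product of states
of single qubits has an energy bounded by the probability of failing the energy tests
(`energy_le_of_one`).

The verifier is a program without loops, whose distribution of outcomes is evaluated with
expectation values (`mean`). It makes every single code test with a probability of at least
`2⁻¹ ^ (5 * k + 1) * (n + 1)⁻¹ ^ k` (`mean_outcome_ge_code`), so that `ρ` is at most `O(n ^ k)`
times the probability of rejection. With the factor `n ^ 2` from the energy bound, the exponent in
the theorem is `k + 2`.
-/

set_option linter.unusedSectionVars false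

namespace LHGame

/-! ### Approximate Pauli words -/

section Words

variable {V : Type*} [NormedAddCommGroup V] [NormedSpace ℂ V]

/-- An operator of norm at most one. -/
def IsContraction (A : V →L[ℂ] V) : Prop := ∀ v, ‖A v‖ ≤ ‖v‖

lemma IsContraction.one : IsContraction (1 : V →L[ℂ] V) := fun _ => le_rfl

lemma IsContraction.mul {A B : V →L[ℂ] V} (hA : IsContraction A) (hB : IsContraction B) :
    IsContraction (A * B) := fun v => (hA (B v)).trans (hB v)

lemma IsContraction.smul {A : V →L[ℂ] V} (hA : IsContraction A) {c : ℂ} (hc : ‖c‖ = 1) :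
    IsContraction (c • A) := fun v => by
  simpa [norm_smul, hc] using hA v

lemma IsContraction.list_prod {l : List (V →L[ℂ] V)} (h : ∀ A ∈ l, IsContraction A) :
    IsContraction l.prod := by
  induction l with
  | nil => simpa using IsContraction.one
  | cons A l ih =>
    rw [List.prod_cons]
    exact (h A (by simp)).mul (ih fun B hB => h B (by simp [hB]))

lemma IsContraction.dist_le {A : V →L[ℂ] V} (hA : IsContraction A) {u v : V} {r : ℝ}
    (h : ‖u - v‖ ≤ r) : ‖A u - A v‖ ≤ r := by
  rw [← map_sub]; exact (hA _).trans h

/-- The operators `A μ`, which stand for the observables of one prover, can be replaced, where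
they act directly on `ψ`, by operators `T μ` of the other provers, up to an error `δ`. -/
structure Mirrored {Λ : Type*} (ψ : V) (δ : ℝ) (A T : Λ → V →L[ℂ] V) : Prop where
  contr : ∀ a, IsContraction (A a)
  contr' : ∀ a, IsContraction (T a)
  comm : ∀ a b, Commute (A a) (T b)
  near : ∀ a, ‖A a ψ - T a ψ‖ ≤ δ

/-- Two contractions that nearly agree on `ψ` still nearly agree on `a ψ`, if `a` can be
replaced on `ψ` by a contraction `T` that commutes with both. -/
lemma norm_sub_apply_le_of_near {ψ : V} {δ : ℝ} {a T B B' : V →L[ℂ] V} (hT : IsContraction T)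
    (hnear : ‖a ψ - T ψ‖ ≤ δ) (hB : IsContraction B) (hB' : IsContraction B')
    (hBT : Commute B T) (hBT' : Commute B' T) :
    ‖B (a ψ) - B' (a ψ)‖ ≤ ‖B ψ - B' ψ‖ + 2 * δ := by
  have e1 : B (T ψ) = T (B ψ) := congrArg (fun f : V →L[ℂ] V => f ψ) hBT.eq
  have e2 : B' (T ψ) = T (B' ψ) := congrArg (fun f : V →L[ℂ] V => f ψ) hBT'.eq
  have key : B (a ψ) - B' (a ψ) =
      B (a ψ - T ψ) - B' (a ψ - T ψ) + T (B ψ - B' ψ) := by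
    simp only [map_sub, e1, e2]; abel
  rw [key]
  have h1 := (hB (a ψ - T ψ)).trans hnear
  have h2 := (hB' (a ψ - T ψ)).trans hnear
  have h3 := hT (B ψ - B' ψ)
  have := norm_add_le (B (a ψ - T ψ) - B' (a ψ - T ψ)) (T (B ψ - B' ψ))
  have := norm_sub_le (B (a ψ - T ψ)) (B' (a ψ - T ψ))
  linarith

variable {Λ : Type*} {ψ : V} {δ δ' : ℝ} {A T : Λ → V →L[ℂ] V} {ε : Λ → Λ → ℂ}

/-- The product of the operators `A a` over a list of letters. -/
abbrev wordOp {M : Type*} [Monoid M] (A : Λ → M) (l : List Λ) : M := (l.map A).prod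

lemma norm_prod_map_eq_one (hε : ∀ a b, ‖ε a b‖ = 1) (b : Λ) (l : List Λ) :
    ‖(l.map (ε · b)).prod‖ = 1 := by
  induction l with
  | nil => simp
  | cons c l ih => simp [ih, hε]

lemma Mirrored.contr_word (h : Mirrored ψ δ A T) (l : List Λ) : IsContraction (wordOp A l) :=
  IsContraction.list_prod fun B hB => by
    obtain ⟨a, -, rfl⟩ := List.mem_map.1 hB
    exact h.contr a

lemma Mirrored.comm_word (h : Mirrored ψ δ A T) (l : List Λ) (b : Λ) :
    Commute (wordOp A l) (T b) :=
  Commute.list_prod_left _ _ fun B hB => by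
    obtain ⟨a, -, rfl⟩ := List.mem_map.1 hB
    exact h.comm a b

@[simp] lemma wordOp_nil {M : Type*} [Monoid M] (A : Λ → M) : wordOp A [] = 1 := rfl

lemma wordOp_concat {M : Type*} [Monoid M] (A : Λ → M) (l : List Λ) (a : Λ) :
    wordOp A (l ++ [a]) = wordOp A l * A a := by simp [wordOp]

/-- A letter can be moved to the left through a word of letters with which it nearly commutes
or anticommutes. -/
lemma Mirrored.word_comm (h : Mirrored ψ δ A T) (hε : ∀ a b, ‖ε a b‖ = 1) (b : Λ)
    (l : List Λ) (hl : ∀ a ∈ l, ‖A a (A b ψ) - ε a b • A b (A a ψ)‖ ≤ δ') :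
    ‖wordOp A l (A b ψ) - (l.map (ε · b)).prod • A b (wordOp A l ψ)‖ ≤
      l.length * (δ' + 2 * δ) := by
  induction l using List.reverseRecOn with
  | nil => simp
  | append_singleton l a ih =>
    have ih := ih fun c hc => hl c (by simp [hc])
    have ha := hl a (by simp)
    set s := (l.map (ε · b)).prod with hs
    have hs1 : ‖s‖ = 1 := norm_prod_map_eq_one hε b l
    have e1 : wordOp A (l ++ [a]) (A b ψ) - ((l ++ [a]).map (ε · b)).prod •
        A b (wordOp A (l ++ [a]) ψ) =
        wordOp A l (A a (A b ψ) - ε a b • A b (A a ψ)) +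
        ε a b • ((wordOp A l * A b) (A a ψ) - (s • (A b * wordOp A l)) (A a ψ)) := by
      rw [wordOp_concat]
      simp [smul_sub, smul_smul, mul_comm s, ← hs]
    rw [e1]
    have h1 := (h.contr_word l _).trans ha
    have h2 := norm_sub_apply_le_of_near (h.contr' a) (h.near a)
      ((h.contr_word l).mul (h.contr b)) (((h.contr b).mul (h.contr_word l)).smul hs1)
      ((h.comm_word l a).mul_left (h.comm b a))
      (((h.comm b a).mul_left (h.comm_word l a)).smul_left s)
    have h3 : ‖(wordOp A l * A b) ψ - (s • (A b * wordOp A l)) ψ‖ ≤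
        l.length * (δ' + 2 * δ) := by simpa using ih
    refine (norm_add_le _ _).trans ?_
    rw [norm_smul, hε, one_mul, List.length_append, List.length_singleton]
    rw [Nat.cast_add, Nat.cast_one]
    simp only [mul_apply_eq_comp] at *
    linarith

/-- Near involutions remain so on a vector to which a word has been applied. -/
lemma Mirrored.sq_word (h : Mirrored ψ δ A T) (b : Λ) (hb : ‖A b (A b ψ) - ψ‖ ≤ δ')
    (l : List Λ) :
    ‖A b (A b (wordOp A l ψ)) - wordOp A l ψ‖ ≤ δ' + l.length * (2 * δ) := by
  induction l using List.reverseRecOn with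
  | nil => simpa using hb
  | append_singleton l a ih =>
    have h2 := norm_sub_apply_le_of_near (B := A b * A b * wordOp A l) (B' := wordOp A l)
      (h.contr' a) (h.near a) (((h.contr b).mul (h.contr b)).mul (h.contr_word l))
      (h.contr_word l) (((h.comm b a).mul_left (h.comm b a)).mul_left (h.comm_word l a))
      (h.comm_word l a)
    rw [wordOp_concat, List.length_append, List.length_singleton]
    rw [Nat.cast_add, Nat.cast_one]
    simp only [mul_apply_eq_comp] at h2 ⊢
    linarith

/-- A word followed by the reversed word is nearly the identity on `ψ`. -/
lemma Mirrored.reverse_word (h : Mirrored ψ δ A T) (l : List Λ)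
    (hl : ∀ a ∈ l, ‖A a (A a ψ) - ψ‖ ≤ δ') :
    ‖wordOp A l.reverse (wordOp A l ψ) - ψ‖ ≤ l.length * (δ' + 2 * δ) := by
  induction l using List.reverseRecOn with
  | nil => simp
  | append_singleton l a ih =>
    have ih := ih fun c hc => hl c (by simp [hc])
    have ha := hl a (by simp)
    have h2 := norm_sub_apply_le_of_near
      (B := A a * (wordOp A l.reverse * wordOp A l)) (B' := A a)
      (h.contr' a) (h.near a)
      ((h.contr a).mul ((h.contr_word _).mul (h.contr_word l))) (h.contr a)
      ((h.comm a a).mul_left ((h.comm_word _ a).mul_left (h.comm_word l a))) (h.comm a a)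
    have h3 : ‖(A a * (wordOp A l.reverse * wordOp A l)) ψ - A a ψ‖ ≤
        l.length * (δ' + 2 * δ) := (h.contr a).dist_le ih
    have e : wordOp A (l ++ [a]).reverse = A a * wordOp A l.reverse := by simp [wordOp]
    rw [wordOp_concat, e, List.length_append, List.length_singleton]
    rw [Nat.cast_add, Nat.cast_one]
    have := norm_sub_le_norm_sub_add_norm_sub
      ((A a * (wordOp A l.reverse * wordOp A l)) (A a ψ)) (A a (A a ψ)) ψ
    simp only [mul_apply_eq_comp] at *
    linarith

variable [DecidableEq Λ]

/-- The exponent vector `g` with its entry at `a` changed. -/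
def toggle (g : Λ → Bool) (a : Λ) : Λ → Bool := Function.update g a (!g a)

lemma filter_toggle_of_notMem {l : List Λ} {a : Λ} (g : Λ → Bool) (ha : a ∉ l) :
    l.filter (toggle g a) = l.filter g := by
  refine List.filter_congr fun x hx => ?_
  have : x ≠ a := fun h => ha (h ▸ hx)
  simp [toggle, this]

/-- Multiplying the ordered monomial with exponents `g` by the letter `b` gives, up to a sign
and a small error, the monomial in which the exponent of `b` is changed. -/
lemma Mirrored.filter_mul (h : Mirrored ψ δ A T) (hδ : 0 ≤ δ) (hδ' : 0 ≤ δ')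
    (hε : ∀ a b, ‖ε a b‖ = 1)
    (hcomm : ∀ a b, a ≠ b → ‖A a (A b ψ) - ε a b • A b (A a ψ)‖ ≤ δ')
    (hsq : ∀ a, ‖A a (A a ψ) - ψ‖ ≤ δ') (l₁ l₂ : List Λ) (b : Λ)
    (h₁ : b ∉ l₁) (h₂ : b ∉ l₂) (g : Λ → Bool) :
    ‖wordOp A ((l₁ ++ b :: l₂).filter g) (A b ψ) -
      ((l₂.filter g).map (ε · b)).prod • wordOp A ((l₁ ++ b :: l₂).filter (toggle g b)) ψ‖ ≤
      (l₂.length + 1) * (δ' + 4 * δ) := by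
  set w₁ := wordOp A (l₁.filter g) with hw₁
  set w₂ := wordOp A (l₂.filter g) with hw₂
  set s := ((l₂.filter g).map (ε · b)).prod with hs
  have hs1 : ‖s‖ = 1 := norm_prod_map_eq_one hε b _
  have hlen : ((l₂.filter g).length : ℝ) ≤ l₂.length := by
    exact_mod_cast List.length_filter_le _ _
  have hmove := h.word_comm hε b (l₂.filter g) (δ' := δ') fun a ha =>
    hcomm a b fun hab => h₂ (hab ▸ List.mem_of_mem_filter ha)
  have hsqw := h.sq_word b (hsq b) (l₂.filter g)
  rw [← hw₂, ← hs] at hmove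
  rw [← hw₂] at hsqw
  have hc₁ : IsContraction w₁ := h.contr_word _
  cases hg : g b with
  | false =>
    have e1 : wordOp A ((l₁ ++ b :: l₂).filter g) = w₁ * w₂ := by
      simp [List.filter_append, hg, wordOp, hw₁, hw₂]
    have e2 : wordOp A ((l₁ ++ b :: l₂).filter (toggle g b)) = w₁ * (A b * w₂) := by
      have : toggle g b b = true := by simp [toggle, hg]
      rw [List.filter_append, List.filter_cons, this, filter_toggle_of_notMem g h₁,
        filter_toggle_of_notMem g h₂]
      simp [wordOp, hw₁, hw₂]
    rw [e1, e2]
    have := hc₁.dist_le hmove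
    simp only [mul_apply_eq_comp, map_smul] at this ⊢
    refine this.trans ?_
    have : (0 : ℝ) ≤ ((l₂.filter g).length : ℝ) := by positivity
    nlinarith
  | true =>
    have e1 : wordOp A ((l₁ ++ b :: l₂).filter g) = w₁ * (A b * w₂) := by
      simp [List.filter_append, hg, wordOp, hw₁, hw₂]
    have e2 : wordOp A ((l₁ ++ b :: l₂).filter (toggle g b)) = w₁ * w₂ := by
      have : toggle g b b = false := by simp [toggle, hg]
      rw [List.filter_append, List.filter_cons, this, filter_toggle_of_notMem g h₁,
        filter_toggle_of_notMem g h₂]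
      simp [wordOp, hw₁, hw₂]
    rw [e1, e2]
    have k1 := (hc₁.mul (h.contr b)).dist_le hmove
    have k2 : ‖s • w₁ (A b (A b (w₂ ψ))) - s • w₁ (w₂ ψ)‖ ≤
        δ' + (l₂.filter g).length * (2 * δ) := by
      rw [← smul_sub, norm_smul, hs1, one_mul]
      exact hc₁.dist_le hsqw
    have k3 := norm_sub_le_norm_sub_add_norm_sub (w₁ (A b (w₂ (A b ψ))))
      (s • w₁ (A b (A b (w₂ ψ)))) (s • w₁ (w₂ ψ))
    simp only [mul_apply_eq_comp, map_smul] at k1 ⊢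
    have : (0 : ℝ) ≤ ((l₂.filter g).length : ℝ) := by positivity
    nlinarith

/-- The effect on a monomial `c • A^g` of multiplication from the right by the letters of a list,
where `s g a` is the sign that appears when the letter `a` is put into its place. -/
def toggles (s : (Λ → Bool) → Λ → ℂ) (g : Λ → Bool) (l : List Λ) : (Λ → Bool) × ℂ :=
  l.foldl (fun c a => (toggle c.1 a, c.2 * s c.1 a)) (g, 1)

lemma toggles_concat (s : (Λ → Bool) → Λ → ℂ) (g : Λ → Bool) (l : List Λ) (a : Λ) :
    toggles s g (l ++ [a]) =
      (toggle (toggles s g l).1 a, (toggles s g l).2 * s (toggles s g l).1 a) := by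
  simp [toggles]

lemma norm_toggles (s : (Λ → Bool) → Λ → ℂ) (hs : ∀ g a, ‖s g a‖ = 1) (g : Λ → Bool)
    (l : List Λ) : ‖(toggles s g l).2‖ = 1 := by
  induction l using List.reverseRecOn with
  | nil => simp [toggles]
  | append_singleton l a ih => simp [toggles_concat, ih, hs]

/-- If a map `E` into the operators is nearly multiplicative on `ψ` at the generators `P p` of
`M`, and sends them near to letters, then a monomial applied to `E` of a word is, up to a sign,
the product monomial. -/
lemma Mirrored.word_image (h : Mirrored ψ δ A T) {M K : Type*} [Monoid M] (P : K → M)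
    (E : M → V →L[ℂ] V) (em : K → Λ) (hE1 : E 1 = 1)
    (hEc : ∀ L : List K, IsContraction (E (wordOp P L)))
    (hET : ∀ (L : List K) b, Commute (E (wordOp P L)) (T b))
    (hmul : ∀ (L : List K) p,
      ‖E (wordOp P L * P p) ψ - E (wordOp P L) (E (P p) ψ)‖ ≤ δ)
    (hnear : ∀ p, ‖E (P p) ψ - T (em p) ψ‖ ≤ δ)
    (F : (Λ → Bool) → V →L[ℂ] V) (hF : ∀ g, IsContraction (F g))
    (hFT : ∀ g b, Commute (F g) (T b))
    (s : (Λ → Bool) → Λ → ℂ) (hs : ∀ g a, ‖s g a‖ = 1) {η : ℝ}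
    (hstep : ∀ g p, ‖F g (A (em p) ψ) - s g (em p) • F (toggle g (em p)) ψ‖ ≤ η)
    (g : Λ → Bool) (L : List K) :
    ‖F g (E (wordOp P L) ψ) -
      (toggles s g (L.map em)).2 • F (toggles s g (L.map em)).1 ψ‖ ≤
      L.length * (3 * δ + η) := by
  induction L using List.reverseRecOn with
  | nil => simp [toggles, wordOp, hE1]
  | append_singleton L p ih =>
    rw [List.map_append, List.map_singleton, toggles_concat, wordOp_concat]
    set g' := (toggles s g (L.map em)).1
    set σ := (toggles s g (L.map em)).2 with hσ
    have hσ1 : ‖σ‖ = 1 := norm_toggles s hs g _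
    set a := em p
    set W := E (wordOp P L)
    have hcomm : ∀ {B : V →L[ℂ] V}, Commute B (T a) → B (T a ψ) = T a (B ψ) := fun hB =>
      congrArg (fun f : V →L[ℂ] V => f ψ) hB.eq
    have k1 := (hF g).dist_le (hmul L p)
    have k2 := ((hF g).mul (hEc L)).dist_le (hnear p)
    have e2 : (F g * W) (T a ψ) = T a (F g (W ψ)) :=
      hcomm ((hFT g a).mul_left (hET L a))
    have k3 := (h.contr' a).dist_le ih
    have e3 : T a (σ • F g' ψ) = σ • F g' (T a ψ) := by
      rw [map_smul, hcomm (hFT g' a)]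
    have k4 : ‖σ • F g' (T a ψ) - σ • F g' (A a ψ)‖ ≤ δ := by
      rw [← smul_sub, norm_smul, hσ1, one_mul, norm_sub_rev]
      exact (hF g').dist_le (h.near a)
    have k5 : ‖σ • F g' (A a ψ) - (σ * s g' a) • F (toggle g' a) ψ‖ ≤ η := by
      rw [mul_smul, ← smul_sub, norm_smul, hσ1, one_mul]
      exact hstep g' p
    rw [e2] at k2
    rw [e3] at k3
    have t1 := norm_sub_le_norm_sub_add_norm_sub (F g (E (wordOp P L * P p) ψ))
      (F g (W (E (P p) ψ))) (T a (F g (W ψ)))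
    have t2 := norm_sub_le_norm_sub_add_norm_sub (F g (E (wordOp P L * P p) ψ))
      (T a (F g (W ψ))) (σ • F g' (T a ψ))
    have t3 := norm_sub_le_norm_sub_add_norm_sub (F g (E (wordOp P L * P p) ψ))
      (σ • F g' (T a ψ)) (σ • F g' (A a ψ))
    have t4 := norm_sub_le_norm_sub_add_norm_sub (F g (E (wordOp P L * P p) ψ))
      (σ • F g' (A a ψ)) ((σ * s g' a) • F (toggle g' a) ψ)
    rw [List.length_append, List.length_singleton]
    rw [Nat.cast_add, Nat.cast_one]
    simp only [mul_apply_eq_comp] at *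
    linarith

end Words

/-! ### Tensor products of matrices -/

section Tens

variable {ι : Type*} [Fintype ι] {α β γ : ι → Type*}

/-- The tensor product of a finite family of matrices. -/
def tens (B : ∀ i, Matrix (α i) (β i) ℂ) : Matrix (∀ i, α i) (∀ i, β i) ℂ :=
  Matrix.of fun x y => ∏ i, B i (x i) (y i)

lemma tens_apply (B : ∀ i, Matrix (α i) (β i) ℂ) (x : ∀ i, α i) (y : ∀ i, β i) :
    tens B x y = ∏ i, B i (x i) (y i) := rfl

lemma tens_mul [DecidableEq ι] [∀ i, Fintype (β i)] (B : ∀ i, Matrix (α i) (β i) ℂ)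
    (C : ∀ i, Matrix (β i) (γ i) ℂ) : tens B * tens C = tens fun i => B i * C i := by
  ext x y
  simp only [Matrix.mul_apply, tens_apply, ← Finset.prod_mul_distrib]
  exact (Fintype.prod_sum fun i j => B i (x i) j * C i j (y i)).symm

lemma tens_one [∀ i, DecidableEq (α i)] [DecidableEq (∀ i, α i)] :
    tens (fun i => (1 : Matrix (α i) (α i) ℂ)) = 1 := by
  ext x y
  by_cases h : x = y
  · subst h; simp [tens_apply]
  · obtain ⟨i, hi⟩ := Function.ne_iff.1 h
    rw [Matrix.one_apply_ne h, tens_apply]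
    exact Finset.prod_eq_zero (Finset.mem_univ i) (Matrix.one_apply_ne hi)

lemma tens_conjTranspose (B : ∀ i, Matrix (α i) (β i) ℂ) :
    (tens B).conjTranspose = tens fun i => (B i).conjTranspose := by
  ext x y
  simp [tens_apply, Matrix.conjTranspose_apply]

end Tens

/-! ### Pauli operators -/

section Pauli

/-- The sign `(-1) ^ b`. -/
def sgn (b : Bool) : ℂ := if b then -1 else 1

@[simp] lemma sgn_false : sgn false = 1 := rfl
@[simp] lemma sgn_true : sgn true = -1 := rfl

lemma sgn_xor (a b : Bool) : sgn (xor a b) = sgn a * sgn b := by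
  cases a <;> cases b <;> simp

lemma sgn_not (a : Bool) : sgn (!a) = -sgn a := by cases a <;> simp

lemma sgn_mul_self (a : Bool) : sgn a * sgn a = 1 := by cases a <;> simp

@[simp] lemma norm_sgn (a : Bool) : ‖sgn a‖ = 1 := by cases a <;> simp

@[simp] lemma star_sgn (a : Bool) : star (sgn a) = sgn a := by cases a <;> simp

/-- The Pauli matrices `X` (at `false`) and `Z` (at `true`). -/
def sig (p : Bool) : Matrix Bool Bool ℂ :=
  if p then Matrix.diagonal sgn else Matrix.of fun b c => if b = !c then 1 else 0

lemma sig_conjTranspose (p : Bool) : (sig p).conjTranspose = sig p := by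
  ext b c
  cases p <;> cases b <;> cases c <;> simp [sig, Matrix.conjTranspose_apply]

lemma sig_mul_self (p : Bool) : sig p * sig p = 1 := by
  ext b c
  cases p <;> cases b <;> cases c <;> simp [sig, Matrix.mul_apply]

@[simp] lemma toggle_self {ι : Type*} [DecidableEq ι] (x : ι → Bool) (i : ι) :
    toggle x i i = !x i := by simp [toggle]

@[simp] lemma toggle_of_ne {ι : Type*} [DecidableEq ι] (x : ι → Bool) {i j : ι}
    (h : j ≠ i) : toggle x i j = x j := by
  simp [toggle, h]

lemma toggle_toggle {ι : Type*} [DecidableEq ι] (x : ι → Bool) (i : ι) :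
    toggle (toggle x i) i = x := by
  ext j; by_cases h : j = i
  · subst h; simp [toggle]
  · simp [toggle, h]

lemma eq_toggle_comm {ι : Type*} [DecidableEq ι] {x y : ι → Bool} {i : ι} :
    y = toggle x i ↔ x = toggle y i := by
  constructor <;> (rintro rfl; rw [toggle_toggle])

variable {ι : Type} [DecidableEq ι]

/-- The sign that appears when two Pauli operators are exchanged. -/
def csign (p q : Bool × ι) : ℂ := if p.2 = q.2 ∧ p.1 ≠ q.1 then -1 else 1

lemma norm_csign (p q : Bool × ι) : ‖csign p q‖ = 1 := by
  rw [csign]; split_ifs <;> simp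

variable [Fintype ι]

/-- The Pauli operators `X` and `Z` on one of the qubits labelled by `ι`. -/
def pauli (p : Bool × ι) : Op ι := tens (Function.update 1 p.2 (sig p.1))

lemma pauli_false (i : ι) (x y : ι → Bool) :
    pauli (false, i) x y = if y = toggle x i then 1 else 0 := by
  rw [pauli, tens_apply]
  split_ifs with h
  · refine Finset.prod_eq_one fun j _ => ?_
    subst h
    by_cases hj : j = i
    · subst hj; simp [sig, toggle]
    · simp [hj, toggle]
  · obtain ⟨j, hj⟩ := Function.ne_iff.1 h
    refine Finset.prod_eq_zero (Finset.mem_univ j) ?_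
    by_cases hji : j = i
    · subst hji
      simp only [toggle, Function.update_self] at hj
      simp only [Function.update_self, sig, Bool.false_eq_true, if_false, Matrix.of_apply]
      rw [if_neg]
      rintro h'
      exact hj (by simp [h'])
    · simp only [toggle, Function.update_of_ne hji] at hj ⊢
      simp [Ne.symm hj]

lemma pauli_true (i : ι) (x y : ι → Bool) :
    pauli (true, i) x y = if x = y then sgn (x i) else 0 := by
  rw [pauli, tens_apply]
  split_ifs with h
  · subst h
    rw [Finset.prod_eq_single i]
    · simp [sig]
    · intro j _ hj; simp [hj]
    · simp
  · obtain ⟨j, hj⟩ := Function.ne_iff.1 h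
    refine Finset.prod_eq_zero (Finset.mem_univ j) ?_
    by_cases hji : j = i
    · subst hji; simp [sig, hj]
    · simp [hji, hj]

lemma pauli_true_mulVec (i : ι) (v : (ι → Bool) → ℂ) (x : ι → Bool) :
    (pauli (true, i)).mulVec v x = sgn (x i) * v x := by
  simp [Matrix.mulVec, dotProduct, pauli_true]

lemma pauli_false_mul (i : ι) {κ : Type*} (M : Matrix (ι → Bool) κ ℂ) (x : ι → Bool) (y : κ) :
    (pauli (false, i) * M) x y = M (toggle x i) y := by
  simp [Matrix.mul_apply, pauli_false]

lemma mul_pauli_false (i : ι) {κ : Type*} (M : Matrix κ (ι → Bool) ℂ) (x : κ) (y : ι → Bool) :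
    (M * pauli (false, i)) x y = M x (toggle y i) := by
  simp only [Matrix.mul_apply, pauli_false]
  rw [Finset.sum_eq_single (toggle y i)]
  · simp [toggle_toggle]
  · intro b _ hb
    rw [if_neg, mul_zero]; rintro rfl; exact hb (toggle_toggle _ _).symm
  · simp

lemma pauli_true_mul (i : ι) {κ : Type*} (M : Matrix (ι → Bool) κ ℂ) (x : ι → Bool) (y : κ) :
    (pauli (true, i) * M) x y = sgn (x i) * M x y := by
  simp [Matrix.mul_apply, pauli_true]

lemma mul_pauli_true (i : ι) {κ : Type*} (M : Matrix κ (ι → Bool) ℂ) (x : κ) (y : ι → Bool) :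
    (M * pauli (true, i)) x y = M x y * sgn (y i) := by
  simp only [Matrix.mul_apply, pauli_true]
  rw [Finset.sum_eq_single y] <;> simp +contextual

lemma pauli_conjTranspose (p : Bool × ι) : (pauli p).conjTranspose = pauli p := by
  rw [pauli, tens_conjTranspose]
  congr 1
  ext1 i
  by_cases h : i = p.2
  · subst h; simp [sig_conjTranspose]
  · simp [h]

lemma tens_update_mul {α : ι → Type*} [∀ i, Fintype (α i)] [∀ i, DecidableEq (α i)] (i : ι)
    (B C : Matrix (α i) (α i) ℂ) :
    tens (Function.update (fun i => (1 : Matrix (α i) (α i) ℂ)) i B) *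
      tens (Function.update (fun i => (1 : Matrix (α i) (α i) ℂ)) i C) =
      tens (Function.update (fun i => (1 : Matrix (α i) (α i) ℂ)) i (B * C)) := by
  rw [tens_mul]
  congr 1
  ext1 j
  by_cases h : j = i
  · subst h; simp
  · simp [h]

lemma pauli_mul_self (p : Bool × ι) : pauli p * pauli p = 1 := by
  have := tens_update_mul (α := fun _ : ι => Bool) p.2 (sig p.1) (sig p.1)
  refine this.trans ?_
  rw [sig_mul_self]
  refine Eq.trans ?_ (tens_one (α := fun _ : ι => Bool))
  rw [Function.update_eq_self_iff.2 rfl]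

lemma pauli_mul_comm (p q : Bool × ι) : pauli p * pauli q = csign p q • (pauli q * pauli p) := by
  obtain ⟨a, i⟩ := p
  obtain ⟨b, j⟩ := q
  ext x y
  rw [Matrix.smul_apply]
  by_cases hij : i = j
  · subst hij
    cases a <;> cases b <;>
      simp [csign, pauli_false_mul, pauli_true_mul, pauli_false, pauli_true, sgn_not]
    · split_ifs with h h' h' <;> simp_all
    · split_ifs with h h' h' <;> simp_all
  · have hij' := Ne.symm hij
    have hcomm : toggle (toggle x i) j = toggle (toggle x j) i := by
      simp [toggle, hij, hij', Function.update_comm hij]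
    cases a <;> cases b <;>
      simp [csign, pauli_false_mul, pauli_true_mul, pauli_false, pauli_true, hij, hij', hcomm]
    · by_cases h : y = toggle x i
      · subst h; simp
      · simp [h, Ne.symm h]
    · by_cases h : y = toggle x j
      · subst h; simp
      · simp [h, Ne.symm h]
    · split_ifs <;> ring

end Pauli

/-! ### Operators on some of the qubits -/

section Lift

variable {κ ι : Type} [Fintype κ] [DecidableEq κ] [Fintype ι] [DecidableEq ι] (f : κ ↪ ι)

lemma lift_apply_extend (A : Op κ) (x : ι → Bool) (w : κ → Bool) :
    lift f A x (Function.extend f w x) = A (x ∘ f) w := by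
  have h1 : ∀ i, i ∉ Set.range f → x i = Function.extend f w x i := fun i hi =>
    (Function.extend_apply' _ _ _ hi).symm
  have h2 : Function.extend f w x ∘ f = w := by
    ext a; simp [f.injective.extend_apply]
  rw [lift, if_pos h1, h2]

lemma eq_extend {x y : ι → Bool} (h : ∀ i, i ∉ Set.range f → x i = y i) :
    y = Function.extend f (y ∘ f) x := by
  ext i
  by_cases hi : i ∈ Set.range f
  · obtain ⟨a, rfl⟩ := hi; simp [f.injective.extend_apply]
  · rw [Function.extend_apply' _ _ _ hi, h i hi]

lemma lift_apply_of_ne {A : Op κ} {x y : ι → Bool} {i : ι} (hi : i ∉ Set.range f)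
    (h : x i ≠ y i) : lift f A x y = 0 := by
  rw [lift, if_neg]; exact fun h' => h (h' i hi)

/-- A sum weighted with matrix elements of `lift f A` runs over the values at the qubits in the
range of `f`. -/
lemma sum_lift {E : Type*} [AddCommMonoid E] [Module ℂ E] (A : Op κ) (x : ι → Bool)
    (v : (ι → Bool) → E) :
    ∑ y, lift f A x y • v y = ∑ w, A (x ∘ f) w • v (Function.extend f w x) := by
  symm
  refine Fintype.sum_of_injective (fun w : κ → Bool => Function.extend f w x) ?_ _ _ ?_ ?_
  · intro w w' h
    ext a
    simpa [f.injective.extend_apply] using congrFun h (f a)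
  · intro y hy
    rw [lift, if_neg, zero_smul]
    exact fun h => hy ⟨y ∘ f, (eq_extend f h).symm⟩
  · intro w; simp only [lift_apply_extend]

lemma lift_mul (A B : Op κ) : lift f (A * B) = lift f A * lift f B := by
  ext x z
  rw [Matrix.mul_apply]
  have := sum_lift f A x (fun y => lift f B y z)
  simp only [smul_eq_mul] at this
  rw [this]
  have h1 : ∀ w, (∀ i, i ∉ Set.range f → Function.extend f w x i = z i) ↔
      (∀ i, i ∉ Set.range f → x i = z i) := fun w =>
    forall₂_congr fun i hi => by rw [Function.extend_apply' _ _ _ hi]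
  have h2 : ∀ w, Function.extend f w x ∘ f = w := fun w => by
    ext a; simp [f.injective.extend_apply]
  simp only [lift, h1, h2]
  split_ifs <;> simp [Matrix.mul_apply]

lemma lift_one : lift f (1 : Op κ) = 1 := by
  ext x y
  by_cases h : x = y
  · subst h; simp [lift]
  · rw [Matrix.one_apply_ne h, lift]
    split_ifs with h'
    · refine Matrix.one_apply_ne fun hf => h ?_
      ext i
      by_cases hi : i ∈ Set.range f
      · obtain ⟨a, rfl⟩ := hi; exact congrFun hf a
      · exact h' i hi
    · rfl

lemma lift_conjTranspose (A : Op κ) : (lift f A).conjTranspose = lift f A.conjTranspose := by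
  ext x y
  simp only [Matrix.conjTranspose_apply, lift, eq_comm (a := x _)]
  split_ifs <;> simp

lemma lift_smul (c : ℂ) (A : Op κ) : lift f (c • A) = c • lift f A := by
  ext x y; simp [lift]

lemma lift_add (A B : Op κ) : lift f (A + B) = lift f A + lift f B := by
  ext x y; simp only [lift, Matrix.add_apply]; split_ifs <;> simp

/-- `lift f` as a homomorphism of rings. -/
noncomputable def liftHom : Op κ →+* Op ι where
  toFun := lift f
  map_one' := lift_one f
  map_mul' := lift_mul f
  map_zero' := by ext x y; simp [lift]
  map_add' := lift_add f

lemma lift_sum {J : Type*} (s : Finset J) (A : J → Op κ) :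
    lift f (∑ j ∈ s, A j) = ∑ j ∈ s, lift f (A j) := map_sum (liftHom f) A s

lemma lift_sub (A B : Op κ) : lift f (A - B) = lift f A - lift f B := map_sub (liftHom f) A B

lemma lift_pauli (p : Bool) (a : κ) : lift f (pauli (p, a)) = pauli (p, f a) := by
  ext x y
  cases p
  · rw [pauli_false, lift]
    simp only [pauli_false]
    by_cases h : y = toggle x (f a)
    · subst h
      rw [if_pos rfl, if_pos, if_pos]
      · ext b
        by_cases hb : b = a
        · subst hb; simp
        · simp [hb]
      · intro i hi
        rw [toggle_of_ne]
        rintro rfl; exact hi ⟨a, rfl⟩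
    · rw [if_neg h]
      split_ifs with h1 h2
      · refine absurd ?_ h
        ext i
        by_cases hi : i ∈ Set.range f
        · obtain ⟨b, rfl⟩ := hi
          have := congrFun h2 b
          by_cases hb : b = a
          · subst hb; simpa using this
          · simpa [hb] using this
        · rw [toggle_of_ne, h1 i hi]
          rintro rfl; exact hi ⟨a, rfl⟩
      · rfl
      · rfl
  · rw [pauli_true, lift]
    simp only [pauli_true]
    by_cases h : x = y
    · subst h; simp
    · rw [if_neg h]
      split_ifs with h1 h2
      · refine absurd ?_ h
        ext i
        by_cases hi : i ∈ Set.range f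
        · obtain ⟨b, rfl⟩ := hi
          exact congrFun h2 b
        · exact h1 i hi
      · rfl
      · rfl

lemma lift_wordOp (l : List (Bool × κ)) :
    lift f (wordOp pauli l) = wordOp pauli (l.map fun p => (p.1, f p.2)) := by
  refine (map_list_prod (liftHom f) _).trans ?_
  rw [wordOp, List.map_map, List.map_map]
  congr 2
  ext1 p
  exact lift_pauli f p.1 p.2

/-- Pauli operators at qubits on which `lift f A` does not act commute with it. -/
lemma commute_pauli_lift (A : Op κ) (p : Bool) {w : ι} (hw : w ∉ Set.range f) :
    Commute (pauli (p, w)) (lift f A) := by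
  have hne : ∀ a, f a ≠ w := fun a ha => hw ⟨a, ha⟩
  ext x y
  cases p
  · rw [pauli_false_mul, mul_pauli_false, lift, lift]
    have h1 : ∀ z : ι → Bool, toggle z w ∘ f = z ∘ f := fun z => by
      ext a; simp [hne a]
    rw [h1, h1]
    congr 1
    refine propext (forall₂_congr fun i _ => ?_)
    by_cases hi : i = w
    · subst hi; simp
    · simp [hi]
  · rw [pauli_true_mul, mul_pauli_true]
    by_cases h : x w = y w
    · rw [h, mul_comm]
    · rw [lift_apply_of_ne f hw h]; simp

/-- An operator on some of the tensor factors, as a tensor product. -/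
lemma lift_tens (B : κ → Matrix Bool Bool ℂ) :
    lift f (tens B) = tens (Function.extend f B 1) := by
  ext x y
  rw [tens_apply, lift]
  split_ifs with h
  · rw [tens_apply, ← Finset.prod_subset (Finset.subset_univ (Finset.univ.map f))]
    · simp [f.injective.extend_apply]
    · intro i _ hi
      have hi' : i ∉ Set.range f := by simpa using hi
      rw [Function.extend_apply' _ _ _ hi']
      rw [h i hi']; exact Matrix.one_apply_eq _
  · push Not at h
    obtain ⟨i, hi, hne⟩ := h
    refine (Finset.prod_eq_zero (Finset.mem_univ i) ?_).symm
    rw [Function.extend_apply' _ _ _ hi]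
    exact Matrix.one_apply_ne hne

lemma lift_mem_unitary {U : Op κ} (hU : U ∈ Matrix.unitaryGroup (κ → Bool) ℂ) :
    lift f U ∈ Matrix.unitaryGroup (ι → Bool) ℂ := by
  rw [Matrix.mem_unitaryGroup_iff', Matrix.star_eq_conjTranspose] at hU ⊢
  rw [lift_conjTranspose, ← lift_mul, hU, lift_one]

end Lift

/-! ### Expansion in Pauli operators -/

section Expansion

/-- The character `x ↦ (-1) ^ (b · x)`. -/
def chi {ι : Type*} [Fintype ι] (b x : ι → Bool) : ℂ := ∏ i, sgn (b i && x i)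

lemma chi_comm {ι : Type*} [Fintype ι] (b x : ι → Bool) : chi b x = chi x b := by
  simp [chi, Bool.and_comm]

lemma norm_chi {ι : Type*} [Fintype ι] (b x : ι → Bool) : ‖chi b x‖ = 1 := by
  simp [chi, norm_prod]

lemma star_chi {ι : Type*} [Fintype ι] (b x : ι → Bool) : star (chi b x) = chi b x := by
  simp only [chi, star_prod, star_sgn]

lemma chi_toggle {ι : Type*} [Fintype ι] [DecidableEq ι] (b x : ι → Bool) (j : ι) :
    chi (toggle b j) x = sgn (x j) * chi b x := by
  rw [chi, chi, ← Finset.mul_prod_erase _ _ (Finset.mem_univ j),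
    ← Finset.mul_prod_erase _ (fun i => sgn (b i && x i)) (Finset.mem_univ j), ← mul_assoc]
  congr 1
  · rw [toggle_self]; cases b j <;> cases x j <;> simp
  · refine Finset.prod_congr rfl fun i hi => ?_
    rw [toggle_of_ne _ (Finset.ne_of_mem_erase hi)]

lemma sum_chi_mul_chi {ι : Type*} [Fintype ι] [DecidableEq ι] (x y : ι → Bool) :
    ∑ b, chi b x * chi b y = if x = y then 2 ^ Fintype.card ι else 0 := by
  have h1 : ∀ i, ∑ b : Bool, sgn (b && x i) * sgn (b && y i) = if x i = y i then 2 else 0 := by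
    intro i
    cases x i <;> cases y i <;> norm_num
  simp only [chi, ← Finset.prod_mul_distrib]
  rw [← Fintype.prod_sum (fun (i : ι) (b : Bool) => sgn (b && x i) * sgn (b && y i))]
  simp only [h1]
  split_ifs with h
  · subst h; simp
  · obtain ⟨i, hi⟩ := Function.ne_iff.1 h
    exact Finset.prod_eq_zero (Finset.mem_univ i) (by simp [hi])

/-- The letters of the Pauli monomials on `s` qubits: first the `X`, then the `Z` operators. -/
def letters (s : ℕ) : List (Bool × Fin s) :=
  (List.finRange s).map (false, ·) ++ (List.finRange s).map (true, ·)

lemma length_letters (s : ℕ) : (letters s).length = 2 * s := by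
  simp [letters]; ring

/-- The addition of bit vectors. -/
def bxor {ι : Type*} (x a : ι → Bool) : ι → Bool := fun i => xor (x i) (a i)

variable {s : ℕ}

/-- A word in the operators `X` is a permutation matrix. -/
lemma wordOp_X (g : Bool × Fin s → Bool) (l : List (Fin s)) (hl : l.Nodup)
    (x y : Fin s → Bool) :
    wordOp pauli ((l.map (false, ·)).filter g) x y =
      if y = (fun i => if i ∈ l then xor (x i) (g (false, i)) else x i) then 1 else 0 := by
  induction l generalizing x with
  | nil => simp [Matrix.one_apply, eq_comm]
  | cons i l ih =>
    rw [List.nodup_cons] at hl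
    have ih := ih hl.2
    rw [List.map_cons, List.filter_cons]
    cases hg : g (false, i)
    · rw [if_neg (by simp), ih]
      congr 2
      ext j
      by_cases hj : j = i
      · subst hj; simp [hl.1, hg]
      · simp [hj]
    · rw [if_pos rfl, wordOp, List.map_cons, List.prod_cons, pauli_false_mul, ← wordOp, ih]
      congr 2
      ext j
      by_cases hj : j = i
      · subst hj; simp [hl.1, hg]
      · simp [hj]

/-- A word in the operators `Z` is a diagonal matrix. -/
lemma wordOp_Z (g : Bool × Fin s → Bool) (l : List (Fin s)) (x y : Fin s → Bool) :
    wordOp pauli ((l.map (true, ·)).filter g) x y =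
      if x = y then (l.map fun i => sgn (g (true, i) && x i)).prod else 0 := by
  induction l generalizing x with
  | nil => simp [Matrix.one_apply]
  | cons i l ih =>
    rw [List.map_cons, List.filter_cons]
    cases hg : g (true, i)
    · rw [if_neg (by simp), ih]; simp [hg]
    · rw [if_pos rfl, wordOp, List.map_cons, List.prod_cons, pauli_true_mul, ← wordOp, ih]
      split_ifs with h
      · subst h; simp [hg]
      · simp

/-- A Pauli monomial adds the exponents of the letters `X` to a string, with the character given by
the exponents of the letters `Z` as a factor. -/
lemma wordOp_letters (g : Bool × Fin s → Bool) (x y : Fin s → Bool) :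
    wordOp pauli ((letters s).filter g) x y =
      if y = bxor x (fun i => g (false, i)) then chi (fun i => g (true, i)) y else 0 := by
  rw [letters, List.filter_append, wordOp, List.map_append, List.prod_append, Matrix.mul_apply,
    ← wordOp, ← wordOp]
  simp only [wordOp_X g _ (List.nodup_finRange s), wordOp_Z, List.mem_finRange, if_true, ite_mul,
    one_mul, zero_mul]
  rw [Finset.sum_ite_eq' Finset.univ, if_pos (Finset.mem_univ _)]
  have : (fun i => xor (x i) (g (false, i))) = bxor x fun i => g (false, i) := rfl
  rw [this]
  by_cases h : y = bxor x fun i => g (false, i)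
  · rw [if_pos h, if_pos h.symm, ← h, chi, ← Fin.prod_univ_def]
  · rw [if_neg h, if_neg (Ne.symm h)]

lemma sum_letters {E : Type*} [AddCommMonoid E]
    (F : (Fin s → Bool) → (Fin s → Bool) → E) :
    ∑ g : Bool × Fin s → Bool, F (fun i => g (false, i)) (fun i => g (true, i)) =
      ∑ a, ∑ b, F a b := by
  rw [← Fintype.sum_prod_type', ← Equiv.sum_comp ((Equiv.curry Bool (Fin s) Bool).trans
    (Equiv.boolArrowEquivProd _))]
  rfl

/-- Every operator is a combination of Pauli monomials, with coefficients that satisfy every bound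
satisfied by the matrix elements of the operator. -/
lemma exists_pauli_expansion (A : Op (Fin s)) :
    ∃ c : (Bool × Fin s → Bool) → ℂ,
      (∀ r : ℝ, (∀ x y, ‖A x y‖ ≤ r) → ∀ g, ‖c g‖ ≤ r) ∧
      A = ∑ g, c g • wordOp pauli ((letters s).filter g) := by
  set c : (Fin s → Bool) → (Fin s → Bool) → ℂ := fun a b =>
    (2 ^ s : ℂ)⁻¹ * ∑ x, chi b (bxor x a) * A x (bxor x a) with hc
  refine ⟨fun g => c (fun i => g (false, i)) (fun i => g (true, i)), ?_, ?_⟩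
  · intro r hr g
    have h2 : (0 : ℝ) < 2 ^ s := by positivity
    rw [hc, norm_mul, norm_inv, norm_pow, Complex.norm_ofNat, inv_mul_le_iff₀ h2]
    refine (norm_sum_le _ _).trans ?_
    refine (Finset.sum_le_card_nsmul _ _ r fun x _ => ?_).trans_eq ?_
    · rw [norm_mul, norm_chi, one_mul]; exact hr _ _
    · simp
  · ext x y
    rw [Matrix.sum_apply]
    simp only [Matrix.smul_apply, wordOp_letters, smul_eq_mul]
    rw [sum_letters (fun a b => c a b * if y = bxor x a then chi b y else 0)]
    simp only [mul_ite, mul_zero]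
    rw [Finset.sum_eq_single (bxor x y)]
    · have hxy : y = bxor x (bxor x y) := by
        ext i; simp [bxor]
      simp only [if_pos hxy, hc]
      have h1 : ∀ x' : Fin s → Bool, ∑ b : Fin s → Bool,
          chi b (bxor x' (bxor x y)) * chi b y = if x' = x then (2 : ℂ) ^ s else 0 := by
        intro x'
        rw [sum_chi_mul_chi, Fintype.card_fin]
        congr 1
        refine propext ⟨fun h => ?_, fun h => ?_⟩
        · ext i
          have := congrFun h i
          simp only [bxor] at this
          revert this
          cases x' i <;> cases x i <;> cases y i <;> simp
        · rw [h, ← hxy]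
      simp only [mul_assoc, Finset.sum_mul]
      rw [← Finset.mul_sum, Finset.sum_comm]
      have h2 : ∀ x' : Fin s → Bool, ∑ b : Fin s → Bool, chi b (bxor x' (bxor x y)) *
          (A x' (bxor x' (bxor x y)) * chi b y) =
          if x' = x then (2 : ℂ) ^ s * A x' (bxor x' (bxor x y)) else 0 := by
        intro x'
        have := congrArg (· * A x' (bxor x' (bxor x y))) (h1 x')
        simp only [Finset.sum_mul, ite_mul, zero_mul] at this
        rw [← this]
        exact Finset.sum_congr rfl fun b _ => by ring
      simp only [h2]
      rw [Finset.sum_ite_eq' Finset.univ, if_pos (Finset.mem_univ _), ← hxy, ← mul_assoc,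
        inv_mul_cancel₀ (by positivity), one_mul]
    · intro a _ ha
      refine Finset.sum_eq_zero fun b _ => ?_
      rw [if_neg]
      rintro rfl
      apply ha
      ext i; simp [bxor]
    · simp

end Expansion

/-! ### The decoder of the five-qubit code -/

section Decoder

/-- The parity of a string of five bits. -/
def parity (x : Fin 5 → Bool) : Bool := xor (x 0) (xor (x 1) (xor (x 2) (xor (x 3) (x 4))))

/-- The parity of the number of cyclically adjacent pairs of ones. -/
def quad (x : Fin 5 → Bool) : Bool :=
  xor (x 0 && x 1) (xor (x 1 && x 2) (xor (x 2 && x 3) (xor (x 3 && x 4) (x 4 && x 0))))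

/-- The inner product of `x` with the string of even weight that is the `Z`-type error with
syndrome `z 1, …, z 4`. -/
def syndromePhase (z x : Fin 5 → Bool) : Bool :=
  xor (xor (z 1) (xor (z 2) (z 3)) && x 0) (xor (xor (z 2) (xor (z 3) (z 4)) && x 1)
    (xor (xor (z 1) (z 2) && x 2) (xor (xor (z 2) (z 3) && x 3) (xor (z 3) (z 4) && x 4))))

/-- The unitary that decodes the five-qubit code: the logical qubit is put on qubit `0`, the
syndromes on the others. Its adjoint maps `|b, s⟩` to the logical state `b` with a `Z`-type error
applied to it. As the error has even weight, it commutes with the logical operators `X ⊗ ⋯ ⊗ X`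
and `Z ⊗ ⋯ ⊗ Z`, so that the decoder turns these into `X` and `Z` on qubit `0` on the whole
space, not just on the code. -/
noncomputable def decoder : Op (Fin 5) := Matrix.of fun z x =>
  if parity x = z 0 then sgn (xor (syndromePhase z x) (xor (quad x) (z 0))) / 4 else 0

/-- The stabilizer whose syndrome is put on qubit `w ≠ 0` by the decoder. -/
def stab (w i : Fin 5) : Matrix Bool Bool ℂ :=
  if i = w + 4 ∨ i = w + 2 then sig false else if i = w ∨ i = w + 1 then sig true else 1

lemma tens_stab (w : Fin 5) : tens (stab w) =
    pauli (false, w + 4) * pauli (false, w + 2) * pauli (true, w) * pauli (true, w + 1) := by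
  simp only [pauli, tens_mul]
  congr 1
  ext1 i
  fin_cases w <;> fin_cases i <;> simp [stab]

lemma tens_sig (p : Bool) : tens (fun _ : Fin 5 => sig p) =
    pauli (p, 0) * pauli (p, 1) * pauli (p, 2) * pauli (p, 3) * pauli (p, 4) := by
  simp only [pauli, tens_mul]
  congr 1
  ext1 i
  fin_cases i <;> simp

lemma decoder_eq_of {x x' : Fin 5 → Bool} {z z' : Fin 5 → Bool} {b : Bool}
    (h1 : parity x = z 0 ↔ parity x' = z' 0)
    (h2 : parity x' = z' 0 → xor (syndromePhase z x) (xor (quad x) (z 0)) =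
      xor b (xor (syndromePhase z' x') (xor (quad x') (z' 0)))) :
    decoder z x = sgn b * decoder z' x' := by
  simp only [decoder, Matrix.of_apply, h1]
  split_ifs with h
  · rw [h2 h, sgn_xor]; ring
  · simp

/-- The stabilizers become `Z` on the qubits that carry the syndromes. The entries of both sides
can differ only in a sign, the exponent of which is a Boolean function of ten bits. -/
lemma decoder_mul_stab {w : Fin 5} (hw : w ≠ 0) :
    decoder * tens (stab w) = pauli (true, w) * decoder := by
  ext z x
  rw [tens_stab, pauli_true_mul, ← mul_assoc, ← mul_assoc, ← mul_assoc, mul_pauli_true,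
    mul_pauli_true, mul_pauli_false, mul_pauli_false]
  rw [decoder_eq_of (b := xor (z w) (xor (x w) (x (w + 1)))) (z' := z) (x' := x), sgn_xor, sgn_xor]
  · linear_combination sgn (z w) * decoder z x * (sgn (x w) * sgn (x w) *
      sgn_mul_self (x (w + 1)) + sgn_mul_self (x w))
  · fin_cases w <;> simp [parity, toggle]
  · intro _
    generalize hx0 : x 0 = x0
    generalize hx1 : x 1 = x1
    generalize hx2 : x 2 = x2
    generalize hx3 : x 3 = x3
    generalize hx4 : x 4 = x4
    generalize hz1 : z 1 = z1
    generalize hz2 : z 2 = z2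
    generalize hz3 : z 3 = z3
    generalize hz4 : z 4 = z4
    fin_cases w
    · exact absurd rfl hw
    all_goals
      simp [syndromePhase, quad, toggle, hx0, hx1, hx2, hx3, hx4, hz1,
        hz2, hz3, hz4]
      generalize z 0 = z0
      clear * -
      revert x0 x1 x2 x3 x4 z0 z1 z2 z3 z4
      decide

/-- The logical operators `X ⊗ ⋯ ⊗ X` and `Z ⊗ ⋯ ⊗ Z` become `X` and `Z` on qubit `0`. -/
lemma pauli_mul_decoder (p : Bool) :
    pauli (p, 0) * decoder = decoder * tens (fun _ => sig p) := by
  ext z x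
  rw [tens_sig]
  simp only [← mul_assoc]
  cases p
  · simp only [pauli_false_mul, mul_pauli_false]
    rw [← one_mul (decoder (toggle z 0) x), ← sgn_false, eq_comm]
    refine decoder_eq_of ?_ fun h => ?_
    · simp [parity, toggle]
    · clear h
      simp [syndromePhase, quad, toggle]
      generalize x 0 = x0
      generalize x 1 = x1
      generalize x 2 = x2
      generalize x 3 = x3
      generalize x 4 = x4
      generalize z 0 = z0
      generalize z 1 = z1
      generalize z 2 = z2
      generalize z 3 = z3
      generalize z 4 = z4
      clear * -
      revert x0 x1 x2 x3 x4 z0 z1 z2 z3 z4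
      decide
  · simp only [pauli_true_mul, mul_pauli_true, decoder, Matrix.of_apply]
    split_ifs with h
    · rw [← h, parity]
      simp only [sgn_xor]
      ring
    · simp

lemma tens_sig_conjTranspose (p : Bool) :
    (tens (fun _ : Fin 5 => sig p)).conjTranspose = tens (fun _ : Fin 5 => sig p) := by
  simp only [tens_conjTranspose, sig_conjTranspose]

lemma stab_conjTranspose (w i : Fin 5) : (stab w i).conjTranspose = stab w i := by
  rw [stab]; split_ifs <;> simp [sig_conjTranspose]

lemma decoder_mem_unitary : decoder ∈ Matrix.unitaryGroup (Fin 5 → Bool) ℂ := by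
  rw [Matrix.mem_unitaryGroup_iff, Matrix.star_eq_conjTranspose]
  -- the Gram matrix of the rows commutes with all `Z` operators, hence it is diagonal
  have hcomm : ∀ w, pauli (true, w) * (decoder * decoder.conjTranspose) =
      decoder * decoder.conjTranspose * pauli (true, w) := by
    intro w
    obtain ⟨S, hS, hd⟩ : ∃ S : Op (Fin 5), S.conjTranspose = S ∧
        pauli (true, w) * decoder = decoder * S := by
      by_cases hw : w = 0
      · subst hw; exact ⟨_, tens_sig_conjTranspose true, pauli_mul_decoder true⟩
      · refine ⟨_, ?_, (decoder_mul_stab hw).symm⟩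
        simp only [tens_conjTranspose, stab_conjTranspose]
    have h2 := congrArg Matrix.conjTranspose hd
    rw [Matrix.conjTranspose_mul, Matrix.conjTranspose_mul, hS, pauli_conjTranspose] at h2
    rw [← mul_assoc, hd, mul_assoc, mul_assoc, h2]
  ext z z'
  by_cases h : z = z'
  · subst h
    have hcard : ∀ b, (Finset.univ.filter fun x : Fin 5 → Bool => parity x = b).card = 16 := by
      decide
    rw [Matrix.one_apply_eq, Matrix.mul_apply]
    have : ∀ x, decoder z x * decoder.conjTranspose x z =
        if parity x = z 0 then (1 / 16 : ℂ) else 0 := by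
      intro x
      simp only [Matrix.conjTranspose_apply, decoder, Matrix.of_apply]
      split_ifs
      · have h4 : star (sgn (syndromePhase z x ^^ (quad x ^^ z 0)) / 4 : ℂ) =
            sgn (syndromePhase z x ^^ (quad x ^^ z 0)) / 4 := by
          rw [star_div₀, star_sgn]; simp
        rw [h4]
        linear_combination (1 / 16 : ℂ) * sgn_mul_self (syndromePhase z x ^^ (quad x ^^ z 0))
      · simp
    rw [Finset.sum_congr rfl fun x _ => this x, ← Finset.sum_filter, Finset.sum_const, hcard]
    norm_num
  · rw [Matrix.one_apply_ne h]
    obtain ⟨w, hw⟩ := Function.ne_iff.1 h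
    have h1 := congrFun (congrFun (hcomm w) z) z'
    rw [pauli_true_mul, mul_pauli_true] at h1
    generalize (decoder * decoder.conjTranspose) z z' = g at h1
    revert h1 hw
    cases z w <;> cases z' w <;> simp [self_eq_neg, neg_eq_self]

lemma decoder_algebraic (z x : Fin 5 → Bool) : IsAlgebraic ℚ (decoder z x) := by
  rw [decoder, Matrix.of_apply]
  split_ifs
  · have : ∀ b, (sgn b / 4 : ℂ) = algebraMap ℚ ℂ ((if b then -1 else 1) / 4) := by
      intro b; cases b <;> simp [sgn]
    rw [this]
    exact isAlgebraic_algebraMap _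
  · exact isAlgebraic_zero

/-- The logical basis states are rows of the decoder. -/
lemma codeword_eq_decoder (b : Bool) (x : Fin 5 → Bool) :
    codeword b x = decoder (Function.update (fun _ => false) 0 b) x := by
  have h1 : ∀ (x : Fin 5 → Bool) (b : Bool),
      (Finset.univ.filter (fun i => x i = true)).card % 2 = b.toNat ↔ parity x = b := by decide
  have h2 : ∀ (x : Fin 5 → Bool),
      (Finset.univ.filter (fun i => x i = true ∧ x (i + 1) = true)).card % 2 =
        (quad x).toNat := by decide
  have h3 : ∀ m : ℕ, ∀ c : Bool, m % 2 = c.toNat → (-1 : ℂ) ^ m = sgn c := by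
    intro m c h
    rw [neg_one_pow_eq_pow_mod_two, h]
    cases c <;> simp
  rw [codeword, decoder, Matrix.of_apply, Function.update_self]
  simp only [h1]
  have h4 : syndromePhase (Function.update (fun _ => false) 0 b) x = false := by
    simp [syndromePhase]
  rw [h4, Bool.false_xor, sgn_xor, pow_add, h3 _ _ (h2 x)]
  congr 2
  cases b <;> simp

end Decoder

/-! ### Strategies as isometries -/

section Vectors

open scoped InnerProductSpace

variable {m n l : Type*} [Fintype m] [Fintype n] [Fintype l] [DecidableEq m] [DecidableEq n]
  [DecidableEq l]

/-- A matrix as a map between Euclidean spaces. -/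
noncomputable def cl (M : Matrix m n ℂ) : EuclideanSpace ℂ n →L[ℂ] EuclideanSpace ℂ m :=
  LinearMap.toContinuousLinearMap (Matrix.toEuclideanLin M)

lemma cl_apply (M : Matrix m n ℂ) (v : EuclideanSpace ℂ n) :
    cl M v = WithLp.toLp 2 (M.mulVec v.ofLp) := rfl

lemma cl_mul (M : Matrix m n ℂ) (N : Matrix n l ℂ) (v : EuclideanSpace ℂ l) :
    cl (M * N) v = cl M (cl N v) := by
  simp [cl_apply, Matrix.mulVec_mulVec]

lemma cl_one : cl (1 : Matrix n n ℂ) = 1 := by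
  ext1 v; simp [cl_apply]

lemma cl_smul (c : ℂ) (M : Matrix m n ℂ) (v : EuclideanSpace ℂ n) :
    cl (c • M) v = c • cl M v := by
  simp [cl_apply, Matrix.smul_mulVec]

/-- `cl` on square matrices, as a homomorphism of monoids. -/
noncomputable def clHom : Matrix n n ℂ →* (EuclideanSpace ℂ n →L[ℂ] EuclideanSpace ℂ n) where
  toFun := cl
  map_one' := cl_one
  map_mul' M N := by ext1 v; exact cl_mul M N v

lemma clHom_apply (M : Matrix n n ℂ) : clHom M = cl M := rfl

lemma cl_sum {J : Type*} (s : Finset J) (M : J → Matrix m n ℂ) (v : EuclideanSpace ℂ n) :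
    cl (∑ j ∈ s, M j) v = ∑ j ∈ s, cl (M j) v := by
  simp [cl]

lemma inner_cl (M : Matrix m n ℂ) (u : EuclideanSpace ℂ m) (v : EuclideanSpace ℂ n) :
    ⟪u, cl M v⟫_ℂ = ⟪cl M.conjTranspose u, v⟫_ℂ := by
  have h : cl M.conjTranspose u = LinearMap.adjoint (Matrix.toEuclideanLin M) u := by
    rw [← Matrix.toEuclideanLin_conjTranspose_eq_adjoint]; rfl
  rw [h, LinearMap.adjoint_inner_left]; rfl

lemma norm_cl_sq (M : Matrix m n ℂ) (v : EuclideanSpace ℂ n) :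
    ‖cl M v‖ ^ 2 = (⟪v, cl (M.conjTranspose * M) v⟫_ℂ).re := by
  rw [cl_mul, inner_cl, Matrix.conjTranspose_conjTranspose, ← inner_self_eq_norm_sq (𝕜 := ℂ)]
  rfl

lemma norm_cl_of_isometry {M : Matrix m n ℂ} (h : M.conjTranspose * M = 1)
    (v : EuclideanSpace ℂ n) : ‖cl M v‖ = ‖v‖ := by
  have := norm_cl_sq M v
  rw [h, cl_one] at this
  have h2 : RCLike.re ⟪v, v⟫_ℂ = ‖v‖ ^ 2 := inner_self_eq_norm_sq v
  exact (sq_eq_sq₀ (norm_nonneg _) (norm_nonneg _)).1 (this.trans h2)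

/-- The adjoint of an isometry is a contraction; the defect is the distance from the range. -/
lemma norm_sub_proj_sq {M : Matrix m n ℂ} (h : M.conjTranspose * M = 1)
    (u : EuclideanSpace ℂ m) :
    ‖u - cl M (cl M.conjTranspose u)‖ ^ 2 = ‖u‖ ^ 2 - ‖cl M.conjTranspose u‖ ^ 2 := by
  rw [@norm_sub_sq ℂ, inner_cl, norm_cl_of_isometry h]
  have : RCLike.re ⟪cl M.conjTranspose u, cl M.conjTranspose u⟫_ℂ = ‖cl M.conjTranspose u‖ ^ 2 :=
    inner_self_eq_norm_sq _
  rw [this]; ring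

lemma norm_cl_conjTranspose_le {M : Matrix m n ℂ} (h : M.conjTranspose * M = 1)
    (u : EuclideanSpace ℂ m) : ‖cl M.conjTranspose u‖ ≤ ‖u‖ := by
  have := norm_sub_proj_sq h u
  exact le_of_sq_le_sq (by nlinarith [sq_nonneg ‖u - cl M (cl M.conjTranspose u)‖]) (norm_nonneg _)

lemma isState_iff {n : Type} [Fintype n] (ψ : n → ℂ) : IsState ψ ↔ ‖WithLp.toLp 2 ψ‖ = 1 := by
  rw [IsState, ← sq_eq_sq₀ (norm_nonneg _) zero_le_one, EuclideanSpace.norm_sq_eq, one_pow]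

lemma expect_eq {n : Type} [Fintype n] [DecidableEq n] (A : Matrix n n ℂ) (ψ : n → ℂ) :
    expect A ψ = (⟪WithLp.toLp 2 ψ, cl A (WithLp.toLp 2 ψ)⟫_ℂ).re := by
  rw [expect, cl_apply, EuclideanSpace.inner_toLp_toLp, dotProduct_comm]

end Vectors

section Amp

variable {X A : Type*} [Fintype X] [Fintype A] [DecidableEq X]

open Classical in
/-- The operator `B` on the first factor of a product. -/
noncomputable def amp (A : Type*) [Fintype A] (B : Matrix X X ℂ) : Matrix (X × A) (X × A) ℂ :=
  Matrix.kroneckerMap (· * ·) B (1 : Matrix A A ℂ)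

lemma amp_mul (B C : Matrix X X ℂ) : amp A (B * C) = amp A B * amp A C := by
  classical
  simpa [amp] using Matrix.mul_kronecker_mul B C (1 : Matrix A A ℂ) 1

lemma amp_one [DecidableEq (X × A)] : amp A (1 : Matrix X X ℂ) = 1 := by
  classical
  have := Matrix.one_kronecker_one (α := ℂ) (m := X) (n := A)
  rw [amp]
  convert! this

lemma amp_conjTranspose (B : Matrix X X ℂ) :
    (amp A B).conjTranspose = amp A B.conjTranspose := by
  classical
  rw [amp, Matrix.conjTranspose_kronecker, Matrix.conjTranspose_one]; rfl

lemma amp_smul (c : ℂ) (B : Matrix X X ℂ) : amp A (c • B) = c • amp A B := by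
  classical
  rw [amp, Matrix.smul_kronecker]; rfl

lemma amp_add (B C : Matrix X X ℂ) : amp A (B + C) = amp A B + amp A C := by
  classical
  rw [amp, Matrix.add_kronecker]; rfl

lemma amp_sum {J : Type*} (s : Finset J) (B : J → Matrix X X ℂ) :
    amp A (∑ j ∈ s, B j) = ∑ j ∈ s, amp A (B j) :=
  map_sum (AddMonoidHom.mk' (amp A) amp_add) B s

lemma amp_mulVec (B : Matrix X X ℂ) (v : X × A → ℂ) (x : X) (e : A) :
    (amp A B).mulVec v (x, e) = B.mulVec (fun x => v (x, e)) x := by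
  classical
  simp only [Matrix.mulVec, dotProduct, amp, Matrix.kroneckerMap_apply, Fintype.sum_prod_type]
  refine Finset.sum_congr rfl fun y _ => ?_
  simp [Matrix.one_apply]

end Amp

/-! ### The operators of the provers -/

section Pull

open scoped InnerProductSpace

variable {k : ℕ} (σ : Strategy k)

/-- The joint operation of the provers on the questions `q`. -/
noncomputable def Strategy.answerMap (q : Fin 5 → List Bool) :
    Matrix ((Wire k → Bool) × (∀ t, σ.A t)) (∀ t, σ.P t) ℂ :=
  Matrix.of fun p y => ∏ t, σ.W t (q t) (fun l => p.1 (t, l), p.2 t) (y t)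

/-- The shared state as a vector of a Euclidean space. -/
noncomputable def Strategy.vec : EuclideanSpace ℂ (∀ t, σ.P t) := WithLp.toLp 2 σ.state

/-- The operator on the register of prover `t` that results when an operator on the answer
to the question `q` is pulled back along the isometry of the prover. -/
noncomputable def Strategy.localPull (t : Fin 5) (q : List Bool) (B : Op (Fin k)) :
    Matrix (σ.P t) (σ.P t) ℂ :=
  (σ.W t q).conjTranspose * amp (σ.A t) B * σ.W t q

/-- The operator on the registers of the provers that results when an operator on the answers
to the questions `q` is pulled back. -/
noncomputable def Strategy.pull (q : Fin 5 → List Bool) (B : Op (Wire k)) :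
    Matrix (∀ t, σ.P t) (∀ t, σ.P t) ℂ :=
  (σ.answerMap q).conjTranspose * amp (∀ t, σ.A t) B * σ.answerMap q

/-- The tensor product of operators on the answers of the five provers. -/
def tensW (B : Fin 5 → Op (Fin k)) : Op (Wire k) :=
  Matrix.of fun x y => ∏ t, B t (fun l => x (t, l)) (fun l => y (t, l))

/-- Answers and private registers, grouped by provers or not. -/
def groupEquiv (A : Fin 5 → Type) :
    (∀ t, (Fin k → Bool) × A t) ≃ (Wire k → Bool) × (∀ t, A t) where
  toFun f := (fun w => (f w.1).1 w.2, fun t => (f t).2)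
  invFun p := fun t => (fun l => p.1 (t, l), p.2 t)
  left_inv _ := rfl
  right_inv _ := rfl

lemma amp_tensW (A : Fin 5 → Type) [∀ t, Fintype (A t)] (B : Fin 5 → Op (Fin k)) :
    amp (∀ t, A t) (tensW B) =
      (tens fun t => amp (A t) (B t)).submatrix (groupEquiv A).symm (groupEquiv A).symm := by
  classical
  ext ⟨x, e⟩ ⟨x', e'⟩
  have h3 : (1 : Matrix (∀ t, A t) (∀ t, A t) ℂ) = tens fun t => 1 := tens_one.symm
  simp only [amp, Matrix.kroneckerMap_apply, Matrix.submatrix_apply, tens_apply, tensW,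
    Matrix.of_apply, groupEquiv, Equiv.coe_fn_symm_mk, Finset.prod_mul_distrib]
  congr 1
  convert! congrFun (congrFun h3 e) e'

lemma pull_tensW (q : Fin 5 → List Bool) (B : Fin 5 → Op (Fin k)) :
    σ.pull q (tensW B) = tens fun t => σ.localPull t (q t) (B t) := by
  have h1 : σ.answerMap q = (tens fun t => σ.W t (q t)).submatrix (groupEquiv σ.A).symm id := rfl
  rw [Strategy.pull, h1, amp_tensW, Matrix.conjTranspose_submatrix, Matrix.submatrix_mul_equiv,
    Matrix.submatrix_mul_equiv, tens_conjTranspose, tens_mul, tens_mul]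
  rfl

lemma tensW_mul (B C : Fin 5 → Op (Fin k)) :
    tensW B * tensW C = tensW fun t => B t * C t := by
  have h : ∀ D : Fin 5 → Op (Fin k), tensW D =
      (tens D).submatrix (Equiv.curry (Fin 5) (Fin k) Bool) (Equiv.curry (Fin 5) (Fin k) Bool) :=
    fun D => rfl
  rw [h, h, h, Matrix.submatrix_mul_equiv, tens_mul]

lemma tensW_one : tensW (fun _ => (1 : Op (Fin k))) = 1 := by
  have h : tensW (fun _ => (1 : Op (Fin k))) =
      (tens fun _ : Fin 5 => (1 : Op (Fin k))).submatrix (Equiv.curry (Fin 5) (Fin k) Bool)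
        (Equiv.curry (Fin 5) (Fin k) Bool) := rfl
  rw [h, tens_one, Matrix.submatrix_one_equiv]

lemma tensW_tens (B : Fin 5 → Fin k → Matrix Bool Bool ℂ) :
    tensW (fun t => tens (B t)) = tens fun w : Wire k => B w.1 w.2 := by
  ext x y
  simp only [tensW, tens_apply, Matrix.of_apply, Fintype.prod_prod_type]

variable {σ}

lemma localPull_one (hσ : σ.IsQuantum) (t : Fin 5) (q : List Bool) : σ.localPull t q 1 = 1 := by
  classical
  rw [Strategy.localPull, amp_one, Matrix.mul_one, hσ.2]

lemma pull_one (hσ : σ.IsQuantum) (q : Fin 5 → List Bool) : σ.pull q 1 = 1 := by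
  rw [← tensW_one, pull_tensW]
  simp only [localPull_one hσ, tens_one]

lemma answerMap_isometry (hσ : σ.IsQuantum) (q : Fin 5 → List Bool) :
    (σ.answerMap q).conjTranspose * σ.answerMap q = 1 := by
  classical
  have := pull_one hσ q
  rwa [Strategy.pull, amp_one, Matrix.mul_one] at this

lemma norm_vec (hσ : σ.IsQuantum) : ‖σ.vec‖ = 1 := (isState_iff _).1 hσ.1

lemma norm_amp_of_unitary {X A : Type*} [Fintype X] [Fintype A] [DecidableEq X] [DecidableEq A]
    {B : Matrix X X ℂ} (hB : B ∈ Matrix.unitaryGroup X ℂ) (u : EuclideanSpace ℂ (X × A)) :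
    ‖cl (amp A B) u‖ = ‖u‖ := by
  refine norm_cl_of_isometry ?_ u
  rw [amp_conjTranspose, ← amp_mul, ← Matrix.star_eq_conjTranspose,
    Matrix.mem_unitaryGroup_iff'.1 hB, amp_one]

open Classical in
lemma cl_pull (q : Fin 5 → List Bool) (B : Op (Wire k)) (v : EuclideanSpace ℂ (∀ t, σ.P t)) :
    cl (σ.pull q B) v =
      cl (σ.answerMap q).conjTranspose (cl (amp _ B) (cl (σ.answerMap q) v)) := by
  rw [Strategy.pull, cl_mul, cl_mul]

lemma pull_contraction (hσ : σ.IsQuantum) (q : Fin 5 → List Bool) {B : Op (Wire k)}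
    (hB : B ∈ Matrix.unitaryGroup _ ℂ) : IsContraction (cl (σ.pull q B)) := by
  classical
  intro v
  rw [cl_pull]
  refine (norm_cl_conjTranspose_le (answerMap_isometry hσ q) _).trans ?_
  rw [norm_amp_of_unitary hB, norm_cl_of_isometry (answerMap_isometry hσ q)]

/-- Pulling back is nearly multiplicative at `p` if the pull-back of `p` nearly preserves the
norm. -/
lemma norm_pull_mul_sub_sq_le (hσ : σ.IsQuantum) (q : Fin 5 → List Bool) {B p : Op (Wire k)}
    (hB : B ∈ Matrix.unitaryGroup _ ℂ) (hp : p ∈ Matrix.unitaryGroup _ ℂ)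
    (v : EuclideanSpace ℂ (∀ t, σ.P t)) :
    ‖cl (σ.pull q (B * p)) v - cl (σ.pull q B) (cl (σ.pull q p) v)‖ ^ 2 ≤
      ‖v‖ ^ 2 - ‖cl (σ.pull q p) v‖ ^ 2 := by
  classical
  have hW := answerMap_isometry hσ q
  simp only [cl_pull, amp_mul, cl_mul, ← map_sub]
  set u := cl (amp (∀ t, σ.A t) p) (cl (σ.answerMap q) v) with hu
  have hun : ‖u‖ = ‖v‖ := by rw [hu, norm_amp_of_unitary hp, norm_cl_of_isometry hW]
  rw [← hun, ← norm_sub_proj_sq hW]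
  gcongr
  refine (norm_cl_conjTranspose_le hW _).trans_eq ?_
  rw [norm_amp_of_unitary hB]

lemma norm_pull_sq_le (hσ : σ.IsQuantum) (q : Fin 5 → List Bool) (B : Op (Wire k))
    (v : EuclideanSpace ℂ (∀ t, σ.P t)) :
    ‖cl (σ.pull q B) v‖ ^ 2 ≤ (⟪v, cl (σ.pull q (B.conjTranspose * B)) v⟫_ℂ).re := by
  classical
  have h1 : (⟪v, cl (σ.pull q (B.conjTranspose * B)) v⟫_ℂ).re =
      ‖cl (amp (∀ t, σ.A t) B) (cl (σ.answerMap q) v)‖ ^ 2 := by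
    rw [norm_cl_sq, amp_conjTranspose, ← amp_mul, cl_pull, inner_cl,
      Matrix.conjTranspose_conjTranspose]
  rw [h1, cl_pull]
  gcongr
  exact norm_cl_conjTranspose_le (answerMap_isometry hσ q) _

lemma expect_conj {X : Type} [Fintype X] [DecidableEq X] (C D : Matrix X X ℂ) (v : X → ℂ) :
    expect (C.conjTranspose * D * C) v = expect D (C.mulVec v) := by
  rw [expect, expect, Matrix.star_mulVec, ← Matrix.dotProduct_mulVec, Matrix.mulVec_mulVec,
    Matrix.mulVec_mulVec, Matrix.mul_assoc]

lemma expect_pull (q : Fin 5 → List Bool) (B : Op (Wire k)) :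
    (⟪σ.vec, cl (σ.pull q B) σ.vec⟫_ℂ).re = ∑ e, expect B (σ.answer q e) := by
  classical
  rw [cl_pull, inner_cl, Matrix.conjTranspose_conjTranspose, cl_apply (amp _ B)]
  have h1 : (cl (σ.answerMap q) σ.vec) =
      WithLp.toLp 2 fun p : (Wire k → Bool) × (∀ t, σ.A t) => σ.answer q p.2 p.1 := rfl
  rw [h1, EuclideanSpace.inner_toLp_toLp, dotProduct_comm, dotProduct, Fintype.sum_prod_type,
    Finset.sum_comm, Complex.re_sum]
  refine Finset.sum_congr rfl fun e _ => ?_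
  simp only [amp_mulVec]
  rfl

lemma expect_diagonal {X : Type} [Fintype X] [DecidableEq X] (d : X → ℝ) (v : X → ℂ) :
    expect (Matrix.diagonal fun x => (d x : ℂ)) v = ∑ x, d x * ‖v x‖ ^ 2 := by
  rw [expect, dotProduct, Complex.re_sum]
  refine Finset.sum_congr rfl fun x _ => ?_
  rw [Matrix.mulVec_diagonal, Pi.star_apply, mul_left_comm, Complex.re_ofReal_mul, mul_comm (star _),
    ← Complex.normSq_eq_norm_sq, Complex.star_def, Complex.mul_conj, Complex.ofReal_re]

lemma expect_one {B : Type} [Fintype B] [DecidableEq B] (v : B → ℂ) :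
    expect (1 : Matrix B B ℂ) v = ∑ x, ‖v x‖ ^ 2 := by
  have := expect_diagonal (fun _ => (1 : ℝ)) v
  simpa using this

lemma expect_sub {B : Type} [Fintype B] (M N : Matrix B B ℂ) (v : B → ℂ) :
    expect (M - N) v = expect M v - expect N v := by
  simp [expect, Matrix.sub_mulVec, dotProduct_sub]

/-- The total weight of the answers. -/
lemma sum_norm_answer (hσ : σ.IsQuantum) (q : Fin 5 → List Bool) {C : Op (Wire k)}
    (hC : C ∈ Matrix.unitaryGroup _ ℂ) :
    ∑ e, ∑ x, ‖C.mulVec (σ.answer q e) x‖ ^ 2 = 1 := by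
  have h1 := expect_pull (σ := σ) q (C.conjTranspose * Matrix.diagonal (fun _ => ((1 : ℝ) : ℂ)) * C)
  simp only [expect_conj, expect_diagonal, one_mul] at h1
  rw [← h1, Complex.ofReal_one, Matrix.diagonal_one, mul_one, ← Matrix.star_eq_conjTranspose,
    Matrix.mem_unitaryGroup_iff'.1 hC, pull_one hσ, cl_one]
  have h2 : RCLike.re ⟪σ.vec, σ.vec⟫_ℂ = ‖σ.vec‖ ^ 2 := inner_self_eq_norm_sq _
  rw [norm_vec hσ] at h2
  exact h2.trans (one_pow 2)

end Pull

/-! ### Tests of the stabilizers -/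

section Tests

open scoped InnerProductSpace

variable {k n m : ℕ} {σ : Strategy k}

open scoped MatrixOrder Matrix.Norms.L2Operator in
lemma exists_eq_conjTranspose_mul_self {ι : Type} [Fintype ι] [DecidableEq ι] {A : Op ι}
    (hA : A.PosSemidef) : ∃ B : Op ι, A = B.conjTranspose * B :=
  CStarAlgebra.nonneg_iff_eq_star_mul_self.1 hA.nonneg

lemma expect_lift_nonneg {κ ι : Type} [Fintype κ] [DecidableEq κ] [Fintype ι] [DecidableEq ι]
    (f : κ ↪ ι) {P : Op κ} (hP : P.PosSemidef) (v : (ι → Bool) → ℂ) :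
    0 ≤ expect (lift f P) v := by
  obtain ⟨B, rfl⟩ := exists_eq_conjTranspose_mul_self hP
  rw [lift_mul, ← lift_conjTranspose, expect_eq, ← norm_cl_sq]
  positivity

/-- The measurement operators for the answer "accept" lie between zero and one. -/
lemma expect_effect_mem (H : LocalHamiltonian k n m) (d : Verdict k) (v : (Wire k → Bool) → ℂ) :
    0 ≤ expect (H.effect d) v ∧ expect (H.effect d) v ≤ ∑ x, ‖v x‖ ^ 2 := by
  have hpos : 0 ≤ ∑ x, ‖v x‖ ^ 2 := Finset.sum_nonneg fun x _ => by positivity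
  cases d with
  | accept => simp only [LocalHamiltonian.effect]; rw [expect_one]; exact ⟨hpos, le_rfl⟩
  | zeros ws =>
    have h1 := expect_diagonal (fun x : Wire k → Bool => if ∀ w ∈ ws, x w = false then (1 : ℝ) else 0) v
    have h2 : (Matrix.diagonal fun x : Wire k → Bool =>
        if ∀ w ∈ ws, x w = false then (1 : ℂ) else 0) = Matrix.diagonal fun x : Wire k → Bool =>
        ((if ∀ w ∈ ws, x w = false then (1 : ℝ) else 0 : ℝ) : ℂ) := by
      congr 1; ext x; split_ifs <;> simp
    simp only [LocalHamiltonian.effect]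
    rw [h2, h1]
    constructor
    · exact Finset.sum_nonneg fun x _ => by positivity
    · refine Finset.sum_le_sum fun x _ => ?_
      split_ifs
      · simp
      · rw [zero_mul]; positivity
  | energy j ws =>
    simp only [LocalHamiltonian.effect]
    split_ifs with h
    · rw [expect_sub, expect_one]
      have h0 := expect_lift_nonneg ((Fin.castLEEmb (H.size_le ⟨j, h⟩)).trans ws) (H.term_nonneg ⟨j, h⟩) v
      refine ⟨?_, by linarith⟩
      have h1 := expect_lift_nonneg ((Fin.castLEEmb (H.size_le ⟨j, h⟩)).trans ws) (H.term_le_one ⟨j, h⟩) v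
      rw [lift_sub, lift_one, expect_sub, expect_one] at h1
      exact h1
    · rw [expect_one]; exact ⟨hpos, le_rfl⟩

lemma acceptIn_mem (hσ : σ.IsQuantum) (H : LocalHamiltonian k n m) {s : Config k}
    (hs : s.circuit ∈ Matrix.unitaryGroup (Wire k → Bool) ℂ) :
    0 ≤ acceptIn H σ s ∧ acceptIn H σ s ≤ 1 := by
  rw [acceptIn, ← sum_norm_answer hσ s.msg hs]
  exact ⟨Finset.sum_nonneg fun e _ => (expect_effect_mem H _ _).1,
    Finset.sum_le_sum fun e _ => (expect_effect_mem H _ _).2⟩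

/-- The five wires with qubit `l t` from prover `t`. -/
def blockWires (l : Fin 5 → Fin k) : Fin 5 ↪ Wire k :=
  ⟨fun t => (t, l t), fun _ _ h => congrArg Prod.fst h⟩

lemma lift_blockWires_tens (l : Fin 5 → Fin k) (B : Fin 5 → Matrix Bool Bool ℂ) :
    lift (blockWires l) (tens B) = tensW fun t => tens (Function.update 1 (l t) (B t)) := by
  rw [lift_tens, tensW_tens]
  congr 1
  ext1 ⟨t, i⟩
  by_cases h : i = l t
  · subst h
    have := (blockWires l).injective.extend_apply B 1 t
    rw [Function.update_self]
    exact this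
  · rw [Function.update_of_ne h, Function.extend_apply']
    · rfl
    · rintro ⟨t', ht'⟩
      have h1 : t' = t := congrArg Prod.fst ht'
      subst h1
      exact h (congrArg Prod.snd ht').symm

/-- The wires of a block that carry the syndromes after decoding. -/
def syndromeWires (l : Fin 5 → Fin k) : Finset (Wire k) :=
  (Finset.univ.erase 0).map (blockWires l)

lemma mem_syndromeWires (l : Fin 5 → Fin k) {w : Fin 5} (hw : w ≠ 0) :
    blockWires l w ∈ syndromeWires l :=
  Finset.mem_map_of_mem _ (Finset.mem_erase.2 ⟨hw, Finset.mem_univ _⟩)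

/-- If the test that a block is in the code is passed with high probability, then all the
stabilizers have expectation values close to one. -/
lemma one_sub_stab_le (hσ : σ.IsQuantum) (H : LocalHamiltonian k n m) {s : Config k}
    (l : Fin 5 → Fin k) (hc : s.circuit = lift (blockWires l) decoder)
    (hv : s.verdict = .zeros (syndromeWires l)) {w : Fin 5} (hw : w ≠ 0) :
    1 - (⟪σ.vec, cl (σ.pull s.msg
      (tensW fun t => tens (Function.update 1 (l t) (stab w t)))) σ.vec⟫_ℂ).re ≤
      2 * (1 - acceptIn H σ s) := by
  set U := lift (blockWires l) decoder with hU
  have hUu : U ∈ Matrix.unitaryGroup (Wire k → Bool) ℂ := lift_mem_unitary _ decoder_mem_unitary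
  have h1 : U * (tensW fun t => tens (Function.update 1 (l t) (stab w t))) =
      pauli (true, blockWires l w) * U := by
    rw [hU, ← lift_blockWires_tens, ← lift_pauli, ← lift_mul, ← lift_mul, decoder_mul_stab hw]
  have h2 : (tensW fun t => tens (Function.update 1 (l t) (stab w t))) =
      U.conjTranspose * Matrix.diagonal (fun x => ((if x (blockWires l w) then -1 else 1 : ℝ) : ℂ)) *
        U := by
    have h3 : Matrix.diagonal (fun x => ((if x (blockWires l w) then -1 else 1 : ℝ) : ℂ)) =
        pauli (true, blockWires l w) := by
      ext x y
      rw [pauli_true, Matrix.diagonal_apply, sgn]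
      split_ifs <;> simp
    rw [h3, Matrix.mul_assoc, ← h1, ← Matrix.mul_assoc, ← Matrix.star_eq_conjTranspose,
      Matrix.mem_unitaryGroup_iff'.1 hUu, one_mul]
  rw [h2, expect_pull, acceptIn, hc]
  simp only [expect_conj, expect_diagonal]
  have h3 := sum_norm_answer hσ s.msg hUu
  have h4 : ∀ e, expect (H.effect s.verdict) (U.mulVec (σ.answer s.msg e)) =
      ∑ x, (if ∀ w ∈ syndromeWires l, x w = false then (1 : ℝ) else 0) *
        ‖U.mulVec (σ.answer s.msg e) x‖ ^ 2 := by
    intro e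
    rw [hv, ← expect_diagonal]
    simp only [LocalHamiltonian.effect]
    congr 2
    ext x; split_ifs <;> simp
  simp only [h4]
  have h5 : ∑ e, ∑ x, (2 * (if ∀ w ∈ syndromeWires l, x w = false then (1 : ℝ) else 0) *
      ‖U.mulVec (σ.answer s.msg e) x‖ ^ 2) ≤
      ∑ e, ∑ x, (1 + (if x (blockWires l w) then -1 else 1 : ℝ)) *
        ‖U.mulVec (σ.answer s.msg e) x‖ ^ 2 := by
    refine Finset.sum_le_sum fun e _ => Finset.sum_le_sum fun x _ => ?_
    gcongr
    split_ifs with h6 h7 h7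
    · rw [h6 _ (mem_syndromeWires l hw)] at h7; exact absurd h7 (by simp)
    · norm_num
    · norm_num
    · norm_num
  simp only [add_mul, one_mul, Finset.sum_add_distrib, mul_assoc, ← Finset.mul_sum] at h5
  rw [h3] at h5
  linarith

/-- A block on which all stabilizers act trivially passes the test that it is in the code. -/
lemma acceptIn_eq_one (hσ : σ.IsQuantum) (H : LocalHamiltonian k n m) {s : Config k}
    (l : Fin 5 → Fin k) (hc : s.circuit = lift (blockWires l) decoder)
    (hv : s.verdict = .zeros (syndromeWires l))
    (hst : ∀ w, w ≠ 0 → ∀ e, (tensW fun t => tens (Function.update 1 (l t) (stab w t))).mulVec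
      (σ.answer s.msg e) = σ.answer s.msg e) :
    acceptIn H σ s = 1 := by
  set U := lift (blockWires l) decoder with hU
  have hUu : U ∈ Matrix.unitaryGroup (Wire k → Bool) ℂ := lift_mem_unitary _ decoder_mem_unitary
  have h1 : ∀ w, w ≠ 0 → U * (tensW fun t => tens (Function.update 1 (l t) (stab w t))) =
      pauli (true, blockWires l w) * U := by
    intro w hw
    rw [hU, ← lift_blockWires_tens, ← lift_pauli, ← lift_mul, ← lift_mul, decoder_mul_stab hw]
  rw [acceptIn, ← sum_norm_answer hσ s.msg hUu, hc]
  refine Finset.sum_congr rfl fun e _ => ?_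
  set u := U.mulVec (σ.answer s.msg e) with hu
  have h2 : ∀ w, w ≠ 0 → (pauli (true, blockWires l w)).mulVec u = u := by
    intro w hw
    rw [hu, Matrix.mulVec_mulVec, ← h1 w hw, ← Matrix.mulVec_mulVec, hst w hw e]
  have h4 : expect (H.effect s.verdict) u =
      ∑ x, (if ∀ w ∈ syndromeWires l, x w = false then (1 : ℝ) else 0) * ‖u x‖ ^ 2 := by
    rw [hv, ← expect_diagonal]
    simp only [LocalHamiltonian.effect]
    congr 2
    ext x; split_ifs <;> simp
  rw [h4]
  refine Finset.sum_congr rfl fun x _ => ?_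
  split_ifs with h
  · rw [one_mul]
  · push Not at h
    obtain ⟨w, hw, hx⟩ := h
    obtain ⟨i, hi, rfl⟩ := Finset.mem_map.1 hw
    have h5 := congrFun (h2 i (Finset.ne_of_mem_erase hi)) x
    rw [pauli_true_mulVec] at h5
    have h6 : x (blockWires l i) = true := by simpa using hx
    rw [h6, sgn_true] at h5
    have h7 : u x = 0 := by linear_combination (-1 / 2 : ℂ) * h5
    simp [h7]

end Tests

/-! ### The observables of a single prover -/

section Unitaries

lemma tens_mem_unitary {ι : Type} [Fintype ι] [DecidableEq ι] {B : ι → Matrix Bool Bool ℂ}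
    (hB : ∀ i, (B i).conjTranspose * B i = 1) : tens B ∈ Matrix.unitaryGroup (ι → Bool) ℂ := by
  rw [Matrix.mem_unitaryGroup_iff', Matrix.star_eq_conjTranspose, tens_conjTranspose, tens_mul]
  simp only [hB]
  exact tens_one

lemma pauli_mem_unitary {ι : Type} [Fintype ι] [DecidableEq ι] (p : Bool × ι) :
    pauli p ∈ Matrix.unitaryGroup (ι → Bool) ℂ := by
  rw [Matrix.mem_unitaryGroup_iff', Matrix.star_eq_conjTranspose, pauli_conjTranspose,
    pauli_mul_self]

lemma tensW_mem_unitary {k : ℕ} {B : Fin 5 → Op (Fin k)}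
    (hB : ∀ t, B t ∈ Matrix.unitaryGroup (Fin k → Bool) ℂ) :
    tensW B ∈ Matrix.unitaryGroup (Wire k → Bool) ℂ := by
  have h : (tensW B).conjTranspose = tensW fun t => (B t).conjTranspose := by
    ext x y; simp [tensW, Matrix.conjTranspose_apply]
  have hB' : ∀ t, (B t).conjTranspose * B t = 1 := fun t => Matrix.mem_unitaryGroup_iff'.1 (hB t)
  rw [Matrix.mem_unitaryGroup_iff', Matrix.star_eq_conjTranspose, h, tensW_mul]
  simp only [hB', tensW_one]

lemma stab_mul_self (w t : Fin 5) : (stab w t).conjTranspose * stab w t = 1 := by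
  rw [stab_conjTranspose, stab]
  split_ifs <;> simp [sig_mul_self]

/-- A stabilizer that acts by `X` (for `p = false`) or `Z` on qubit `t`, and has a syndrome. -/
def gen (p : Bool) (t : Fin 5) : Fin 5 :=
  if p then (if t = 0 then 4 else t) else (if t = 4 then 2 else t + 1)

lemma gen_ne_zero (p : Bool) (t : Fin 5) : gen p t ≠ 0 := by
  revert p t; decide

lemma stab_gen (p : Bool) (t : Fin 5) : stab (gen p t) t = sig p := by
  cases p <;> fin_cases t <;> simp [stab, gen]

end Unitaries

section Observables

open scoped InnerProductSpace

variable {k n : ℕ} {σ : Strategy k}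

/-- An operator on the register of prover `t`. -/
noncomputable def Strategy.obs (σ : Strategy k) (t : Fin 5) :
    Matrix (σ.P t) (σ.P t) ℂ →*
      (EuclideanSpace ℂ (∀ t, σ.P t) →L[ℂ] EuclideanSpace ℂ (∀ t, σ.P t)) :=
  clHom.comp
    { toFun := fun M => tens (Function.update (fun t => (1 : Matrix (σ.P t) (σ.P t) ℂ)) t M)
      map_one' := by
        rw [Function.update_eq_self_iff.2 rfl]; exact tens_one
      map_mul' := fun M N => (tens_update_mul (ι := Fin 5) t M N).symm }

lemma obs_apply (t : Fin 5) (M : Matrix (σ.P t) (σ.P t) ℂ) :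
    σ.obs t M = cl (tens (Function.update (fun t => (1 : Matrix (σ.P t) (σ.P t) ℂ)) t M)) := rfl

lemma tens_update_mul_tens (t : Fin 5) (M : Matrix (σ.P t) (σ.P t) ℂ)
    (N : ∀ t, Matrix (σ.P t) (σ.P t) ℂ) :
    tens (Function.update (fun t => (1 : Matrix (σ.P t) (σ.P t) ℂ)) t M) *
      tens (Function.update N t 1) = tens (Function.update N t M) := by
  rw [tens_mul]
  congr 1
  ext1 j
  by_cases h : j = t
  · subst h; simp
  · simp [h]

/-- Operators of prover `t` commute with those of the other provers. -/
lemma commute_obs (t : Fin 5) (M : Matrix (σ.P t) (σ.P t) ℂ)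
    (N : ∀ t, Matrix (σ.P t) (σ.P t) ℂ) :
    Commute (σ.obs t M) (cl (tens (Function.update N t 1))) := by
  rw [obs_apply, ← clHom_apply, ← clHom_apply]
  refine Commute.map ?_ _
  rw [commute_iff_eq, tens_update_mul_tens, tens_mul]
  congr 1
  ext1 j
  by_cases h : j = t
  · subst h; simp
  · simp [h]

lemma commute_obs_obs {t t' : Fin 5} (h : t ≠ t') (M : Matrix (σ.P t) (σ.P t) ℂ)
    (N : Matrix (σ.P t') (σ.P t') ℂ) : Commute (σ.obs t M) (σ.obs t' N) := by
  have := commute_obs (σ := σ) t M (Function.update (fun t => 1) t' N)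
  rwa [Function.update_eq_self_iff.2 (by rw [Function.update_of_ne h])] at this

lemma obs_localPull (hσ : σ.IsQuantum) (t : Fin 5) (q : List Bool) (B : Op (Fin k)) :
    σ.obs t (σ.localPull t q B) =
      cl (σ.pull (fun _ => q) (tensW (Function.update (fun _ => 1) t B))) := by
  rw [obs_apply, pull_tensW]
  congr 2
  ext1 j
  by_cases h : j = t
  · subst h; simp
  · simp [h, localPull_one hσ]

lemma update_mem_unitary {t : Fin 5} {B : Op (Fin k)}
    (hB : B ∈ Matrix.unitaryGroup (Fin k → Bool) ℂ) :
    tensW (Function.update (fun _ => 1) t B) ∈ Matrix.unitaryGroup (Wire k → Bool) ℂ :=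
  tensW_mem_unitary fun t' => by
    by_cases h : t' = t
    · subst h; simpa using hB
    · simp [h]

lemma obs_contraction (hσ : σ.IsQuantum) (t : Fin 5) (q : List Bool) {B : Op (Fin k)}
    (hB : B ∈ Matrix.unitaryGroup (Fin k → Bool) ℂ) :
    IsContraction (σ.obs t (σ.localPull t q B)) := by
  rw [obs_localPull hσ]
  exact pull_contraction hσ _ (update_mem_unitary hB)

lemma localPull_conjTranspose (t : Fin 5) (q : List Bool) (B : Op (Fin k)) :
    (σ.localPull t q B).conjTranspose = σ.localPull t q B.conjTranspose := by
  classical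
  simp only [Strategy.localPull, Matrix.conjTranspose_mul, Matrix.conjTranspose_conjTranspose,
    amp_conjTranspose, Matrix.mul_assoc]

/-- Two vectors in the unit ball with an inner product close to one are close to each other and to
the unit sphere. -/
lemma near_of_inner {V : Type*} [NormedAddCommGroup V] [InnerProductSpace ℂ V] {u v ψ : V} {ρ : ℝ}
    (hψ : ‖ψ‖ = 1) (hu : ‖u‖ ≤ ‖ψ‖) (hv : ‖v‖ ≤ ‖ψ‖) (h : 1 - (⟪u, v⟫_ℂ).re ≤ 2 * ρ) :
    ‖u - v‖ ≤ 2 * √ρ ∧ ‖ψ‖ ^ 2 - ‖u‖ ^ 2 ≤ (2 * √ρ) ^ 2 := by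
  have h0 : (⟪u, v⟫_ℂ).re ≤ ‖u‖ * ‖v‖ := @re_inner_le_norm ℂ _ _ _ _ u v
  have h1 : ‖u - v‖ ^ 2 = ‖u‖ ^ 2 - 2 * (⟪u, v⟫_ℂ).re + ‖v‖ ^ 2 := @norm_sub_sq ℂ _ _ _ _ u v
  rw [hψ] at hu hv
  have hu0 := norm_nonneg u
  have hv0 := norm_nonneg v
  have hρ : 0 ≤ ρ := by nlinarith
  have h2 : (2 * √ρ) ^ 2 = 4 * ρ := by rw [mul_pow, Real.sq_sqrt hρ]; norm_num
  constructor
  · refine abs_le_of_sq_le_sq' ?_ (by positivity) |>.2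
    rw [h2, h1]; nlinarith
  · rw [h2, hψ]; nlinarith

variable (enc : (Fin k → Option (Fin n)) → List Bool) (l₀ : Fin k)

/-- The tuple of questions that asks only for the qubit `i`, in slot `l₀`. -/
def single (i : Fin n) : Fin k → Option (Fin n) := Function.update (fun _ => none) l₀ (some i)

/-- The tuple `v` asks for the qubit `i` in slot `l`, and in no other slot. -/
def Asks (v : Fin k → Option (Fin n)) (l : Fin k) (i : Fin n) : Prop :=
  v l = some i ∧ ∀ l', l' ≠ l → v l' ≠ some i

lemma asks_single (i : Fin n) : Asks (single l₀ i) l₀ i :=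
  ⟨by simp [single], fun l' h => by simp [single, h]⟩

/-- The questions in the code test: prover `t` is asked `v`, the others are asked for qubit `i`. -/
def testMsg (v : Fin k → Option (Fin n)) (t : Fin 5) (i : Fin n) : Fin 5 → List Bool :=
  Function.update (fun _ => enc (single l₀ i)) t (enc v)

/-- The slots in the code test. -/
def testSlots (t : Fin 5) (l : Fin k) : Fin 5 → Fin k := Function.update (fun _ => l₀) t l

/-- The stabilizers are close to one in all the code tests. -/
def StabBound (σ : Strategy k) (ρ : ℝ) : Prop :=
  ∀ v t l i, Asks v l i → ∀ w, w ≠ 0 → 1 - (⟪σ.vec, cl (σ.pull (testMsg enc l₀ v t i)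
    (tensW fun t' => tens (Function.update 1 (testSlots l₀ t l t') (stab w t')))) σ.vec⟫_ℂ).re ≤
    2 * ρ

/-- The observable that prover `t` measures for the letter `a` when asked for one qubit. -/
noncomputable def Strategy.letterMat (σ : Strategy k) (t : Fin 5) (a : Bool × Fin n) :
    Matrix (σ.P t) (σ.P t) ℂ :=
  σ.localPull t (enc (single l₀ a.2)) (pauli (a.1, l₀))

/-- The operator of the provers other than `t` that takes the place of the letter `a` of
prover `t`: the rest of a stabilizer. -/
noncomputable def Strategy.mirror (σ : Strategy k) (t : Fin 5) (a : Bool × Fin n) :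
    EuclideanSpace ℂ (∀ t, σ.P t) →L[ℂ] EuclideanSpace ℂ (∀ t, σ.P t) :=
  cl (tens (Function.update (fun t' => σ.localPull t' (enc (single l₀ a.2))
    (tens (Function.update 1 l₀ (stab (gen a.1 t) t')))) t 1))

lemma update_stab_unitary (l : Fin k) (w t : Fin 5) :
    tens (Function.update 1 l (stab w t)) ∈ Matrix.unitaryGroup (Fin k → Bool) ℂ :=
  tens_mem_unitary fun i => by
    by_cases h : i = l
    · subst h; simpa using stab_mul_self w t
    · simp [h]

variable {enc l₀}

lemma mirror_contraction (hσ : σ.IsQuantum) (t : Fin 5) (a : Bool × Fin n) :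
    IsContraction (σ.mirror enc l₀ t a) := by
  have h : σ.mirror enc l₀ t a = cl (σ.pull (fun _ => enc (single l₀ a.2)) (tensW
      (Function.update (fun t' => tens (Function.update 1 l₀ (stab (gen a.1 t) t'))) t 1))) := by
    rw [Strategy.mirror, pull_tensW]
    congr 2
    ext1 j
    by_cases h : j = t
    · subst h; simp [localPull_one hσ]
    · simp [h]
  rw [h]
  refine pull_contraction hσ _ (tensW_mem_unitary fun t' => ?_)
  by_cases h : t' = t
  · subst h; simp
  · simpa [h] using update_stab_unitary _ _ _

/-- A stabilizer that nearly fixes the shared state is the product of an observable of prover `t`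
and an operator of the other provers; as the observable is self-adjoint, the two factors have nearly
the same effect. -/
lemma obs_near (hσ : σ.IsQuantum) {ρ : ℝ} (h : StabBound enc l₀ σ ρ) (t : Fin 5)
    {v : Fin k → Option (Fin n)} {l : Fin k} {i : Fin n} (hv : Asks v l i) (p : Bool) :
    ‖σ.obs t (σ.localPull t (enc v) (pauli (p, l))) σ.vec - σ.mirror enc l₀ t (p, i) σ.vec‖ ≤
      2 * √ρ ∧
    ‖σ.vec‖ ^ 2 - ‖σ.obs t (σ.localPull t (enc v) (pauli (p, l))) σ.vec‖ ^ 2 ≤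
      (2 * √ρ) ^ 2 := by
  refine near_of_inner (norm_vec hσ) (obs_contraction hσ t _ (pauli_mem_unitary _) _)
    (mirror_contraction hσ t _ _) ?_
  have h1 := h v t l i hv (gen p t) (gen_ne_zero p t)
  have h2 : ⟪σ.obs t (σ.localPull t (enc v) (pauli (p, l))) σ.vec,
      σ.mirror enc l₀ t (p, i) σ.vec⟫_ℂ = ⟪σ.vec, cl (σ.pull (testMsg enc l₀ v t i)
      (tensW fun t' => tens (Function.update 1 (testSlots l₀ t l t') (stab (gen p t) t'))))
      σ.vec⟫_ℂ := by
    have h3 : (tens (Function.update (fun t => (1 : Matrix (σ.P t) (σ.P t) ℂ)) t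
        (σ.localPull t (enc v) (pauli (p, l))))).conjTranspose =
        tens (Function.update (fun t => (1 : Matrix (σ.P t) (σ.P t) ℂ)) t
        (σ.localPull t (enc v) (pauli (p, l)))) := by
      rw [tens_conjTranspose]
      congr 1
      ext1 j
      by_cases h : j = t
      · subst h; simp [localPull_conjTranspose, pauli_conjTranspose]
      · simp [h]
    rw [obs_apply, ← h3, ← inner_cl, Strategy.mirror, ← cl_mul, tens_update_mul_tens, pull_tensW]
    congr 4
    ext1 j
    by_cases h : j = t
    · subst h
      simp only [Function.update_self, testMsg, testSlots, stab_gen]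
      rfl
    · simp [h, testMsg, testSlots]
  rw [h2]
  exact h1

/-- Pulling back to the register of prover `t` is nearly multiplicative, as the Pauli operator on
the right nearly maps the shared state into the range of the isometry of the prover. -/
lemma obs_mul_near (hσ : σ.IsQuantum) {ρ : ℝ} (h : StabBound enc l₀ σ ρ) (t : Fin 5)
    {v : Fin k → Option (Fin n)} {l : Fin k} {i : Fin n} (hv : Asks v l i) (p : Bool)
    {B : Op (Fin k)} (hB : B ∈ Matrix.unitaryGroup (Fin k → Bool) ℂ) :
    ‖σ.obs t (σ.localPull t (enc v) (B * pauli (p, l))) σ.vec -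
      σ.obs t (σ.localPull t (enc v) B)
        (σ.obs t (σ.localPull t (enc v) (pauli (p, l))) σ.vec)‖ ≤ 2 * √ρ := by
  have h1 := (obs_near hσ h t hv p).2
  have h2 : tensW (Function.update (fun _ => 1) t (B * pauli (p, l))) =
      tensW (Function.update (fun _ => 1) t B) *
        tensW (Function.update (fun _ => 1) t (pauli (p, l))) := by
    rw [tensW_mul]
    congr 1
    ext1 j
    by_cases h : j = t
    · subst h; simp
    · simp [h]
  rw [obs_localPull hσ] at h1
  simp only [obs_localPull hσ]
  rw [h2]
  exact abs_le_of_sq_le_sq' ((norm_pull_mul_sub_sq_le hσ _ (update_mem_unitary hB)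
    (update_mem_unitary (pauli_mem_unitary _)) _).trans h1) (by positivity) |>.2

/-- The operators of the other provers do not depend on the question that prover `t` is asked. -/
lemma mirrored (hσ : σ.IsQuantum) {ρ : ℝ} (h : StabBound enc l₀ σ ρ) (t : Fin 5) :
    Mirrored σ.vec (2 * √ρ) (fun a => σ.obs t (σ.letterMat enc l₀ t a))
      (σ.mirror enc l₀ t) where
  contr _ := obs_contraction hσ t _ (pauli_mem_unitary _)
  contr' a := mirror_contraction hσ t a
  comm _ _ := commute_obs t _ _
  near a := (obs_near hσ h t (asks_single l₀ a.2) a.1).1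

/-- A vector close to `E₀ E₁ ψ` is close to `A₀ A₁ ψ`, if `Eᵢ` and `Aᵢ` have the same mirror image
`Tᵢ`: this passes from `E₀ E₁` to `E₀ T₁ = T₁ E₀`, `T₁ T₀`, `T₁ A₀ = A₀ T₁` and `A₀ A₁`. -/
lemma norm_sub_mul_apply_le {V : Type*} [NormedAddCommGroup V] [NormedSpace ℂ V] {δ : ℝ}
    {ψ x : V} {E₀ E₁ A₀ A₁ T₀ T₁ : V →L[ℂ] V} (hE₀ : IsContraction E₀) (hT₁ : IsContraction T₁)
    (hA₀ : IsContraction A₀) (c₀ : Commute E₀ T₁) (c₁ : Commute A₀ T₁)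
    (k1 : ‖x - E₀ (E₁ ψ)‖ ≤ δ) (k2 : ‖E₁ ψ - T₁ ψ‖ ≤ δ) (k3 : ‖E₀ ψ - T₀ ψ‖ ≤ δ)
    (k4 : ‖A₀ ψ - T₀ ψ‖ ≤ δ) (k5 : ‖A₁ ψ - T₁ ψ‖ ≤ δ) : ‖x - A₀ (A₁ ψ)‖ ≤ 5 * δ := by
  have e2 : E₀ (T₁ ψ) = T₁ (E₀ ψ) := congrArg (fun f : V →L[ℂ] V => f ψ) c₀.eq
  have e4 : A₀ (T₁ ψ) = T₁ (A₀ ψ) := congrArg (fun f : V →L[ℂ] V => f ψ) c₁.eq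
  have k2 := hE₀.dist_le k2
  have k3 := hT₁.dist_le k3
  rw [norm_sub_rev] at k4 k5
  have k4 := hT₁.dist_le k4
  have k5 := hA₀.dist_le k5
  rw [e2] at k2
  rw [e4] at k5
  have t1 := norm_sub_le_norm_sub_add_norm_sub x (E₀ (E₁ ψ)) (T₁ (E₀ ψ))
  have t2 := norm_sub_le_norm_sub_add_norm_sub x (T₁ (E₀ ψ)) (T₁ (T₀ ψ))
  have t3 := norm_sub_le_norm_sub_add_norm_sub x (T₁ (T₀ ψ)) (T₁ (A₀ ψ))
  have t4 := norm_sub_le_norm_sub_add_norm_sub x (T₁ (A₀ ψ)) (A₀ (A₁ ψ))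
  linarith

/-- A product of two Pauli operators on the answer to a question is pulled back nearly to the
product of two letters. -/
lemma obs_pair_near (hσ : σ.IsQuantum) {ρ : ℝ} (h : StabBound enc l₀ σ ρ) (t : Fin 5)
    {v : Fin k → Option (Fin n)} {l l' : Fin k} {i i' : Fin n} (hv : Asks v l i)
    (hv' : Asks v l' i') (p p' : Bool) :
    ‖σ.obs t (σ.localPull t (enc v) (pauli (p, l) * pauli (p', l'))) σ.vec -
      σ.obs t (σ.letterMat enc l₀ t (p, i)) (σ.obs t (σ.letterMat enc l₀ t (p', i')) σ.vec)‖ ≤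
      5 * (2 * √ρ) := by
  have hM := mirrored hσ h t
  exact norm_sub_mul_apply_le (obs_contraction hσ t (enc v) (pauli_mem_unitary (p, l)))
    (hM.contr' (p', i')) (hM.contr (p, i)) (commute_obs t _ _) (hM.comm (p, i) (p', i'))
    (obs_mul_near hσ h t hv' p' (pauli_mem_unitary (p, l))) (obs_near hσ h t hv' p').1
    (obs_near hσ h t hv p).1 (hM.near (p, i)) (hM.near (p', i'))

lemma localPull_smul (t : Fin 5) (q : List Bool) (c : ℂ) (B : Op (Fin k)) :
    σ.localPull t q (c • B) = c • σ.localPull t q B := by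
  classical
  rw [Strategy.localPull, amp_smul, Matrix.mul_smul, Matrix.smul_mul]; rfl

lemma obs_smul (t : Fin 5) (c : ℂ) (M : Matrix (σ.P t) (σ.P t) ℂ) :
    σ.obs t (c • M) = c • σ.obs t M := by
  have h : tens (Function.update (fun t => (1 : Matrix (σ.P t) (σ.P t) ℂ)) t (c • M)) =
      c • tens (Function.update (fun t => (1 : Matrix (σ.P t) (σ.P t) ℂ)) t M) := by
    ext x y
    rw [Matrix.smul_apply, tens_apply, tens_apply,
      ← Finset.mul_prod_erase _ _ (Finset.mem_univ t),
      ← Finset.mul_prod_erase _ (fun i => Function.update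
        (fun t => (1 : Matrix (σ.P t) (σ.P t) ℂ)) t M i (x i) (y i)) (Finset.mem_univ t),
      smul_eq_mul, ← mul_assoc]
    congr 1
    · simp
    · refine Finset.prod_congr rfl fun i hi => ?_
      simp [Finset.ne_of_mem_erase hi]
  ext1 v
  rw [obs_apply, h, cl_smul]; rfl

/-- The letters nearly satisfy the commutation relations of the Pauli operators. For letters on
different qubits, this compares them with Pauli operators on the answer to a single question that
asks for both qubits, which is why `k` has to be at least two. -/
lemma letters_comm (hσ : σ.IsQuantum) (hk : 2 ≤ k) {ρ : ℝ} (h : StabBound enc l₀ σ ρ) (t : Fin 5)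
    (a b : Bool × Fin n) :
    ‖σ.obs t (σ.letterMat enc l₀ t a) (σ.obs t (σ.letterMat enc l₀ t b) σ.vec) -
      csign a b • σ.obs t (σ.letterMat enc l₀ t b) (σ.obs t (σ.letterMat enc l₀ t a) σ.vec)‖ ≤
      10 * (2 * √ρ) := by
  obtain ⟨p, i⟩ := a
  obtain ⟨p', i'⟩ := b
  obtain ⟨v, l, l', hv, hv', hll⟩ : ∃ v : Fin k → Option (Fin n), ∃ l l', Asks v l i ∧ Asks v l' i' ∧
      (l = l' ↔ i = i') := by
    by_cases hi : i = i'
    · subst hi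
      exact ⟨_, l₀, l₀, asks_single l₀ i, asks_single l₀ i, by simp⟩
    · have : Nontrivial (Fin k) := Fin.nontrivial_iff_two_le.2 hk
      obtain ⟨l', hl'⟩ := exists_ne l₀
      refine ⟨Function.update (single l₀ i) l' (some i'), l₀, l', ⟨?_, ?_⟩, ⟨?_, ?_⟩, ?_⟩
      · simp [single, hl'.symm]
      · intro l'' hl''
        by_cases h1 : l'' = l'
        · subst h1; simp [Ne.symm hi]
        · simp [single, h1, hl'']
      · simp
      · intro l'' hl''
        by_cases h1 : l'' = l₀
        · subst h1; simp [single, hl'', hi]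
        · simp [single, h1, hl'']
      · simp [hl'.symm, hi]
  have hs : csign (p, i) (p', i') = csign (p, l) (p', l') := by simp [csign, hll]
  have k1 := obs_pair_near hσ h t hv hv' p p'
  have k2 := obs_pair_near hσ h t hv' hv p' p
  rw [pauli_mul_comm, localPull_smul, obs_smul, ← hs] at k1
  set s := csign (p, i) (p', i') with hs'
  have k3 : ‖s • σ.obs t (σ.localPull t (enc v) (pauli (p', l') * pauli (p, l))) σ.vec -
      s • σ.obs t (σ.letterMat enc l₀ t (p', i')) (σ.obs t (σ.letterMat enc l₀ t (p, i)) σ.vec)‖ ≤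
      5 * (2 * √ρ) := by
    rw [← smul_sub, norm_smul, hs', norm_csign, one_mul]; exact k2
  rw [norm_sub_rev] at k1
  have := norm_sub_le_norm_sub_add_norm_sub
    (σ.obs t (σ.letterMat enc l₀ t (p, i)) (σ.obs t (σ.letterMat enc l₀ t (p', i')) σ.vec))
    (s • σ.obs t (σ.localPull t (enc v) (pauli (p', l') * pauli (p, l))) σ.vec)
    (s • σ.obs t (σ.letterMat enc l₀ t (p', i')) (σ.obs t (σ.letterMat enc l₀ t (p, i)) σ.vec))
  simp only [smul_apply] at k1
  linarith

lemma letters_sq (hσ : σ.IsQuantum) {ρ : ℝ} (h : StabBound enc l₀ σ ρ) (t : Fin 5)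
    (a : Bool × Fin n) :
    ‖σ.obs t (σ.letterMat enc l₀ t a) (σ.obs t (σ.letterMat enc l₀ t a) σ.vec) - σ.vec‖ ≤
      10 * (2 * √ρ) := by
  have k1 := obs_pair_near hσ h t (asks_single l₀ a.2) (asks_single l₀ a.2) a.1 a.1
  rw [pauli_mul_self, localPull_one hσ, map_one, norm_sub_rev] at k1
  have : (0 : ℝ) ≤ 2 * √ρ := by positivity
  refine k1.trans ?_
  linarith

end Observables

/-! ### Monomials in the observables of all provers -/

section Monomials

open scoped InnerProductSpace

variable {k n : ℕ} {σ : Strategy k}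

lemma prod_csign (l : List (Bool × Fin n)) (hl : l.Nodup) (g : Bool × Fin n → Bool)
    (b : Bool × Fin n) : ((l.filter g).map (csign · b)).prod =
      if (!b.1, b.2) ∈ l ∧ g (!b.1, b.2) = true then -1 else 1 := by
  induction l with
  | nil => simp
  | cons a l ih =>
    rw [List.nodup_cons] at hl
    have ih := ih hl.2
    by_cases hab : a = (!b.1, b.2)
    · subst hab
      rw [if_neg fun h => hl.1 h.1] at ih
      have h1 : csign (!b.1, b.2) b = -1 := by simp [csign]
      cases hg : g (!b.1, b.2) <;> simp [hg, ih, h1]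
    · have h1 : csign a b = 1 := by
        rw [csign, if_neg]
        rintro ⟨h2, h3⟩
        exact hab (Prod.ext (by revert h3; cases a.1 <;> cases b.1 <;> simp) h2)
      have h2 : ((!b.1, b.2) ∈ a :: l) ↔ (!b.1, b.2) ∈ l := by simp [Ne.symm hab]
      simp only [h2]
      rw [← ih]
      cases hg : g a <;> simp [hg, h1]

/-- The sign that appears when the letter `a` is moved to its place in the monomial with
exponents `g`. -/
def lsign (g : Bool × Fin n → Bool) (a : Bool × Fin n) : ℂ :=
  if a.1 then 1 else sgn (g (true, a.2))

lemma lsign_mul_self (g : Bool × Fin n → Bool) (a : Bool × Fin n) :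
    lsign g a * lsign g a = 1 := by
  rw [lsign]; split_ifs
  · simp
  · exact sgn_mul_self _

lemma norm_lsign (g : Bool × Fin n → Bool) (a : Bool × Fin n) : ‖lsign g a‖ = 1 := by
  rw [lsign]; split_ifs <;> simp

/-- The letter `b` splits the list of the letters. The letters after it contain the other letter on
the same qubit just if `b` is an `X`. -/
lemma letters_split (b : Bool × Fin n) : ∃ l₁ l₂, letters n = l₁ ++ b :: l₂ ∧ b ∉ l₁ ∧ b ∉ l₂ ∧
    (l₂.length + 1 ≤ 2 * n) ∧ l₂.Nodup ∧ ((!b.1, b.2) ∈ l₂ ↔ b.1 = false) := by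
  obtain ⟨c, j⟩ := b
  obtain ⟨s, t, hst⟩ := List.append_of_mem (List.mem_finRange j)
  have hnd := List.nodup_finRange n
  have hlen := congrArg List.length hst
  simp only [List.length_finRange, List.length_append, List.length_cons] at hlen
  have hinj : ∀ c : Bool, Function.Injective fun i : Fin n => (c, i) := fun c i i' h => by
    simpa using h
  have hnd' := hnd
  rw [hst, List.nodup_append, List.nodup_cons] at hnd'
  obtain ⟨-, ⟨hjt, ht⟩, hs⟩ := hnd'
  have hjs : j ∉ s := fun h => hs j h j (by simp) rfl
  cases c
  · refine ⟨s.map (false, ·), t.map (false, ·) ++ (List.finRange n).map (true, ·), ?_, ?_, ?_, ?_,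
      ?_, ?_⟩
    · rw [letters]
      nth_rw 1 [hst]
      simp
    · simpa using hjs
    · simpa using hjt
    · simp; omega
    · rw [List.nodup_append]
      refine ⟨ht.map (hinj _), hnd.map (hinj _), ?_⟩
      simp
    · simp
  · refine ⟨(List.finRange n).map (false, ·) ++ s.map (true, ·), t.map (true, ·), ?_, ?_, ?_, ?_,
      ?_, ?_⟩
    · rw [letters]
      nth_rw 2 [hst]
      simp
    · simpa using hjs
    · simpa using hjt
    · simp; omega
    · exact ht.map (hinj _)
    · simp

variable {enc : (Fin k → Option (Fin n)) → List Bool} {l₀ : Fin k}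

variable (enc l₀) in
/-- The monomial with exponents `g` in the letters of prover `t`. -/
noncomputable def Strategy.mono (σ : Strategy k) (t : Fin 5) (g : Bool × Fin n → Bool) :
    Matrix (σ.P t) (σ.P t) ℂ :=
  wordOp (σ.letterMat enc l₀ t) ((letters n).filter g)

lemma obs_mono (t : Fin 5) (g : Bool × Fin n → Bool) : σ.obs t (σ.mono enc l₀ t g) =
    wordOp (fun a => σ.obs t (σ.letterMat enc l₀ t a)) ((letters n).filter g) := by
  rw [Strategy.mono, map_list_prod, List.map_map]; rfl

lemma mono_mul_letter (hσ : σ.IsQuantum) (hk : 2 ≤ k) {ρ : ℝ} (h : StabBound enc l₀ σ ρ)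
    (t : Fin 5) (g : Bool × Fin n → Bool) (a : Bool × Fin n) :
    ‖σ.obs t (σ.mono enc l₀ t g) (σ.obs t (σ.letterMat enc l₀ t a) σ.vec) -
      lsign g a • σ.obs t (σ.mono enc l₀ t (toggle g a)) σ.vec‖ ≤ 28 * n * (2 * √ρ) := by
  have hδ : (0 : ℝ) ≤ 2 * √ρ := by positivity
  obtain ⟨l₁, l₂, hl, h₁, h₂, hlen, hnd, hmem⟩ := letters_split a
  have hs : ((l₂.filter g).map (csign · a)).prod = lsign g a := by
    rw [prod_csign l₂ hnd, lsign]
    simp only [hmem]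
    rcases a with ⟨c, i⟩
    cases c <;> simp [sgn]
  have key := (mirrored hσ h t).filter_mul (δ' := 10 * (2 * √ρ)) hδ (by positivity) norm_csign
    (fun a b _ => letters_comm hσ hk h t a b) (letters_sq hσ h t) l₁ l₂ a h₁ h₂ g
  rw [← hl, hs] at key
  rw [obs_mono, obs_mono]
  refine key.trans ?_
  -- with `δ = 2 * √ρ`, each of at most `2 * n` steps costs `10 * δ` for a relation and `4 * δ` for
  -- moving operators to the other provers
  have : ((l₂.length : ℝ) + 1) ≤ 2 * n := by exact_mod_cast hlen
  nlinarith

lemma mono_contraction (hσ : σ.IsQuantum) {ρ : ℝ} (h : StabBound enc l₀ σ ρ) (t : Fin 5)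
    (g : Bool × Fin n → Bool) : IsContraction (σ.obs t (σ.mono enc l₀ t g)) := by
  rw [obs_mono]; exact (mirrored hσ h t).contr_word _

/-- A monomial of one prover, applied after a Pauli word on the answer to a question that asks for
the qubits `f 0, f 1, …` in the slots `e 0, e 1, …`. -/
lemma mono_mul_word (hσ : σ.IsQuantum) (hk : 2 ≤ k) {ρ : ℝ} (h : StabBound enc l₀ σ ρ)
    (t : Fin 5) {s : ℕ} (e : Fin s → Fin k) (f : Fin s → Fin n) {v : Fin k → Option (Fin n)}
    (hv : ∀ a, Asks v (e a) (f a)) (g : Bool × Fin n → Bool) (L : List (Bool × Fin s)) :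
    ‖σ.obs t (σ.mono enc l₀ t g)
        (σ.obs t (σ.localPull t (enc v) (wordOp (fun p => pauli (p.1, e p.2)) L)) σ.vec) -
      (toggles lsign g (L.map fun p => (p.1, f p.2))).2 •
        σ.obs t (σ.mono enc l₀ t (toggles lsign g (L.map fun p => (p.1, f p.2))).1) σ.vec‖ ≤
      L.length * (3 * (2 * √ρ) + 28 * n * (2 * √ρ)) := by
  have hw : ∀ L : List (Bool × Fin s), wordOp (fun p => pauli (p.1, e p.2)) L ∈
      Matrix.unitaryGroup (Fin k → Bool) ℂ := fun L => list_prod_mem fun _ hB => by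
    obtain ⟨a, -, rfl⟩ := List.mem_map.1 hB
    exact pauli_mem_unitary _
  exact (mirrored hσ h t).word_image (fun p : Bool × Fin s => pauli (p.1, e p.2))
    (fun B => σ.obs t (σ.localPull t (enc v) B)) (fun p => (p.1, f p.2))
    (by rw [localPull_one hσ, map_one]) (fun L => obs_contraction hσ t _ (hw L))
    (fun L b => commute_obs t _ _)
    (fun L p => obs_mul_near hσ h t (hv p.2) p.1 (hw L))
    (fun p => (obs_near hσ h t (hv p.2) p.1).1)
    (fun g => σ.obs t (σ.mono enc l₀ t g)) (mono_contraction hσ h t)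
    (fun g b => commute_obs t _ _) lsign norm_lsign
    (fun g p => mono_mul_letter hσ hk h t g _) g L

/-- Replacing commuting contractions one by one. -/
lemma norm_list_prod_sub_le {J V : Type*} [NormedAddCommGroup V] [NormedSpace ℂ V]
    {U U' : J → V →L[ℂ] V} (hU : ∀ t, IsContraction (U t)) (hU' : ∀ t, IsContraction (U' t))
    (hc : ∀ t t', t ≠ t' → Commute (U t) (U' t')) (hc' : ∀ t t', t ≠ t' → Commute (U' t) (U' t'))
    {ψ : V} {η : ℝ} (hη : ∀ t, ‖U t ψ - U' t ψ‖ ≤ η) (l : List J) (hl : l.Nodup) :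
    ‖(l.map U).prod ψ - (l.map U').prod ψ‖ ≤ l.length * η := by
  induction l with
  | nil => simp
  | cons t l ih =>
    rw [List.nodup_cons] at hl
    have ih := ih hl.2
    have hne : ∀ t' ∈ l, t ≠ t' := fun t' ht' h => hl.1 (h ▸ ht')
    have c1 : Commute (U t) (l.map U').prod := Commute.list_prod_right _ _ fun B hB => by
      obtain ⟨t', ht', rfl⟩ := List.mem_map.1 hB
      exact hc t t' (hne t' ht')
    have c2 : Commute (U' t) (l.map U').prod := Commute.list_prod_right _ _ fun B hB => by
      obtain ⟨t', ht', rfl⟩ := List.mem_map.1 hB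
      exact hc' t t' (hne t' ht')
    have hcl : IsContraction (l.map U').prod := IsContraction.list_prod fun B hB => by
      obtain ⟨t', -, rfl⟩ := List.mem_map.1 hB
      exact hU' t'
    have e1 : U t ((l.map U').prod ψ) = (l.map U').prod (U t ψ) :=
      congrArg (fun f : V →L[ℂ] V => f ψ) c1.eq
    have e2 : U' t ((l.map U').prod ψ) = (l.map U').prod (U' t ψ) :=
      congrArg (fun f : V →L[ℂ] V => f ψ) c2.eq
    have k1 := (hU t).dist_le ih
    have k2 := hcl.dist_le (hη t)
    rw [e1] at k1
    rw [List.map_cons, List.map_cons, List.prod_cons, List.prod_cons, List.length_cons,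
      Nat.cast_add, Nat.cast_one]
    change ‖U t ((l.map U).prod ψ) - U' t ((l.map U').prod ψ)‖ ≤ _
    rw [e2]
    have := norm_sub_le_norm_sub_add_norm_sub (U t ((l.map U).prod ψ)) ((l.map U').prod (U t ψ))
      ((l.map U').prod (U' t ψ))
    linarith

lemma cl_tens_eq_prod (M : ∀ t, Matrix (σ.P t) (σ.P t) ℂ) :
    cl (tens M) = ((List.finRange 5).map fun t => σ.obs t (M t)).prod := by
  have h : ∀ l : List (Fin 5), l.Nodup → (l.map fun t => σ.obs t (M t)).prod =
      cl (tens fun t => if t ∈ l then M t else 1) := by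
    intro l hl
    induction l with
    | nil => simpa using (show (1 : _ →L[ℂ] _) = _ by rw [tens_one, cl_one])
    | cons t l ih =>
      rw [List.nodup_cons] at hl
      rw [List.map_cons, List.prod_cons, ih hl.2, obs_apply, ← clHom_apply, ← clHom_apply,
        ← map_mul, tens_mul, clHom_apply]
      congr 2
      ext1 j
      by_cases hj : j = t
      · subst hj; simp [hl.1]
      · simp [hj]
  rw [h _ (List.nodup_finRange 5)]
  simp

/-- Nearly equal operators of the single provers have nearly equal products. -/
lemma norm_tens_sub_le (M N : ∀ t, Matrix (σ.P t) (σ.P t) ℂ)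
    (hM : ∀ t, IsContraction (σ.obs t (M t))) (hN : ∀ t, IsContraction (σ.obs t (N t))) {η : ℝ}
    (hη : ∀ t, ‖σ.obs t (M t) σ.vec - σ.obs t (N t) σ.vec‖ ≤ η) :
    ‖cl (tens M) σ.vec - cl (tens N) σ.vec‖ ≤ 5 * η := by
  have := norm_list_prod_sub_le hM hN (fun t t' h => commute_obs_obs h _ _)
    (fun t t' h => commute_obs_obs h _ _) hη (List.finRange 5) (List.nodup_finRange 5)
  rw [← cl_tens_eq_prod, ← cl_tens_eq_prod] at this
  simpa using this

lemma tens_contraction (M : ∀ t, Matrix (σ.P t) (σ.P t) ℂ)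
    (hM : ∀ t, IsContraction (σ.obs t (M t))) : IsContraction (cl (tens M)) := by
  rw [cl_tens_eq_prod]
  refine IsContraction.list_prod fun B hB => ?_
  obtain ⟨t, -, rfl⟩ := List.mem_map.1 hB
  exact hM t

variable (enc l₀) in
/-- The product over all provers of their monomials with exponents `g`: a logical Pauli operator
on `n` qubits. -/
noncomputable def Strategy.logical (σ : Strategy k) (g : Bool × Fin n → Bool) :
    EuclideanSpace ℂ (∀ t, σ.P t) →L[ℂ] EuclideanSpace ℂ (∀ t, σ.P t) :=
  cl (tens fun t => σ.mono enc l₀ t g)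

lemma toggles_mul_self (g : Bool × Fin n → Bool) (l : List (Bool × Fin n)) :
    (toggles lsign g l).2 * (toggles lsign g l).2 = 1 := by
  induction l using List.reverseRecOn with
  | nil => simp [toggles]
  | append_singleton l a ih =>
    rw [toggles_concat]
    linear_combination (lsign (toggles lsign g l).1 a * lsign (toggles lsign g l).1 a) * ih +
      lsign_mul_self (toggles lsign g l).1 a

/-- A sign that all five provers contribute counts once, because five is odd. -/
lemma tens_smul_five (c : ℂ) (hc : c * c = 1) (M : ∀ t, Matrix (σ.P t) (σ.P t) ℂ) :
    tens (fun t => c • M t) = c • tens M := by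
  ext x y
  rw [Matrix.smul_apply, tens_apply, tens_apply]
  simp only [Matrix.smul_apply, smul_eq_mul, Finset.prod_mul_distrib, Finset.prod_const,
    Finset.card_univ, Fintype.card_fin]
  linear_combination (c * (c * c + 1) * ∏ t, M t (x t) (y t)) * hc

/-- The logical operators nearly form a representation of the Pauli group, on the vectors that
result from `σ.vec` by Pauli words on the answers to a question. -/
lemma logical_mul_word (hσ : σ.IsQuantum) (hk : 2 ≤ k) {ρ : ℝ} (h : StabBound enc l₀ σ ρ)
    {s : ℕ} (e : Fin s → Fin k) (f : Fin s → Fin n) {v : Fin k → Option (Fin n)}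
    (hv : ∀ a, Asks v (e a) (f a)) (g : Bool × Fin n → Bool) (L : List (Bool × Fin s)) :
    ‖σ.logical enc l₀ g (cl (σ.pull (fun _ => enc v)
        (tensW fun _ => wordOp (fun p => pauli (p.1, e p.2)) L)) σ.vec) -
      (toggles lsign g (L.map fun p => (p.1, f p.2))).2 •
        σ.logical enc l₀ (toggles lsign g (L.map fun p => (p.1, f p.2))).1 σ.vec‖ ≤
      5 * (L.length * (3 * (2 * √ρ) + 28 * n * (2 * √ρ))) := by
  set c := (toggles lsign g (L.map fun p => (p.1, f p.2))).2 with hc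
  set g' := (toggles lsign g (L.map fun p => (p.1, f p.2))).1
  have hcc : c * c = 1 := toggles_mul_self _ _
  have hc1 : ‖c‖ = 1 := norm_toggles _ norm_lsign _ _
  have hw : wordOp (fun p => pauli (p.1, e p.2)) L ∈ Matrix.unitaryGroup (Fin k → Bool) ℂ :=
    list_prod_mem fun _ hB => by
      obtain ⟨a, -, rfl⟩ := List.mem_map.1 hB
      exact pauli_mem_unitary _
  have key := norm_tens_sub_le (σ := σ)
    (fun t => σ.mono enc l₀ t g *
      σ.localPull t (enc v) (wordOp (fun p => pauli (p.1, e p.2)) L))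
    (fun t => c • σ.mono enc l₀ t g')
    (fun t => by
      rw [map_mul]; exact (mono_contraction hσ h t g).mul (obs_contraction hσ t _ hw))
    (fun t => by rw [obs_smul]; exact (mono_contraction hσ h t g').smul hc1)
    (fun t => by
      rw [map_mul, obs_smul]
      exact mono_mul_word hσ hk h t e f hv g L)
  rw [tens_smul_five c hcc, cl_smul] at key
  rw [pull_tensW, Strategy.logical, ← cl_mul, tens_mul]
  exact key

lemma logical_contraction (hσ : σ.IsQuantum) {ρ : ℝ} (h : StabBound enc l₀ σ ρ)
    (g : Bool × Fin n → Bool) : IsContraction (σ.logical enc l₀ g) :=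
  tens_contraction _ fun t => mono_contraction hσ h t g

/-- The logical operators nearly preserve the norm of `σ.vec`, as the reversed words nearly undo
them. Five provers undo at most `2 * n` letters each, with an error of `12 * (2 * √ρ)` per letter. -/
lemma norm_logical_ge (hσ : σ.IsQuantum) {ρ : ℝ} (h : StabBound enc l₀ σ ρ)
    (g : Bool × Fin n → Bool) :
    1 - 120 * n * (2 * √ρ) ≤ ‖σ.logical enc l₀ g σ.vec‖ := by
  have hδ : (0 : ℝ) ≤ 2 * √ρ := by positivity
  set R : ∀ t, Matrix (σ.P t) (σ.P t) ℂ := fun t =>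
    wordOp (σ.letterMat enc l₀ t) ((letters n).filter g).reverse with hR
  have hRo : ∀ t, σ.obs t (R t) =
      wordOp (fun a => σ.obs t (σ.letterMat enc l₀ t a)) ((letters n).filter g).reverse := by
    intro t
    rw [hR, map_list_prod, List.map_map]; rfl
  have hRc : ∀ t, IsContraction (σ.obs t (R t)) := fun t => by
    rw [hRo]; exact (mirrored hσ h t).contr_word _
  have hlen : (((letters n).filter g).length : ℝ) ≤ 2 * n := by
    have := List.length_filter_le g (letters n)
    rw [length_letters] at this
    exact_mod_cast this
  have key := norm_tens_sub_le (σ := σ) (fun t => R t * σ.mono enc l₀ t g) (fun t => 1)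
    (fun t => by
      rw [map_mul]; exact (hRc t).mul (mono_contraction hσ h t g))
    (fun t => by rw [map_one]; exact IsContraction.one)
    (η := 2 * n * (12 * (2 * √ρ))) (fun t => by
      have k := (mirrored hσ h t).reverse_word (δ' := 10 * (2 * √ρ)) ((letters n).filter g)
        fun a _ => letters_sq hσ h t a
      rw [map_mul, map_one, hRo, obs_mono]
      refine k.trans ?_
      have : 10 * (2 * √ρ) + 2 * (2 * √ρ) = 12 * (2 * √ρ) := by ring
      rw [this]
      gcongr)
  rw [tens_one, cl_one, ← tens_mul, cl_mul] at key
  have k1 : ‖cl (tens R) (σ.logical enc l₀ g σ.vec)‖ ≤ ‖σ.logical enc l₀ g σ.vec‖ :=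
    tens_contraction R hRc _
  have k2 := norm_sub_norm_le σ.vec (cl (tens R) (σ.logical enc l₀ g σ.vec))
  rw [norm_sub_rev, norm_vec hσ] at k2
  have k3 : ‖cl (tens R) (σ.logical enc l₀ g σ.vec) - σ.vec‖ ≤ 5 * (2 * n * (12 * (2 * √ρ))) := key
  linarith

end Monomials

/-! ### Decoding of all blocks -/

section DecodeAll

open scoped InnerProductSpace

variable {k n m : ℕ} {σ : Strategy k}

/-- The decoders of the blocks in a list. -/
noncomputable def decodeAll (L : List (Fin k)) : Op (Wire k) :=
  (L.map fun l => lift (blockWires fun _ => l) decoder).prod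

lemma decodeAll_mem_unitary (L : List (Fin k)) :
    decodeAll L ∈ Matrix.unitaryGroup (Wire k → Bool) ℂ :=
  list_prod_mem fun _ hB => by
    obtain ⟨a, -, rfl⟩ := List.mem_map.1 hB
    exact lift_mem_unitary _ decoder_mem_unitary

lemma tensW_pauli (p : Bool) (l : Fin k) :
    (tensW fun _ => pauli (p, l)) = lift (blockWires fun _ => l) (tens fun _ => sig p) := by
  rw [lift_blockWires_tens]; rfl

lemma commute_lift_decoder {p : Bool} {l l' : Fin k} (h : l ≠ l') (t : Fin 5) :
    Commute (pauli (p, ((t, l) : Wire k))) (lift (blockWires fun _ => l') decoder) :=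
  commute_pauli_lift _ _ _ (by rintro ⟨t', ht'⟩; exact h (congrArg Prod.snd ht').symm)

lemma commute_tensW_decoder {p : Bool} {l l' : Fin k} (h : l ≠ l') :
    Commute (tensW fun _ => pauli (p, l)) (lift (blockWires fun _ => l') decoder) := by
  rw [tensW_pauli, tens_sig]
  simp only [lift_mul, lift_pauli]
  exact ((((commute_lift_decoder h _).mul_left (commute_lift_decoder h _)).mul_left
    (commute_lift_decoder h _)).mul_left (commute_lift_decoder h _)).mul_left
    (commute_lift_decoder h _)

/-- After decoding, a Pauli operator on a logical qubit is the corresponding operator on all five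
qubits of the block before. -/
lemma pauli_mul_decodeAll (p : Bool) {l : Fin k} {L : List (Fin k)} (hL : L.Nodup) (hl : l ∈ L) :
    pauli (p, ((0, l) : Wire k)) * decodeAll L = decodeAll L * tensW fun _ => pauli (p, l) := by
  induction L with
  | nil => simp at hl
  | cons l' L ih =>
    rw [List.nodup_cons] at hL
    have e : decodeAll (l' :: L) = lift (blockWires fun _ => l') decoder * decodeAll L := by
      simp [decodeAll]
    rw [e]
    by_cases h : l = l'
    · subst h
      have h1 : Commute (tensW fun _ => pauli (p, l)) (decodeAll L) :=
        Commute.list_prod_right _ _ fun B hB => by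
          obtain ⟨a, ha, rfl⟩ := List.mem_map.1 hB
          exact commute_tensW_decoder fun h => hL.1 (h ▸ ha)
      have h2 : pauli (p, ((0, l) : Wire k)) * lift (blockWires fun _ => l) decoder =
          lift (blockWires fun _ => l) decoder * tensW fun _ => pauli (p, l) := by
        have : ((0, l) : Wire k) = blockWires (fun _ => l) 0 := rfl
        rw [tensW_pauli, this, ← lift_pauli, ← lift_mul, ← lift_mul, pauli_mul_decoder]
      rw [← mul_assoc, h2, mul_assoc, h1.eq, mul_assoc]
    · have hl' : l ∈ L := by simpa [h] using hl
      rw [← mul_assoc, (commute_lift_decoder h 0).eq, mul_assoc, ih hL.2 hl', mul_assoc]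

/-- The wires that carry the logical qubits after decoding. -/
def logicalWires (k : ℕ) : Fin k ↪ Wire k := ⟨fun l => (0, l), fun _ _ h => congrArg Prod.snd h⟩

lemma wordOp_mul_decodeAll {s : ℕ} (hs : s ≤ k) (L : List (Bool × Fin s)) :
    lift ((Fin.castLEEmb hs).trans (logicalWires k)) (wordOp pauli L) *
        decodeAll (List.finRange k) =
      decodeAll (List.finRange k) *
        tensW fun _ => wordOp (fun p => pauli (p.1, Fin.castLE hs p.2)) L := by
  rw [lift_wordOp]
  induction L with
  | nil => simp [wordOp, tensW_one]
  | cons p L ih =>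
    have h1 := pauli_mul_decodeAll p.1 (List.nodup_finRange k)
      (List.mem_finRange (Fin.castLE hs p.2))
    have e1 : (tensW fun _ => wordOp (fun p => pauli (p.1, Fin.castLE hs p.2)) (p :: L)) =
        (tensW fun _ => pauli (p.1, Fin.castLE hs p.2)) *
          tensW fun _ => wordOp (fun p => pauli (p.1, Fin.castLE hs p.2)) L := by
      rw [tensW_mul]; simp [wordOp]
    rw [e1, ← mul_assoc, ← h1, List.map_cons, wordOp, List.map_cons, List.prod_cons, mul_assoc,
      ← wordOp, ih, mul_assoc]
    rfl

/-- The operator on the answers that is measured in the energy test, expanded in Pauli words. -/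
lemma conj_decodeAll {s : ℕ} (hs : s ≤ k) {A : Op (Fin s)} {c : (Bool × Fin s → Bool) → ℂ}
    (hA : A = ∑ g, c g • wordOp pauli ((letters s).filter g)) :
    (decodeAll (List.finRange k)).conjTranspose *
      lift ((Fin.castLEEmb hs).trans (logicalWires k)) A * decodeAll (List.finRange k) =
    ∑ g, c g • tensW fun _ =>
      wordOp (fun p => pauli (p.1, Fin.castLE hs p.2)) ((letters s).filter g) := by
  have hU : (decodeAll (List.finRange k)).conjTranspose * decodeAll (List.finRange k) = 1 :=
    Matrix.mem_unitaryGroup_iff'.1 (decodeAll_mem_unitary _)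
  rw [hA, lift_sum, Matrix.mul_sum, Matrix.sum_mul]
  refine Finset.sum_congr rfl fun g _ => ?_
  rw [lift_smul, Matrix.mul_smul, Matrix.smul_mul, Matrix.mul_assoc, wordOp_mul_decodeAll,
    ← Matrix.mul_assoc, hU, one_mul]

/-- The tuple of questions for a term of the Hamiltonian. -/
def termTuple (H : LocalHamiltonian k n m) (j : Fin m) : Fin k → Option (Fin n) := fun l =>
  if h : (l : ℕ) < H.size j then some (H.supp j ⟨l, h⟩) else none

lemma asks_termTuple (H : LocalHamiltonian k n m) (j : Fin m) (a : Fin (H.size j)) :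
    Asks (termTuple H j) (Fin.castLE (H.size_le j) a) (H.supp j a) := by
  constructor
  · simp [termTuple]
  · intro l hl h
    rw [termTuple] at h
    split_ifs at h with h1
    have h2 := (H.supp j).injective (Option.some.inj h)
    apply hl
    ext
    simp [← h2]

/-- `s` is a configuration in which the energy of term `j` is measured. -/
structure IsEnergy (enc : (Fin k → Option (Fin n)) → List Bool) (H : LocalHamiltonian k n m)
    (j : Fin m) (s : Config k) : Prop where
  msg : s.msg = fun _ => enc (termTuple H j)
  circuit : s.circuit = decodeAll (List.finRange k)
  verdict : s.verdict = .energy j (logicalWires k)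

/-- `s` is a configuration in which the code test is made for the slot `l` of the tuple `v`,
which is sent to prover `t`. -/
structure IsCodeTest (enc : (Fin k → Option (Fin n)) → List Bool) (l₀ : Fin k)
    (v : Fin k → Option (Fin n)) (t : Fin 5) (l : Fin k) (i : Fin n) (s : Config k) : Prop where
  msg : s.msg = testMsg enc l₀ v t i
  circuit : s.circuit = lift (blockWires (testSlots l₀ t l)) decoder
  verdict : s.verdict = .zeros (syndromeWires (testSlots l₀ t l))

variable {enc : (Fin k → Option (Fin n)) → List Bool} {l₀ : Fin k}

lemma one_sub_acceptIn_energy (hσ : σ.IsQuantum) {H : LocalHamiltonian k n m} {j : Fin m}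
    {s : Config k} (hs : IsEnergy enc H j s) :
    1 - acceptIn H σ s = (⟪σ.vec, cl (σ.pull (fun _ => enc (termTuple H j))
      ((decodeAll (List.finRange k)).conjTranspose *
        lift ((Fin.castLEEmb (H.size_le j)).trans (logicalWires k)) (H.term j) *
        decodeAll (List.finRange k))) σ.vec⟫_ℂ).re := by
  have hU := sum_norm_answer hσ s.msg (decodeAll_mem_unitary (List.finRange k))
  rw [expect_pull, acceptIn, ← hU, hs.circuit, ← Finset.sum_sub_distrib, hs.msg]
  refine Finset.sum_congr rfl fun e _ => ?_
  set u := (decodeAll (List.finRange k)).mulVec (σ.answer (fun _ => enc (termTuple H j)) e)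
  rw [expect_conj, ← expect_one, hs.verdict]
  simp only [LocalHamiltonian.effect, j.2, dif_pos]
  rw [expect_sub, sub_sub_cancel]

end DecodeAll

/-! ### The extraction of an `n`-qubit state -/

section Extraction

variable {V : Type*} [NormedAddCommGroup V] [InnerProductSpace ℂ V] {n : ℕ}

/-- The exponents `a` of the letters `X` and `b` of the letters `Z`. -/
def pair (a b : Fin n → Bool) : Bool × Fin n → Bool := fun p => if p.1 then b p.2 else a p.2

/-- The linear transformation that identifies families indexed by the Pauli group modulo signs
with families indexed by pairs of bit strings: it intertwines the right regular representation of
the Pauli group with the usual one on the first string. -/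
noncomputable def transf (F : (Bool × Fin n → Bool) → V) (x r : Fin n → Bool) : V :=
  ∑ b, chi b x • F (pair (bxor x r) b)

lemma sum_norm_chi_smul (v : (Fin n → Bool) → V) :
    ∑ x, ‖∑ b, chi b x • v b‖ ^ 2 = 2 ^ n * ∑ b, ‖v b‖ ^ 2 := by
  have h1 : ∀ u : V, ((‖u‖ ^ 2 : ℝ) : ℂ) = inner ℂ u u := fun u => by
    rw [inner_self_eq_norm_sq_to_K]; simp
  apply Complex.ofReal_injective
  rw [Complex.ofReal_sum, Complex.ofReal_mul, Complex.ofReal_sum]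
  simp only [h1, sum_inner, inner_sum, inner_smul_left, inner_smul_right]
  have h2 : ∀ b x : Fin n → Bool, (starRingEnd ℂ) (chi b x) = chi b x := star_chi
  simp only [h2]
  rw [Finset.sum_comm]
  rw [Complex.ofReal_pow, Complex.ofReal_ofNat, Finset.mul_sum]
  refine Finset.sum_congr rfl fun b _ => ?_
  simp only [Finset.mul_sum]
  rw [Finset.sum_comm]
  rw [Finset.sum_eq_single b]
  · have h3 := sum_chi_mul_chi b b
    simp only [chi_comm _ b, if_true, Fintype.card_fin] at h3
    simp only [← mul_assoc, ← Finset.sum_mul, h3]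
  · intro b' _ hb'
    have h3 := sum_chi_mul_chi b b'
    rw [if_neg hb'.symm] at h3
    have h4 : ∑ x : Fin n → Bool, chi b x * chi b' x = 0 := by
      rw [← h3]; exact Finset.sum_congr rfl fun x _ => by rw [chi_comm b, chi_comm b']
    simp only [← mul_assoc, ← Finset.sum_mul]
    rw [h4, zero_mul]
  · simp

lemma sum_pair {E : Type*} [AddCommMonoid E] (F : (Bool × Fin n → Bool) → E) :
    ∑ g, F g = ∑ a, ∑ b, F (pair a b) := by
  rw [← sum_letters (fun a b => F (pair a b))]
  refine Finset.sum_congr rfl fun g _ => ?_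
  congr 1
  ext ⟨p, i⟩
  cases p <;> simp [pair]

/-- Parseval's identity. -/
lemma sum_norm_transf (F : (Bool × Fin n → Bool) → V) :
    ∑ x, ∑ r, ‖transf F x r‖ ^ 2 = 2 ^ n * ∑ g, ‖F g‖ ^ 2 := by
  have h1 : ∀ x : Fin n → Bool, ∑ r, ‖transf F x r‖ ^ 2 =
      ∑ a, ‖∑ b, chi b x • F (pair a b)‖ ^ 2 := by
    intro x
    refine Fintype.sum_bijective (fun r => bxor x r) ?_ _ _ fun r => rfl
    refine Function.Involutive.bijective fun r => ?_
    ext i; simp [bxor]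
  simp only [h1]
  rw [Finset.sum_comm]
  simp only [sum_norm_chi_smul, sum_pair, Finset.mul_sum]

/-- The action of an operator on the first string. -/
noncomputable def actFirst (M : Op (Fin n)) (G : (Fin n → Bool) → (Fin n → Bool) → V)
    (x r : Fin n → Bool) : V := ∑ y, M x y • G y r

lemma actFirst_mul (M N : Op (Fin n)) (G : (Fin n → Bool) → (Fin n → Bool) → V) :
    actFirst (M * N) G = actFirst M (actFirst N G) := by
  ext x r
  simp only [actFirst, Matrix.mul_apply, Finset.sum_smul, Finset.smul_sum, smul_smul]
  exact Finset.sum_comm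

lemma actFirst_one (G : (Fin n → Bool) → (Fin n → Bool) → V) : actFirst 1 G = G := by
  ext x r
  simp [actFirst, Matrix.one_apply]

lemma actFirst_sum {J : Type*} (s : Finset J) (c : J → ℂ) (M : J → Op (Fin n))
    (G : (Fin n → Bool) → (Fin n → Bool) → V) (x r : Fin n → Bool) :
    actFirst (∑ j ∈ s, c j • M j) G x r = ∑ j ∈ s, c j • actFirst (M j) G x r := by
  simp only [actFirst, Matrix.sum_apply, Matrix.smul_apply, Finset.sum_smul, Finset.smul_sum,
    smul_smul, smul_eq_mul]
  exact Finset.sum_comm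

lemma actFirst_pauli (a : Bool × Fin n) (F : (Bool × Fin n → Bool) → V) :
    actFirst (pauli a) (transf F) = transf fun g => lsign g a • F (toggle g a) := by
  obtain ⟨p, j⟩ := a
  ext x r
  cases p
  · have h1 : actFirst (pauli (false, j)) (transf F) x r = transf F (toggle x j) r := by
      simp [actFirst, pauli_false]
    rw [h1, transf, transf]
    refine Finset.sum_congr rfl fun b _ => ?_
    rw [chi_comm, chi_toggle, mul_comm, mul_smul, chi_comm]
    congr 3
    ext ⟨q, i⟩
    cases q
    · by_cases hi : i = j
      · subst hi; simp [pair, bxor]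
      · simp [pair, bxor, hi]
    · simp [pair]
  · have h1 : actFirst (pauli (true, j)) (transf F) x r = sgn (x j) • transf F x r := by
      simp [actFirst, pauli_true]
    rw [h1, transf, transf, Finset.smul_sum]
    refine Fintype.sum_bijective (fun b => toggle b j)
      (Function.Involutive.bijective fun b => toggle_toggle b j) _ _ fun b => ?_
    rw [chi_toggle, smul_smul]
    simp only [lsign, if_true, one_smul]
    congr 2
    ext ⟨q, i⟩
    cases q
    · simp [pair]
    · by_cases hi : i = j
      · subst hi; simp [pair]
      · simp [pair, hi]

lemma actFirst_wordOp (L : List (Bool × Fin n)) (F : (Bool × Fin n → Bool) → V) :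
    actFirst (wordOp pauli L) (transf F) =
      transf fun g => (toggles lsign g L).2 • F (toggles lsign g L).1 := by
  induction L using List.reverseRecOn generalizing F with
  | nil => simp [toggles, actFirst_one]
  | append_singleton L a ih =>
    rw [wordOp_concat, actFirst_mul, actFirst_pauli, ih]
    simp only [toggles_concat, smul_smul]

/-- An operator on some of the qubits, applied to the transform of a family. -/
lemma actFirst_lift {s : ℕ} (f : Fin s ↪ Fin n) {A : Op (Fin s)} {c : (Bool × Fin s → Bool) → ℂ}
    (hA : A = ∑ g, c g • wordOp pauli ((letters s).filter g)) (F : (Bool × Fin n → Bool) → V) :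
    actFirst (lift f A) (transf F) = transf fun g => ∑ h, c h •
      (toggles lsign g (((letters s).filter h).map fun p => (p.1, f p.2))).2 •
        F (toggles lsign g (((letters s).filter h).map fun p => (p.1, f p.2))).1 := by
  ext x r
  rw [hA, lift_sum]
  simp only [lift_smul, lift_wordOp]
  rw [actFirst_sum]
  simp only [actFirst_wordOp, transf, Finset.smul_sum]
  rw [Finset.sum_comm]
  refine Finset.sum_congr rfl fun b _ => Finset.sum_congr rfl fun h _ => ?_
  rw [smul_comm]

end Extraction

/-! ### Soundness for questions on at least two qubits -/

section EnergyBound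

open scoped InnerProductSpace

variable {k n m : ℕ} {σ : Strategy k}

lemma expect_conjTranspose_mul_self {B : Type} [Fintype B] [DecidableEq B] (A : Matrix B B ℂ)
    (v : B → ℂ) : expect (A.conjTranspose * A) v = ∑ x, ‖A.mulVec v x‖ ^ 2 := by
  have h1 := expect_conj A 1 v
  rwa [mul_one, expect_one] at h1

lemma expect_sum {B J : Type} [Fintype B] (s : Finset J) (A : J → Matrix B B ℂ) (v : B → ℂ) :
    expect (∑ j ∈ s, A j) v = ∑ j ∈ s, expect (A j) v := by
  simp only [expect, Matrix.sum_mulVec, dotProduct_sum, Complex.re_sum]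

lemma expect_op (H : LocalHamiltonian k n m) (v : (Fin n → Bool) → ℂ) :
    expect H.op v = ∑ j, expect (lift (H.supp j).toEmbedding (H.term j)) v := expect_sum _ _ _

lemma expect_op_le (H : LocalHamiltonian k n m) (v : (Fin n → Bool) → ℂ) :
    expect H.op v ≤ m * ∑ x, ‖v x‖ ^ 2 := by
  rw [expect_op]
  have h1 : ∀ j, expect (lift (H.supp j).toEmbedding (H.term j)) v ≤ ∑ x, ‖v x‖ ^ 2 := by
    intro j
    have h2 := expect_lift_nonneg (H.supp j).toEmbedding (H.term_le_one j) v
    rw [lift_sub, lift_one, expect_sub, expect_one] at h2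
    linarith
  refine (Finset.sum_le_sum fun j _ => h1 j).trans ?_
  simp

lemma expect_smul {B : Type} [Fintype B] [DecidableEq B] (A : Matrix B B ℂ) (r : ℝ) (v : B → ℂ) :
    expect A ((r : ℂ) • v) = r ^ 2 * expect A v := by
  rw [expect, expect, Matrix.mulVec_smul, star_smul, smul_dotProduct, dotProduct_smul]
  simp [← mul_assoc, pow_two]

lemma exists_isState_expect {B : Type} [Fintype B] [DecidableEq B] {v : B → ℂ} (hv : v ≠ 0) :
    0 < ∑ x, ‖v x‖ ^ 2 ∧
      ∃ ψ, IsState ψ ∧ ∀ A, expect A v = (∑ x, ‖v x‖ ^ 2) * expect A ψ := by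
  have hN : 0 ≤ ∑ x, ‖v x‖ ^ 2 := by positivity
  have hpos : 0 < ∑ x, ‖v x‖ ^ 2 := by
    refine hN.lt_of_ne fun h0 => hv ?_
    ext x
    have := (Finset.sum_eq_zero_iff_of_nonneg fun x _ => by positivity).1 h0.symm x
      (Finset.mem_univ x)
    simpa using this
  refine ⟨hpos, ((((√(∑ x, ‖v x‖ ^ 2))⁻¹ : ℝ) : ℂ) • v), ?_, fun A => ?_⟩
  · rw [IsState]
    simp only [Pi.smul_apply, norm_smul, mul_pow, Complex.norm_real, Real.norm_eq_abs, sq_abs,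
      inv_pow, Real.sq_sqrt hN]
    rw [← Finset.mul_sum]
    exact inv_mul_cancel₀ hpos.ne'
  · rw [expect_smul, inv_pow, Real.sq_sqrt hN, mul_inv_cancel_left₀ hpos.ne']

/-- A bound for the expectation value on states extends to all vectors. -/
lemma mul_norm_sq_le_expect {B : Type} [Fintype B] [DecidableEq B] {A : Matrix B B ℂ} {r : ℝ}
    (h : ∀ ψ, IsState ψ → r ≤ expect A ψ) (v : B → ℂ) :
    r * ∑ x, ‖v x‖ ^ 2 ≤ expect A v := by
  by_cases hv : v = 0
  · subst hv; simp [expect]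
  · obtain ⟨hpos, ψ, hψ, hA⟩ := exists_isState_expect hv
    rw [hA, mul_comm]
    exact mul_le_mul_of_nonneg_left (h ψ hψ) hpos.le

/-- Operators of norm at most one have entries of norm at most one. -/
lemma norm_entry_le_one {ι : Type} [Fintype ι] [DecidableEq ι] {A : Op ι}
    (hA : (1 - A.conjTranspose * A).PosSemidef) (x y : ι → Bool) : ‖A x y‖ ≤ 1 := by
  have h := hA.diag_nonneg (i := y)
  have h1 : (A.conjTranspose * A) y y = ((∑ x, ‖A x y‖ ^ 2 : ℝ) : ℂ) := by
    rw [Matrix.mul_apply, Complex.ofReal_sum]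
    refine Finset.sum_congr rfl fun x _ => ?_
    rw [Matrix.conjTranspose_apply, Complex.star_def, Complex.conj_mul']
    simp
  rw [Matrix.sub_apply, Matrix.one_apply_eq, h1, ← Complex.ofReal_one, ← Complex.ofReal_sub,
    Complex.zero_le_real] at h
  have h2 : ‖A x y‖ ^ 2 ≤ ∑ x, ‖A x y‖ ^ 2 :=
    Finset.single_le_sum (f := fun x => ‖A x y‖ ^ 2) (fun x _ => by positivity) (Finset.mem_univ x)
  exact (sq_le_one_iff₀ (norm_nonneg _)).1 (by linarith)

lemma pull_sum_smul {J : Type} (q : Fin 5 → List Bool) (s : Finset J) (c : J → ℂ)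
    (B : J → Op (Wire k)) (v : EuclideanSpace ℂ (∀ t, σ.P t)) :
    cl (σ.pull q (∑ j ∈ s, c j • B j)) v = ∑ j ∈ s, c j • cl (σ.pull q (B j)) v := by
  have h : σ.pull q (∑ j ∈ s, c j • B j) = ∑ j ∈ s, c j • σ.pull q (B j) := by
    simp only [Strategy.pull, amp_sum, amp_smul, Matrix.mul_sum, Matrix.sum_mul, Matrix.mul_smul,
      Matrix.smul_mul]
  rw [h, cl_sum]
  simp only [cl_smul]

/-- The energy of a family of vectors in a Euclidean space, coordinate by coordinate. -/
lemma energy_family_ge {I : Type} [Fintype I] (H : LocalHamiltonian k n m) {b : ℝ}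
    (hb : ∀ Ψ, IsState Ψ → b * m ≤ expect H.op Ψ) {A : ∀ j, Op (Fin (H.size j))}
    (hA : ∀ j, H.term j = (A j).conjTranspose * A j)
    (G : (Fin n → Bool) → (Fin n → Bool) → EuclideanSpace ℂ I) :
    b * m * ∑ x, ∑ r, ‖G x r‖ ^ 2 ≤
      ∑ j, ∑ x, ∑ r, ‖actFirst (lift (H.supp j).toEmbedding (A j)) G x r‖ ^ 2 := by
  have h1 : ∀ (r : Fin n → Bool) (y : I), b * m * ∑ x, ‖G x r y‖ ^ 2 ≤
      ∑ j, ∑ x, ‖actFirst (lift (H.supp j).toEmbedding (A j)) G x r y‖ ^ 2 := by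
    intro r y
    refine (mul_norm_sq_le_expect hb fun x => G x r y).trans (le_of_eq ?_)
    rw [expect_op]
    refine Finset.sum_congr rfl fun j _ => ?_
    rw [hA, lift_mul, ← lift_conjTranspose, expect_conjTranspose_mul_self]
    refine Finset.sum_congr rfl fun x _ => ?_
    simp [actFirst, Matrix.mulVec, dotProduct]
  have h2 : ∀ f : (Fin n → Bool) → (Fin n → Bool) → I → ℝ,
      ∑ x, ∑ r, ∑ y, f x r y = ∑ r, ∑ y, ∑ x, f x r y := fun f => by
    rw [Finset.sum_comm]
    exact Finset.sum_congr rfl fun r _ => Finset.sum_comm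
  simp only [EuclideanSpace.norm_sq_eq, h2]
  calc _ = ∑ r, ∑ y, b * m * ∑ x, ‖G x r y‖ ^ 2 := by simp only [Finset.mul_sum]
    _ ≤ ∑ r, ∑ y, ∑ j, ∑ x, ‖actFirst (lift (H.supp j).toEmbedding (A j)) G x r y‖ ^ 2 :=
        Finset.sum_le_sum fun r _ => Finset.sum_le_sum fun y _ => h1 r y
    _ = ∑ r, ∑ j, ∑ y, ∑ x, ‖actFirst (lift (H.supp j).toEmbedding (A j)) G x r y‖ ^ 2 :=
        Finset.sum_congr rfl fun r _ => Finset.sum_comm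
    _ = _ := Finset.sum_comm

variable {enc : (Fin k → Option (Fin n)) → List Bool} {l₀ : Fin k}

variable (σ enc) in
/-- The probability that the energy test of term `j` rejects. -/
noncomputable def energyRej (H : LocalHamiltonian k n m) (j : Fin m) : ℝ :=
  (⟪σ.vec, cl (σ.pull (fun _ => enc (termTuple H j))
      ((decodeAll (List.finRange k)).conjTranspose *
        lift ((Fin.castLEEmb (H.size_le j)).trans (logicalWires k)) (H.term j) *
        decodeAll (List.finRange k))) σ.vec⟫_ℂ).re

lemma energyRej_nonneg (H : LocalHamiltonian k n m) (j : Fin m) : 0 ≤ energyRej σ enc H j := by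
  rw [energyRej, expect_pull]
  refine Finset.sum_nonneg fun e _ => ?_
  rw [expect_conj]
  exact expect_lift_nonneg _ (H.term_nonneg j) _

/-- The logical operators carry the vector measured in the energy test of a term to the image
of the extracted state under the factor `A` of this term. -/
lemma norm_sum_toggles_le (hσ : σ.IsQuantum) (hk : 2 ≤ k) {ρ : ℝ} (h : StabBound enc l₀ σ ρ)
    (hn : 1 ≤ n) (H : LocalHamiltonian k n m) (j : Fin m) {A : Op (Fin (H.size j))}
    (hA : H.term j = A.conjTranspose * A) {c : (Bool × Fin (H.size j) → Bool) → ℂ}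
    (hc : ∀ g, ‖c g‖ ≤ 1) (hcA : A = ∑ g, c g • wordOp pauli ((letters (H.size j)).filter g))
    (g : Bool × Fin n → Bool) :
    ‖∑ h, c h • (toggles lsign g (((letters (H.size j)).filter h).map
        fun p => (p.1, (H.supp j).toEmbedding p.2))).2 •
      σ.logical enc l₀ (toggles lsign g (((letters (H.size j)).filter h).map
        fun p => (p.1, (H.supp j).toEmbedding p.2))).1 σ.vec‖ ≤
      √(energyRej σ enc H j) + 4 ^ k * (310 * k * n * (2 * √ρ)) := by
  set U := decodeAll (List.finRange k)
  have hU : U * U.conjTranspose = 1 := Matrix.mem_unitaryGroup_iff.1 (decodeAll_mem_unitary _)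
  set f := (Fin.castLEEmb (H.size_le j)).trans (logicalWires k)
  set q : Fin 5 → List Bool := fun _ => enc (termTuple H j)
  set X : (Bool × Fin (H.size j) → Bool) → EuclideanSpace ℂ (∀ t, σ.P t) := fun h =>
    cl (σ.pull q (tensW fun _ => wordOp (fun p => pauli (p.1, Fin.castLE (H.size_le j) p.2))
      ((letters (H.size j)).filter h))) σ.vec with hX
  have h1 : ‖∑ h, c h • X h‖ ^ 2 ≤ energyRej σ enc H j := by
    have h2 := norm_pull_sq_le hσ q (U.conjTranspose * lift f A * U) σ.vec
    have h3 : (U.conjTranspose * lift f A * U).conjTranspose * (U.conjTranspose * lift f A * U) =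
        U.conjTranspose * lift f (H.term j) * U := by
      rw [hA, lift_mul, ← lift_conjTranspose]
      simp only [Matrix.conjTranspose_mul, Matrix.conjTranspose_conjTranspose]
      calc _ = U.conjTranspose * (lift f A).conjTranspose * (U * U.conjTranspose) * lift f A * U := by
            simp only [Matrix.mul_assoc]
        _ = _ := by rw [hU, Matrix.mul_one]; simp only [Matrix.mul_assoc]
    rw [h3] at h2
    rw [conj_decodeAll (H.size_le j) hcA, pull_sum_smul] at h2
    exact h2
  have h4 : ‖∑ h, c h • X h‖ ≤ √(energyRej σ enc H j) := Real.le_sqrt_of_sq_le h1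
  have hδ : (0 : ℝ) ≤ 2 * √ρ := by positivity
  set Y : (Bool × Fin (H.size j) → Bool) → EuclideanSpace ℂ (∀ t, σ.P t) := fun h =>
    (toggles lsign g (((letters (H.size j)).filter h).map fun p => (p.1, (H.supp j).toEmbedding p.2))).2 •
      σ.logical enc l₀ (toggles lsign g (((letters (H.size j)).filter h).map
        fun p => (p.1, (H.supp j).toEmbedding p.2))).1 σ.vec with hY
  have h5 : ∀ h, ‖σ.logical enc l₀ g (X h) - Y h‖ ≤ 310 * k * n * (2 * √ρ) := by
    intro h'
    refine (logical_mul_word hσ hk h (Fin.castLE (H.size_le j)) (H.supp j) (asks_termTuple H j) g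
      ((letters (H.size j)).filter h')).trans ?_
    have hl : ((((letters (H.size j)).filter h').length : ℕ) : ℝ) ≤ 2 * k := by
      have := List.length_filter_le h' (letters (H.size j))
      rw [length_letters] at this
      have hs : H.size j ≤ k := H.size_le j
      have : ((letters (H.size j)).filter h').length ≤ 2 * k := by omega
      exact_mod_cast this
    have hn' : (1 : ℝ) ≤ n := by exact_mod_cast hn
    -- `310 = 5 * 2 * (3 + 28)`
    have e1 : 3 * (2 * √ρ) + 28 * n * (2 * √ρ) ≤ 31 * n * (2 * √ρ) := by nlinarith
    calc _ ≤ 5 * ((2 * k : ℝ) * (31 * n * (2 * √ρ))) := by gcongr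
      _ = _ := by ring
  have h6 : ∑ h, c h • Y h = σ.logical enc l₀ g (∑ h, c h • X h) -
      ∑ h, c h • (σ.logical enc l₀ g (X h) - Y h) := by
    simp only [map_sum, map_smul, smul_sub, Finset.sum_sub_distrib]
    abel
  have h7 : ‖∑ h, c h • (σ.logical enc l₀ g (X h) - Y h)‖ ≤
      4 ^ k * (310 * k * n * (2 * √ρ)) := by
    refine (norm_sum_le _ _).trans ?_
    have : ∀ h ∈ (Finset.univ : Finset (Bool × Fin (H.size j) → Bool)),
        ‖c h • (σ.logical enc l₀ g (X h) - Y h)‖ ≤ 310 * k * n * (2 * √ρ) := fun h' _ => by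
      rw [norm_smul]
      calc _ ≤ 1 * (310 * k * n * (2 * √ρ)) :=
            mul_le_mul (hc h') (h5 h') (norm_nonneg _) zero_le_one
        _ = _ := one_mul _
    refine (Finset.sum_le_card_nsmul _ _ _ this).trans ?_
    rw [nsmul_eq_mul]
    gcongr
    have hcard : Finset.card (Finset.univ : Finset (Bool × Fin (H.size j) → Bool)) = 4 ^ H.size j := by
      rw [Finset.card_univ, Fintype.card_fun, Fintype.card_prod, Fintype.card_bool,
        Fintype.card_fin, pow_mul]; norm_num
    rw [hcard]
    push_cast
    exact pow_le_pow_right₀ (by norm_num) (H.size_le j)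
  change ‖∑ h, c h • Y h‖ ≤ _
  rw [h6]
  refine (norm_sub_le _ _).trans (add_le_add ?_ h7)
  exact (logical_contraction hσ h g _).trans h4

/-- A strategy that passes the code tests and the energy tests yields a state of low energy: the
transform of the vectors `σ.logical g σ.vec`. Its norm is bounded from below only if `n * √ρ` is
small; otherwise the bound is trivial, since `b ≤ 1`. -/
lemma energy_le_of_stabBound (hσ : σ.IsQuantum) (hk : 2 ≤ k) {ρ : ℝ} (hρ : 0 ≤ ρ)
    (h : StabBound enc l₀ σ ρ) (hn : 1 ≤ n) (H : LocalHamiltonian k n m) {b : ℝ}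
    (hb : ∀ Ψ, IsState Ψ → b * m ≤ expect H.op Ψ) :
    b * m ≤ 8 * ∑ j, energyRej σ enc H j +
      m * (32 * (4 ^ k * (310 * k)) ^ 2 * n ^ 2 * ρ) := by
  choose A hA using fun j => exists_eq_conjTranspose_mul_self (H.term_nonneg j)
  choose c hc hcA using fun j => exists_pauli_expansion (A j)
  have hc1 : ∀ j g, ‖c j g‖ ≤ 1 := fun j => hc j 1 (norm_entry_le_one (hA j ▸ H.term_le_one j))
  have hD := fun j => norm_sum_toggles_le hσ hk h hn H j (hA j) (hc1 j) (hcA j)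
  have hr : ∀ j, 0 ≤ energyRej σ enc H j := fun j => energyRej_nonneg H j
  have hδ : (0 : ℝ) ≤ 2 * √ρ := by positivity
  have hn' : (1 : ℝ) ≤ n := by exact_mod_cast hn
  have hk' : (2 : ℝ) ≤ k := by exact_mod_cast hk
  have hkk : (1 : ℝ) ≤ 4 ^ k := one_le_pow₀ (by norm_num)
  have hsum : 0 ≤ ∑ j, energyRej σ enc H j := Finset.sum_nonneg fun j _ => hr j
  have hm : (0 : ℝ) ≤ m := Nat.cast_nonneg m
  by_cases hbig : 120 * n * (2 * √ρ) ≤ 1 / 2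
  · set E := 4 ^ k * (310 * k * n * (2 * √ρ)) with hE
    set D : Fin m → (Bool × Fin n → Bool) → EuclideanSpace ℂ (∀ t, σ.P t) := fun j g =>
      ∑ h, c j h • (toggles lsign g (((letters (H.size j)).filter h).map
        fun p => (p.1, (H.supp j).toEmbedding p.2))).2 •
      σ.logical enc l₀ (toggles lsign g (((letters (H.size j)).filter h).map
        fun p => (p.1, (H.supp j).toEmbedding p.2))).1 σ.vec
    have h1 := energy_family_ge H hb hA (transf fun g => σ.logical enc l₀ g σ.vec)
    have h2 : ∀ j, actFirst (lift (H.supp j).toEmbedding (A j))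
        (transf fun g => σ.logical enc l₀ g σ.vec) = transf (D j) := fun j =>
      actFirst_lift _ (hcA j) _
    simp only [h2, sum_norm_transf] at h1
    have hcard : Finset.card (Finset.univ : Finset (Bool × Fin n → Bool)) = 4 ^ n := by
      rw [Finset.card_univ, Fintype.card_fun, Fintype.card_prod, Fintype.card_bool,
        Fintype.card_fin, pow_mul]; norm_num
    have h3 : ∀ j, ∑ g, ‖D j g‖ ^ 2 ≤ 4 ^ n * (2 * energyRej σ enc H j + 2 * E ^ 2) := by
      intro j
      have h4 : ∀ g ∈ (Finset.univ : Finset (Bool × Fin n → Bool)),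
          ‖D j g‖ ^ 2 ≤ 2 * energyRej σ enc H j + 2 * E ^ 2 := fun g _ => by
        have h5 : ‖D j g‖ ≤ √(energyRej σ enc H j) + E := hD j g
        have h6 := Real.sq_sqrt (hr j)
        have h7 := pow_le_pow_left₀ (norm_nonneg _) h5 2
        nlinarith [sq_nonneg (√(energyRej σ enc H j) - E)]
      refine (Finset.sum_le_card_nsmul _ _ _ h4).trans ?_
      rw [nsmul_eq_mul, hcard]; push_cast; rfl
    have h8 : (4 : ℝ) ^ n * (1 / 4) ≤ ∑ g, ‖σ.logical enc l₀ g σ.vec‖ ^ 2 := by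
      have h9 : ∀ g ∈ (Finset.univ : Finset (Bool × Fin n → Bool)),
          (1 / 4 : ℝ) ≤ ‖σ.logical enc l₀ g σ.vec‖ ^ 2 := fun g _ => by
        have := norm_logical_ge hσ h g
        have h10 : (1 / 2 : ℝ) ≤ ‖σ.logical enc l₀ g σ.vec‖ := by linarith
        have := pow_le_pow_left₀ (by norm_num) h10 2
        linarith
      refine le_trans (le_of_eq ?_) (Finset.card_nsmul_le_sum _ _ _ h9)
      rw [nsmul_eq_mul, hcard]; push_cast; rfl
    have h11 : ∑ j, (2 : ℝ) ^ n * ∑ g, ‖D j g‖ ^ 2 ≤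
        2 ^ n * (4 ^ n * (2 * ∑ j, energyRej σ enc H j + m * (2 * E ^ 2))) := by
      rw [← Finset.mul_sum]
      refine mul_le_mul_of_nonneg_left ?_ (by positivity)
      refine (Finset.sum_le_sum fun j _ => h3 j).trans (le_of_eq ?_)
      rw [← Finset.mul_sum, Finset.sum_add_distrib, ← Finset.mul_sum]
      simp
    have hE2 : E ^ 2 = (4 ^ k * (310 * k)) ^ 2 * n ^ 2 * (4 * ρ) := by
      rw [hE, ← Real.sq_sqrt hρ, Real.sqrt_sq (Real.sqrt_nonneg ρ)]; ring
    have hR : 0 ≤ 8 * ∑ j, energyRej σ enc H j + m * (8 * E ^ 2) := by positivity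
    have hE3 : m * (32 * (4 ^ k * (310 * k)) ^ 2 * n ^ 2 * ρ) = m * (8 * E ^ 2) := by
      rw [hE2]; ring
    rw [hE3]
    rcases le_or_gt (b * m) 0 with h0 | h0
    · exact h0.trans hR
    · have h12 : b * m * (2 ^ n * (4 ^ n * (1 / 4))) ≤
          2 ^ n * (4 ^ n * (2 * ∑ j, energyRej σ enc H j + m * (2 * E ^ 2))) :=
        (mul_le_mul_of_nonneg_left (mul_le_mul_of_nonneg_left h8 (by positivity)) h0.le).trans
          (h1.trans h11)
      have h13 : (0 : ℝ) < 2 ^ n * 4 ^ n := by positivity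
      have h14 : 2 ^ n * 4 ^ n * (b * m / 4) ≤
          2 ^ n * 4 ^ n * (2 * ∑ j, energyRej σ enc H j + m * (2 * E ^ 2)) := by
        linarith
      have := le_of_mul_le_mul_left h14 h13
      linarith
  -- the second term on the right is larger than `m`, and `H ≤ m`
  · push Not at hbig
    have h1 : 0 < √ρ := by
      by_contra h0
      have : √ρ = 0 := le_antisymm (not_lt.1 h0) (Real.sqrt_nonneg _)
      rw [this] at hbig; norm_num at hbig
    have h2 : √ρ ^ 2 = ρ := Real.sq_sqrt (Real.sqrt_pos.1 h1).le
    have h3 : 1 ≤ (480 * n * √ρ) ^ 2 := by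
      refine one_le_pow₀ ?_
      linarith
    have h4 : b * m ≤ m := by
      have h5 := (mul_norm_sq_le_expect hb (Pi.single (fun _ => false) 1)).trans (expect_op_le H _)
      have h6 : ∑ x, ‖(Pi.single (fun _ => false) 1 : (Fin n → Bool) → ℂ) x‖ ^ 2 = 1 := by
        rw [Finset.sum_eq_single fun _ => false]
        · simp
        · intro x _ hx; simp [hx]
        · simp
      rw [h6] at h5
      linarith
    have h5 : (480 : ℝ) ^ 2 ≤ 32 * (4 ^ k * (310 * k)) ^ 2 := by
      have : (620 : ℝ) ≤ 4 ^ k * (310 * k) := by nlinarith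
      nlinarith
    have h6 : (m : ℝ) ≤ m * (32 * (4 ^ k * (310 * k)) ^ 2 * n ^ 2 * ρ) := by
      refine le_mul_of_one_le_right hm (h3.trans ?_)
      rw [mul_pow, mul_pow, h2]
      have : 0 ≤ ρ := (Real.sqrt_pos.1 h1).le
      gcongr
    linarith

end EnergyBound

/-! ### Soundness for questions on one qubit -/

section OneLocal

variable {ι κ κ' : Type} [Fintype ι] [Fintype κ] [Fintype κ'] [DecidableEq ι] [DecidableEq κ]
  [DecidableEq κ']

lemma lift_trans (f : κ ↪ κ') (g : κ' ↪ ι) (A : Op κ) :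
    lift (f.trans g) A = lift g (lift f A) := by
  ext x y
  simp only [lift]
  by_cases h : ∀ i, i ∉ Set.range g → x i = y i
  · rw [if_pos h]
    by_cases h' : ∀ i, i ∉ Set.range f → (x ∘ g) i = (y ∘ g) i
    · rw [if_pos h', if_pos]
      · rfl
      · intro i hi
        by_cases hg : i ∈ Set.range g
        · obtain ⟨a, rfl⟩ := hg
          exact h' a fun ⟨c, hc⟩ => hi ⟨c, by simp [hc]⟩
        · exact h i hg
    · rw [if_neg h', if_neg]
      intro hall
      exact h' fun i hi => hall (g i) fun ⟨c, hc⟩ => hi ⟨c, g.injective hc⟩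
  · rw [if_neg h, if_neg]
    intro hall
    exact h fun i hi => hall i fun ⟨c, hc⟩ => hi ⟨f c, hc⟩

/-- The expectation value of a local operator, as an average over the values of the other
qubits (each of them is counted once for every value of the qubits in the range of `f`). -/
lemma sum_expect_extend (f : κ ↪ ι) (P : Op κ) (v : (ι → Bool) → ℂ) :
    ∑ x, expect P (fun w => v (Function.extend f w x)) =
      Fintype.card (κ → Bool) * expect (lift f P) v := by
  set F : (ι → Bool) → ℂ := fun y => star (v y) * ∑ w, P (y ∘ f) w * v (Function.extend f w y)
    with hF
  have hext : ∀ (w w' : κ → Bool) (x : ι → Bool),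
      Function.extend f w (Function.extend f w' x) = Function.extend f w x := by
    intro w w' x
    ext i
    by_cases h : ∃ a, f a = i
    · obtain ⟨a, rfl⟩ := h
      rw [f.injective.extend_apply, f.injective.extend_apply]
    · rw [Function.extend_apply' _ _ _ h, Function.extend_apply' _ _ _ h,
        Function.extend_apply' _ _ _ h]
  have hcomp : ∀ (w : κ → Bool) (x : ι → Bool), Function.extend f w x ∘ f = w := fun w x => by
    ext a; simp [f.injective.extend_apply]
  have h1 : expect (lift f P) v = (∑ y, F y).re := by
    rw [expect, dotProduct]
    congr 1
    refine Finset.sum_congr rfl fun y _ => ?_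
    rw [hF, Matrix.mulVec, dotProduct]
    have := sum_lift (f := f) P y v
    simp only [smul_eq_mul] at this
    rw [this]; rfl
  have h2 : ∀ x, expect P (fun w => v (Function.extend f w x)) =
      (∑ w, F (Function.extend f w x)).re := by
    intro x
    rw [expect, dotProduct]
    congr 1
    refine Finset.sum_congr rfl fun w _ => ?_
    simp only [hF, hext, hcomp]
    rfl
  simp only [h1, h2, ← Complex.re_sum]
  rw [← Fintype.sum_prod_type' (f := fun (x : ι → Bool) (w : κ → Bool) => F (Function.extend f w x))]
  have h3 : ∑ p : (ι → Bool) × (κ → Bool), F (Function.extend f p.2 p.1) =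
      ∑ p : (ι → Bool) × (κ → Bool), F p.1 := by
    refine Fintype.sum_bijective (fun p => (Function.extend f p.2 p.1, p.1 ∘ f))
      (Function.Involutive.bijective fun p => ?_) _ _ fun p => rfl
    refine Prod.ext ?_ (hcomp _ _)
    simp only [hext]
    exact (eq_extend (f := f) fun i _ => rfl).symm
  rw [h3, Fintype.sum_prod_type]
  simp only [Finset.sum_const, Finset.card_univ, nsmul_eq_mul, ← Finset.mul_sum]
  rw [← Complex.ofReal_natCast, Complex.re_ofReal_mul]

lemma lift_eq_smul_one [IsEmpty κ] (f : κ ↪ ι) (P : Op κ) :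
    lift f P = P isEmptyElim isEmptyElim • (1 : Op ι) := by
  ext x y
  by_cases h : x = y
  · subst h
    rw [lift, if_pos fun _ _ => rfl, Matrix.smul_apply, Matrix.one_apply_eq, smul_eq_mul, mul_one]
    congr 1 <;> exact Subsingleton.elim _ _
  · rw [lift, if_neg, Matrix.smul_apply, Matrix.one_apply_ne h, smul_zero]
    exact fun h' => h (funext fun i => h' i (by simp))

/-- A mixture has an expectation value that is not smaller than that of some pure state of the
qubits on which the operator acts. -/
lemma exists_state_expect_le {E : Type} [Fintype E] (f : κ ↪ ι) (P : Op κ)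
    (u : E → (ι → Bool) → ℂ) (hu : ∑ e, ∑ x, ‖u e x‖ ^ 2 = 1) :
    ∃ χ : (κ → Bool) → ℂ, IsState χ ∧ expect P χ ≤ ∑ e, expect (lift f P) (u e) := by
  by_contra! hcon
  set R := ∑ e, expect (lift f P) (u e) with hR
  set w : E → (ι → Bool) → (κ → Bool) → ℂ := fun e x z => u e (Function.extend f z x)
  have hc : (0 : ℝ) < Fintype.card (κ → Bool) := by exact_mod_cast Fintype.card_pos
  have h1 : ∑ e, ∑ x, expect P (w e x) = Fintype.card (κ → Bool) * R := by
    simp only [w, sum_expect_extend, hR, Finset.mul_sum]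
  have h2 : ∑ e, ∑ x, ∑ z, ‖w e x z‖ ^ 2 = Fintype.card (κ → Bool) := by
    have := fun e => sum_expect_extend f 1 (u e)
    simp only [expect_one, lift_one] at this
    simp only [w, this, ← Finset.mul_sum, hu, mul_one]
  have h3 : ∀ v : (κ → Bool) → ℂ, v ≠ 0 → R * ∑ z, ‖v z‖ ^ 2 < expect P v := by
    intro v hv
    obtain ⟨hpos, ψ, hψ, hP⟩ := exists_isState_expect hv
    rw [hP, mul_comm]
    exact mul_lt_mul_of_pos_left (hcon ψ hψ) hpos
  have h4 : ∀ v : (κ → Bool) → ℂ, R * ∑ z, ‖v z‖ ^ 2 ≤ expect P v :=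
    mul_norm_sq_le_expect fun ψ hψ => (hcon ψ hψ).le
  have h5 : ∃ e x, w e x ≠ 0 := by
    by_contra! h0
    simp only [h0, Pi.zero_apply, norm_zero, ne_eq, OfNat.ofNat_ne_zero, not_false_eq_true,
      zero_pow, Finset.sum_const_zero] at h2
    exact hc.ne h2
  obtain ⟨e, x, hex⟩ := h5
  have h6 : ∑ e, ∑ x, R * ∑ z, ‖w e x z‖ ^ 2 < ∑ e, ∑ x, expect P (w e x) :=
    Finset.sum_lt_sum (fun e _ => Finset.sum_le_sum fun x _ => h4 _)
      ⟨e, Finset.mem_univ e, Finset.sum_lt_sum (fun x _ => h4 _) ⟨x, Finset.mem_univ x, h3 _ hex⟩⟩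
  simp only [← Finset.mul_sum, h2, h1] at h6
  linarith

variable {n m : ℕ}

/-- The one-element embedding with value `i`. -/
def pointEmb (i : Fin n) : Fin 1 ↪ Fin n := ⟨fun _ => i, fun _ _ _ => Subsingleton.elim _ _⟩

/-- The product of states of single qubits. -/
noncomputable def productState (χ : Fin n → (Fin 1 → Bool) → ℂ) (x : Fin n → Bool) : ℂ :=
  ∏ i, χ i fun _ => x i

lemma isState_productState {χ : Fin n → (Fin 1 → Bool) → ℂ} (hχ : ∀ i, IsState (χ i)) :
    IsState (productState χ) := by
  have h1 : ∀ i, ∑ b : Bool, ‖χ i fun _ => b‖ ^ 2 = 1 := fun i => by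
    rw [← hχ i]
    exact Fintype.sum_equiv (Equiv.funUnique (Fin 1) Bool).symm _ _ fun b => rfl
  have h2 := (Finset.prod_univ_sum (fun _ : Fin n => (Finset.univ : Finset Bool))
    fun i b => ‖χ i fun _ => b‖ ^ 2).symm
  simp only [h1, Finset.prod_const_one, Fintype.piFinset_univ] at h2
  simpa [IsState, productState, Finset.prod_pow] using h2

lemma expect_productState {χ : Fin n → (Fin 1 → Bool) → ℂ} (hχ : ∀ i, IsState (χ i)) (i : Fin n)
    (P : Op (Fin 1)) : expect (lift (pointEmb i) P) (productState χ) = expect P (χ i) := by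
  set d : (Fin n → Bool) → ℂ := fun x => ∏ i' ∈ Finset.univ.erase i, χ i' fun _ => x i'
  have h1 : ∀ x, (fun w => productState χ (Function.extend (pointEmb i) w x)) = d x • χ i := by
    intro x
    ext w
    rw [productState, ← Finset.mul_prod_erase _ _ (Finset.mem_univ i), Pi.smul_apply, smul_eq_mul,
      mul_comm]
    congr 1
    · refine Finset.prod_congr rfl fun i' hi' => ?_
      rw [Function.extend_apply']
      rintro ⟨a, ha⟩
      exact Finset.ne_of_mem_erase hi' ha.symm
    · congr 1
      ext a
      have := (pointEmb i).injective.extend_apply w x a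
      exact this
  have h2 : ∀ (Q : Op (Fin 1)) (c : ℂ) (v : (Fin 1 → Bool) → ℂ),
      expect Q (c • v) = ‖c‖ ^ 2 * expect Q v := by
    intro Q c v
    rw [expect, expect, Matrix.mulVec_smul, star_smul, smul_dotProduct, dotProduct_smul, smul_smul,
      Complex.star_def, Complex.conj_mul', smul_eq_mul, ← Complex.ofReal_pow, Complex.re_ofReal_mul]
  have h3 : ∀ Q : Op (Fin 1), (∑ x, ‖d x‖ ^ 2) * expect Q (χ i) =
      Fintype.card (Fin 1 → Bool) * expect (lift (pointEmb i) Q) (productState χ) := fun Q => by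
    rw [← sum_expect_extend]
    simp only [h1, h2, Finset.sum_mul]
  have h4 := h3 1
  rw [lift_one, expect_one, expect_one, hχ i, isState_productState hχ, mul_one, mul_one] at h4
  have h5 := h3 P
  rw [h4] at h5
  refine (mul_left_cancel₀ ?_ h5).symm
  simp

variable {σ : Strategy 1} {enc : (Fin 1 → Option (Fin n)) → List Bool}

/-- With questions on one qubit, the energy tests alone yield a product state of low energy. -/
lemma energy_le_of_one (hσ : σ.IsQuantum) (hn : 1 ≤ n) (H : LocalHamiltonian 1 n m) {b : ℝ}
    (hb : ∀ Ψ, IsState Ψ → b * m ≤ expect H.op Ψ) : b * m ≤ ∑ j, energyRej σ enc H j := by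
  have hi : ∀ j, ∃ i : Fin n,
      (H.supp j).toEmbedding = (Fin.castLEEmb (H.size_le j)).trans (pointEmb i) ∧
      (H.size j = 0 ∨ termTuple H j = fun _ => some i) := by
    intro j
    rcases Nat.eq_zero_or_pos (H.size j) with h0 | h0
    · refine ⟨⟨0, hn⟩, ?_, Or.inl h0⟩
      ext a
      exact absurd a.2 (by omega)
    · refine ⟨H.supp j ⟨0, h0⟩, ?_, Or.inr ?_⟩
      · ext a
        have : a = ⟨0, h0⟩ := by
          have := H.size_le j
          ext; simp; omega
        subst this; rfl
      · ext1 l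
        have : l = 0 := Subsingleton.elim _ _
        subst this
        simp [termTuple, h0]
  choose i hsupp hi using hi
  set U := decodeAll (List.finRange 1)
  set P : Fin m → Op (Fin 1) := fun j => lift (Fin.castLEEmb (H.size_le j)) (H.term j) with hP
  set u : Fin n → (∀ t, σ.A t) → (Wire 1 → Bool) → ℂ := fun i e =>
    U.mulVec (σ.answer (fun _ => enc fun _ => some i) e)
  have hu : ∀ i, ∑ e, ∑ x, ‖u i e x‖ ^ 2 = 1 := fun i =>
    sum_norm_answer hσ _ (decodeAll_mem_unitary _)
  have hrej : ∀ j, energyRej σ enc H j =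
      ∑ e, expect (lift (logicalWires 1) (P j)) (u (i j) e) := by
    intro j
    have h1 : energyRej σ enc H j = ∑ e, expect (lift (logicalWires 1) (P j))
        (U.mulVec (σ.answer (fun _ => enc (termTuple H j)) e)) := by
      rw [energyRej, expect_pull]
      refine Finset.sum_congr rfl fun e _ => ?_
      rw [expect_conj, hP, lift_trans]
    rcases hi j with h0 | h0
    · have : IsEmpty (Fin (H.size j)) := by rw [h0]; infer_instance
      have h2 : ∀ v, expect (lift (logicalWires 1) (P j)) v =
          (H.term j isEmptyElim isEmptyElim).re * ∑ x, ‖v x‖ ^ 2 := by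
        intro v
        rw [hP, ← lift_trans, lift_eq_smul_one, expect, Matrix.smul_mulVec, Matrix.one_mulVec,
          dotProduct_smul]
        have : star v ⬝ᵥ v = ((∑ x, ‖v x‖ ^ 2 : ℝ) : ℂ) := by
          rw [dotProduct, Complex.ofReal_sum]
          refine Finset.sum_congr rfl fun x _ => ?_
          rw [Pi.star_apply, Complex.star_def, Complex.conj_mul', Complex.ofReal_pow]
        rw [this, smul_eq_mul, Complex.re_mul_ofReal]
      rw [h1]
      simp only [h2, ← Finset.mul_sum]
      rw [hu, sum_norm_answer hσ _ (decodeAll_mem_unitary _)]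
    · rw [h1, h0]
  choose χ hχ hle using fun i' => exists_state_expect_le (logicalWires 1)
    (∑ j with i j = i', P j) (u i') (hu i')
  calc b * m ≤ expect H.op (productState χ) := hb _ (isState_productState hχ)
    _ = ∑ j, expect (P j) (χ (i j)) := by
        rw [expect_op]
        refine Finset.sum_congr rfl fun j _ => ?_
        rw [hsupp, lift_trans, expect_productState hχ]
    _ = ∑ i', ∑ j with i j = i', expect (P j) (χ i') := by
        rw [← Finset.sum_fiberwise Finset.univ i]
        refine Finset.sum_congr rfl fun i' _ => Finset.sum_congr rfl fun j hj => ?_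
        rw [(Finset.mem_filter.1 hj).2]
    _ = ∑ i', expect (∑ j with i j = i', P j) (χ i') := by simp only [expect_sum]
    _ ≤ ∑ i', ∑ e, expect (lift (logicalWires 1) (∑ j with i j = i', P j)) (u i' e) :=
        Finset.sum_le_sum fun i' _ => hle i'
    _ = ∑ i', ∑ j with i j = i', energyRej σ enc H j := by
        refine Finset.sum_congr rfl fun i' _ => ?_
        simp only [lift_sum, expect_sum]
        rw [Finset.sum_comm]
        refine Finset.sum_congr rfl fun j hj => ?_
        rw [hrej, (Finset.mem_filter.1 hj).2]
    _ = _ := Finset.sum_fiberwise Finset.univ i _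

end OneLocal

/-! ### Expectation values over the runs of a program -/

section Semantics

/-- The expectation value of `f`. -/
noncomputable def mean {X : Type*} (μ : PMF X) (f : X → ENNReal) : ENNReal := ∑' x, μ x * f x

section Mean

variable {X Y : Type*}

lemma mean_pure (a : X) (f : X → ENNReal) : mean (PMF.pure a) f = f a := by
  rw [mean, tsum_eq_single a]
  · simp
  · intro x hx; simp [hx]

lemma mean_bind (μ : PMF X) (κ : X → PMF Y) (f : Y → ENNReal) :
    mean (μ.bind κ) f = mean μ fun a => mean (κ a) f := by
  simp only [mean, PMF.bind_apply, ← ENNReal.tsum_mul_right, ← ENNReal.tsum_mul_left]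
  rw [ENNReal.tsum_comm]
  simp only [mul_assoc]

lemma mean_map (μ : PMF X) (g : X → Y) (f : Y → ENNReal) :
    mean (μ.map g) f = mean μ fun a => f (g a) := by
  rw [PMF.map, mean_bind]
  simp only [Function.comp_apply, mean_pure]

lemma mean_uniform (N : ℕ) (f : Fin (N + 1) → ENNReal) :
    mean (PMF.uniformOfFintype (Fin (N + 1))) f = ((N + 1 : ℕ) : ENNReal)⁻¹ * ∑ i, f i := by
  simp [mean, PMF.uniformOfFintype_apply, Finset.mul_sum]

lemma mean_congr {μ : PMF X} {f g : X → ENNReal} (h : ∀ x ∈ μ.support, f x = g x) :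
    mean μ f = mean μ g := by
  refine tsum_congr fun x => ?_
  by_cases hx : μ x = 0
  · simp [hx]
  · rw [h x ((PMF.mem_support_iff _ _).2 hx)]

lemma mean_const (μ : PMF X) (c : ENNReal) : mean μ (fun _ => c) = c := by
  rw [mean, ENNReal.tsum_mul_right, PMF.tsum_coe, one_mul]

lemma mean_add (μ : PMF X) (f g : X → ENNReal) :
    mean μ (fun x => f x + g x) = mean μ f + mean μ g := by
  simp only [mean, mul_add, ENNReal.tsum_add]

end Mean

variable {k n m : ℕ} {H : LocalHamiltonian k n m}

lemma mean_seq (p q : Prog k) (s : Config k) (f : Config k → ENNReal) :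
    mean ((p.seq q).run H s) f = mean (p.run H s) fun s' => mean (q.run H s') f := mean_bind _ _ _

lemma mem_support_seq {p q : Prog k} {s s' : Config k} :
    s' ∈ ((p.seq q).run H s).support ↔
      ∃ s₁ ∈ (p.run H s).support, s' ∈ (q.run H s₁).support := by
  rw [Prog.run, PMF.mem_support_bind_iff]

lemma run_rand (x y : ℕ) (s : Config k) : (Prog.rand x y : Prog k).run H s =
    (PMF.uniformOfFintype (Fin (s.mem y + 1))).map
      fun v : Fin (s.mem y + 1) => s.write x v := by
  rw [Prog.run]
  change PMF.map _ (PMF.bind _ _) = _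
  rw [PMF.map_bind]
  refine congrArg _ (funext fun v => ?_)
  exact PMF.pure_map _ _

lemma mem_write_self (s : Config k) (x v : ℕ) : (s.write x v).mem x = v := Function.update_self ..

lemma mem_write_of_ne (s : Config k) {x r : ℕ} (v : ℕ) (h : r ≠ x) :
    (s.write x v).mem r = s.mem r := Function.update_of_ne h ..

lemma mem_tick (s : Config k) (c r : ℕ) : (s.tick c).mem r = s.mem r := rfl

lemma mem_support_rand {x y : ℕ} {s s' : Config k} :
    s' ∈ ((Prog.rand x y : Prog k).run H s).support ↔ ∃ v ≤ s.mem y, s' = s.write x v := by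
  rw [run_rand, PMF.mem_support_map_iff]
  simp only [PMF.support_uniformOfFintype]
  constructor
  · rintro ⟨v, -, rfl⟩; exact ⟨v, Nat.lt_succ_iff.1 v.2, rfl⟩
  · rintro ⟨v, hv, rfl⟩; exact ⟨⟨v, Nat.lt_succ_iff.2 hv⟩, trivial, rfl⟩

lemma mean_rand (x y : ℕ) (s : Config k) (f : Config k → ENNReal) :
    mean ((Prog.rand x y : Prog k).run H s) f =
      ((s.mem y + 1 : ℕ) : ENNReal)⁻¹ * ∑ v : Fin (s.mem y + 1), f (s.write x v) := by
  rw [run_rand, mean_map, mean_uniform]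

variable (H) in
/-- On the configuration `s`, the program `p` deterministically ends in the configuration `s'`. -/
def Runs (p : Prog k) (s s' : Config k) : Prop := p.run H s = PMF.pure s'

lemma Runs.seq {p q : Prog k} {s s₁ s₂ : Config k} (hp : Runs H p s s₁) (hq : Runs H q s₁ s₂) :
    Runs H (p.seq q) s s₂ := by
  rw [Runs, Prog.run, hp, PMF.pure_bind]; exact hq

/-- The sequential composition of a list of programs. -/
def seqs : List (Prog k) → Prog k
  | [] => .skip
  | p :: L => p.seq (seqs L)

/-- The configuration `s'` agrees with `s` up to the registers and the time. -/
structure Config.Same (s s' : Config k) : Prop where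
  msg : s'.msg = s.msg
  circuit : s'.circuit = s.circuit
  verdict : s'.verdict = s.verdict

lemma Config.Same.trans {s s' s'' : Config k} (h : s.Same s') (h' : s'.Same s'') : s.Same s'' :=
  ⟨h'.1.trans h.1, h'.2.trans h.2, h'.3.trans h.3⟩

/-- Programs without loops. -/
def Prog.LoopFree : Prog k → Prop
  | .seq p q => p.LoopFree ∧ q.LoopFree
  | .ite _ _ p q => p.LoopFree ∧ q.LoopFree
  | .loop _ _ => False
  | _ => True

/-- The number of instructions in a program. -/
def Prog.ops : Prog k → ℕ
  | .seq p q => p.ops + q.ops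
  | .ite _ _ p q => 1 + p.ops + q.ops
  | _ => 1

/-- A program without loops spends its time on its instructions and on the bits that it sends. -/
lemma time_le {p : Prog k} (hp : p.LoopFree) {s s' : Config k} (hs : s' ∈ (p.run H s).support) :
    s'.time + ∑ t, (s.msg t).length ≤ s.time + ∑ t, (s'.msg t).length + p.ops := by
  induction p generalizing s s' with
  | seq p q ihp ihq =>
    obtain ⟨s₁, h₁, h₂⟩ := mem_support_seq.1 hs
    have := ihp hp.1 h₁
    have := ihq hp.2 h₂
    simp only [Prog.ops]
    omega
  | ite x y p q ihp ihq =>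
    rw [Prog.run] at hs
    simp only [Prog.ops]
    split_ifs at hs
    · have := ihp hp.1 hs
      simp only [Config.tick] at this
      omega
    · have := ihq hp.2 hs
      simp only [Config.tick] at this
      omega
  | loop x p => exact hp.elim
  | rand x y =>
    obtain ⟨v, -, rfl⟩ := mem_support_rand.1 hs
    simp only [Config.write, Prog.ops]
    omega
  | send t x =>
    rw [Prog.run, PMF.support_pure, Set.mem_singleton_iff] at hs
    subst hs
    simp only [Config.tick, Prog.ops]
    have h1 : ∑ t', (Function.update s.msg t (s.msg t ++ encodeNat (s.mem x)) t').length =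
        ∑ t', ((s.msg t').length + if t' = t then (encodeNat (s.mem x)).length else 0) := by
      refine Finset.sum_congr rfl fun t' _ => ?_
      by_cases h : t' = t
      · subst h; simp
      · simp [h]
    rw [h1, Finset.sum_add_distrib, Finset.sum_ite_eq' Finset.univ t, if_pos (Finset.mem_univ t)]
    omega
  | _ =>
    rw [Prog.run, PMF.support_pure, Set.mem_singleton_iff] at hs
    subst hs
    simp only [Config.write, Config.tick, Prog.ops]
    omega

lemma loopFree_seqs {L : List (Prog k)} (h : ∀ p ∈ L, p.LoopFree) : (seqs L).LoopFree := by
  induction L with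
  | nil => trivial
  | cons p L ih =>
    exact ⟨h p (by simp), ih fun q hq => h q (by simp [hq])⟩

/-- Sending the contents of the registers in a list. -/
def sends (t : Fin 5) (R : List ℕ) : Prog k := seqs (R.map fun x => .send t x)

lemma runs_sends (t : Fin 5) (R : List ℕ) (s : Config k) :
    ∃ s', Runs H (sends t R) s s' ∧ s'.mem = s.mem ∧ s'.circuit = s.circuit ∧
      s'.verdict = s.verdict ∧
      s'.msg = Function.update s.msg t (s.msg t ++ R.flatMap fun x => encodeNat (s.mem x)) := by
  induction R generalizing s with
  | nil => exact ⟨_, rfl, rfl, rfl, rfl, by simp [Config.tick]⟩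
  | cons x R ih =>
    obtain ⟨s', h1, h2, h3, h4, h5⟩ := ih { s.tick (1 + (encodeNat (s.mem x)).length) with
        msg := Function.update s.msg t (s.msg t ++ encodeNat (s.mem x)) }
    refine ⟨s', Runs.seq rfl h1, h2, h3, h4, ?_⟩
    rw [h5]
    simp [Config.tick]

/-- Sending the contents of some registers to each of the provers in a list. -/
def sendTo (R : Fin 5 → List ℕ) (T : List (Fin 5)) : Prog k := seqs (T.map fun t => sends t (R t))

lemma runs_sendTo (R : Fin 5 → List ℕ) {T : List (Fin 5)} (hT : T.Nodup) (s : Config k) :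
    ∃ s', Runs H (sendTo R T) s s' ∧ s'.mem = s.mem ∧ s'.circuit = s.circuit ∧
      s'.verdict = s.verdict ∧
      ∀ t, s'.msg t = s.msg t ++
        if t ∈ T then (R t).flatMap fun x => encodeNat (s.mem x) else [] := by
  induction T generalizing s with
  | nil => exact ⟨_, rfl, rfl, rfl, rfl, by simp [Config.tick]⟩
  | cons t T ih =>
    rw [List.nodup_cons] at hT
    obtain ⟨s₁, h1, h2, h3, h4, h5⟩ := runs_sends (H := H) t (R t) s
    obtain ⟨s', g1, g2, g3, g4, g5⟩ := ih hT.2 s₁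
    refine ⟨s', h1.seq g1, g2.trans h2, g3.trans h3, g4.trans h4, fun t' => ?_⟩
    rw [g5, h5, h2]
    by_cases ht : t' = t
    · subst ht; simp [hT.1]
    · simp [ht]

/-- The decoding of the blocks in a list. -/
noncomputable def decodeProg (L : List (Fin k)) : Prog k := seqs (L.map fun l : Fin k =>
  .gate 5 decoder decoder_mem_unitary decoder_algebraic (blockWires fun _ => l))

lemma runs_decodeProg (L : List (Fin k)) (s : Config k) :
    ∃ s', Runs H (decodeProg L) s s' ∧ s'.mem = s.mem ∧ s'.msg = s.msg ∧
      s'.verdict = s.verdict ∧ s'.circuit = decodeAll L.reverse * s.circuit := by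
  induction L generalizing s with
  | nil => exact ⟨_, rfl, rfl, rfl, rfl, by simp [Config.tick, decodeAll]⟩
  | cons l L ih =>
    obtain ⟨s', h1, h2, h3, h4, h5⟩ := ih { s.tick 1 with
      circuit := lift (blockWires fun _ => l) decoder * s.circuit }
    refine ⟨s', Runs.seq rfl h1, h2, h3, h4, ?_⟩
    rw [h5]
    simp [decodeAll, Matrix.mul_assoc]

end Semantics

/-! ### The verifier -/

section Verifier

variable {k n m : ℕ} {H : LocalHamiltonian k n m}

/-- The number that is sent to ask for the qubit `i`; zero stands for no qubit. -/
def slotCode : Option (Fin n) → ℕ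
  | none => 0
  | some i => i + 1

lemma slotCode_le (o : Option (Fin n)) : slotCode o ≤ n := by
  cases o with
  | none => exact Nat.zero_le _
  | some i => exact i.2

lemma slotCode_injective : Function.Injective (slotCode (n := n)) := by
  intro o o' h
  cases o <;> cases o' <;> simp_all [slotCode, Fin.ext_iff]

lemma exists_slotCode {a : ℕ} (h : a ≤ n) : ∃ o : Option (Fin n), slotCode o = a := by
  cases a with
  | zero => exact ⟨none, rfl⟩
  | succ a => exact ⟨some ⟨a, h⟩, rfl⟩

/-- The question that asks for the tuple `v` of qubits. -/
def enc (v : Fin k → Option (Fin n)) : List Bool :=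
  (List.finRange k).flatMap fun l => encodeNat (slotCode (v l))

/-- The registers that hold the tuple of questions. Registers `0` and `1` contain `n` and `m`,
register `2` the number one, `3` the number `m - 1`, `4` a term, `5` its size or a coin and `6` the
number of a slot; register `8` is never written and contains zero. -/
def tupleRegs (k : ℕ) : List ℕ := (List.finRange k).map fun l : Fin k => 10 + (l : ℕ)

lemma flatMap_tupleRegs {μ : ℕ → ℕ} {v : Fin k → Option (Fin n)}
    (h : ∀ l : Fin k, μ (10 + l) = slotCode (v l)) :
    ((tupleRegs k).flatMap fun x => encodeNat (μ x)) = enc v := by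
  simp [tupleRegs, enc, List.flatMap_map, h]

/-- Load the qubits of term number `[4]`, the size of which is in register `5`. -/
def loadTerm (L : List (Fin k)) : Prog k := seqs (L.map fun l : Fin k =>
  .seq (.const 6 (l + 1)) (.ite 6 5
    (.seq (.termQubit (10 + l) 4 l) (.add (10 + l) (10 + l) 2)) (.const (10 + l) 0)))

lemma runs_loadTerm (j : Fin m) {L : List (Fin k)} (hL : L.Nodup) (s : Config k)
    (h2 : s.mem 2 = 1) (h4 : s.mem 4 = j) (h5 : s.mem 5 = H.size j) :
    ∃ s', Runs H (loadTerm L) s s' ∧ s.Same s' ∧ s'.mem 4 = j ∧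
      (∀ l ∉ L, s'.mem (10 + l) = s.mem (10 + l)) ∧
      ∀ l ∈ L, s'.mem (10 + l) = slotCode (termTuple H j l) := by
  induction L generalizing s with
  | nil => exact ⟨_, rfl, ⟨rfl, rfl, rfl⟩, h4, fun _ _ => rfl, by simp⟩
  | cons l L ih =>
    rw [List.nodup_cons] at hL
    have hstep : ∃ s₁, Runs H (.seq (.const 6 (l + 1)) (.ite 6 5
        (.seq (.termQubit (10 + l) 4 l) (.add (10 + l) (10 + l) 2)) (.const (10 + l) 0))) s s₁ ∧
        s.Same s₁ ∧ s₁.mem 2 = 1 ∧ s₁.mem 4 = j ∧ s₁.mem 5 = H.size j ∧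
        (∀ l' : Fin k, l' ≠ l → s₁.mem (10 + l') = s.mem (10 + l')) ∧
        s₁.mem (10 + l) = slotCode (termTuple H j l) := by
      have hne : ∀ r : ℕ, r < 10 → r ≠ 10 + l := fun r hr => by omega
      have hne' : ∀ l' : Fin k, l' ≠ l → (10 + l' : ℕ) ≠ 10 + l := fun l' hl' h =>
        hl' (Fin.ext (by omega))
      have h6 : ∀ l' : Fin k, (10 + l' : ℕ) ≠ 6 := fun l' => by omega
      by_cases hl : (l : ℕ) + 1 ≤ H.size j
      · refine ⟨(((((s.write 6 (l + 1)).tick 1).write (10 + l) (H.readQubit j l))).write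
          (10 + l) (H.readQubit j l + 1)), ?_, ⟨rfl, rfl, rfl⟩, ?_, ?_, ?_, ?_, ?_⟩
        · refine Runs.seq rfl ?_
          rw [Runs, Prog.run, if_pos (by
            rw [mem_write_self, mem_write_of_ne _ _ (by norm_num), h5]; exact hl)]
          refine Runs.seq (s₁ := ((s.write 6 (l + 1)).tick 1).write (10 + l) (H.readQubit j l))
            ?_ ?_
          · rw [Runs, Prog.run, mem_tick, mem_write_of_ne _ _ (by norm_num), h4]
          · rw [Runs, Prog.run, mem_write_self, mem_write_of_ne _ _ (hne 2 (by norm_num)), mem_tick,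
              mem_write_of_ne _ _ (by norm_num), h2]
        all_goals try intro l' hl'
        · simp only [mem_write_of_ne _ _ (hne 2 (by norm_num)), mem_tick]
          rw [mem_write_of_ne _ _ (by norm_num), h2]
        · simp only [mem_write_of_ne _ _ (hne 4 (by norm_num)), mem_tick]
          rw [mem_write_of_ne _ _ (by norm_num), h4]
        · simp only [mem_write_of_ne _ _ (hne 5 (by norm_num)), mem_tick]
          rw [mem_write_of_ne _ _ (by norm_num), h5]
        · simp only [mem_write_of_ne _ _ (hne' l' hl'), mem_tick, mem_write_of_ne _ _ (h6 l')]
        · have hlt : (l : ℕ) < H.size j := hl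
          rw [mem_write_self]
          simp [LocalHamiltonian.readQubit, termTuple, hlt, slotCode]
      · refine ⟨((s.write 6 (l + 1)).tick 1).write (10 + l) 0, ?_, ⟨rfl, rfl, rfl⟩, ?_, ?_, ?_,
          ?_, ?_⟩
        · refine Runs.seq rfl ?_
          rw [Runs, Prog.run, if_neg (by
            rw [mem_write_self, mem_write_of_ne _ _ (by norm_num), h5]; exact hl)]
          rfl
        all_goals try intro l' hl'
        · simp only [mem_write_of_ne _ _ (hne 2 (by norm_num)), mem_tick]
          rw [mem_write_of_ne _ _ (by norm_num), h2]
        · simp only [mem_write_of_ne _ _ (hne 4 (by norm_num)), mem_tick]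
          rw [mem_write_of_ne _ _ (by norm_num), h4]
        · simp only [mem_write_of_ne _ _ (hne 5 (by norm_num)), mem_tick]
          rw [mem_write_of_ne _ _ (by norm_num), h5]
        · simp only [mem_write_of_ne _ _ (hne' l' hl'), mem_tick, mem_write_of_ne _ _ (h6 l')]
        · have hlt : ¬ (l : ℕ) < H.size j := hl
          rw [mem_write_self]
          simp [termTuple, hlt, slotCode]
    obtain ⟨s₁, g1, g2, g3, g4, g5, g6, g7⟩ := hstep
    obtain ⟨s', f1, f2, f3, f4, f5⟩ := ih hL.2 s₁ g3 g4 g5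
    refine ⟨s', g1.seq f1, g2.trans f2, f3, ?_, ?_⟩
    · intro l' hl'
      simp only [List.mem_cons, not_or] at hl'
      rw [f4 l' hl'.2, g6 l' hl'.1]
    · intro l' hl'
      by_cases h : l' = l
      · subst h; rw [f4 _ hL.1, g7]
      · exact f5 l' (by simpa [h] using hl')

/-- Configurations in which no test has been prepared; register `8` contains zero. -/
structure Config.IsInitial (n m : ℕ) (s : Config k) : Prop where
  msg : s.msg = fun _ => []
  circuit : s.circuit = 1
  verdict : s.verdict = .accept
  mem_zero : s.mem 0 = n
  mem_one : s.mem 1 = m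
  mem_two : s.mem 2 = 1
  mem_eight : s.mem 8 = 0

/-- The part of the energy test that follows the choice of the term. -/
noncomputable def energyRest (k : ℕ) : Prog k :=
  .seq (.termSize 5 4) (.seq (loadTerm (List.finRange k))
    (.seq (sendTo (fun _ => tupleRegs k) (List.finRange 5))
      (.seq (decodeProg (List.finRange k).reverse) (.measureEnergy 4 (logicalWires k)))))

lemma runs_energyRest (j : Fin m) {s : Config k} (hmsg : s.msg = fun _ => [])
    (hc : s.circuit = 1) (h2 : s.mem 2 = 1) (h4 : s.mem 4 = j) :
    ∃ s', Runs H (energyRest k) s s' ∧ IsEnergy enc H j s' := by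
  obtain ⟨s₁, f1, f2, f3, -, f5⟩ := runs_loadTerm (H := H) j (List.nodup_finRange k)
    (s.write 5 (H.size j)) (by simp [Config.write, h2]) (by simp [Config.write, h4])
    (by simp [Config.write])
  obtain ⟨s₂, g1, g2, g3, g4, g5⟩ := runs_sendTo (H := H) (fun _ => tupleRegs k)
    (List.nodup_finRange 5) s₁
  obtain ⟨s₃, e1, e2, e3, e4, e5⟩ := runs_decodeProg (H := H) (List.finRange k).reverse s₂
  refine ⟨{ s₃.tick 1 with verdict := .energy (s₃.mem 4) (logicalWires k) }, ?_, ?_, ?_, ?_⟩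
  · refine Runs.seq ?_ (f1.seq (g1.seq (e1.seq rfl)))
    rw [Runs, Prog.run, h4]
    simp [LocalHamiltonian.readSize]
  · ext1 t
    change s₃.msg t = _
    rw [e3, g5, f2.msg, if_pos (List.mem_finRange t),
      flatMap_tupleRegs fun l => f5 l (List.mem_finRange l)]
    change s.msg t ++ _ = _
    rw [hmsg, List.nil_append]
  · change s₃.circuit = _
    rw [e5, List.reverse_reverse, g3, f2.circuit]
    change _ * s.circuit = _
    rw [hc, mul_one]
  · change Verdict.energy (s₃.mem 4) _ = _
    rw [e2, g2, f3]

/-- The energy test of a random term. -/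
noncomputable def energyProg (k : ℕ) : Prog k :=
  .seq (.sub 3 1 2) (.seq (.rand 4 3) (energyRest k))

/-- Check that the register `10 + l₁` is different from the registers `10 + l` for all other `l` in
a list, and run `p` in this case. -/
def guardProg (l₁ : Fin k) (p : Prog k) : List (Fin k) → Prog k
  | [] => p
  | l :: L => if l = l₁ then guardProg l₁ p L else
    .ite (10 + l) (10 + l₁) (.ite (10 + l₁) (10 + l) .skip (guardProg l₁ p L)) (guardProg l₁ p L)

lemma runs_guardProg (l₁ : Fin k) (p : Prog k) (L : List (Fin k)) (s : Config k) :
    (∃ c, (guardProg l₁ p L).run H s = p.run H (s.tick c) ∧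
      ∀ l ∈ L, l ≠ l₁ → s.mem (10 + l) ≠ s.mem (10 + l₁)) ∨
    (∃ c, Runs H (guardProg l₁ p L) s (s.tick c) ∧
      ∃ l ∈ L, l ≠ l₁ ∧ s.mem (10 + l) = s.mem (10 + l₁)) := by
  induction L generalizing s with
  | nil => exact Or.inl ⟨0, rfl, by simp⟩
  | cons l L ih =>
    rw [guardProg]
    by_cases hl : l = l₁
    · rw [if_pos hl]
      rcases ih s with ⟨c, h1, h2⟩ | ⟨c, h1, l', hl', h2⟩
      · refine Or.inl ⟨c, h1, fun l' hl' hne => h2 l' ?_ hne⟩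
        rw [List.mem_cons, hl] at hl'
        exact hl'.resolve_left hne
      · exact Or.inr ⟨c, h1, l', List.mem_cons_of_mem _ hl', h2⟩
    · rw [if_neg hl]
      have htick : ∀ a b, (s.tick a).tick b = s.tick (a + b) := fun a b => by
        simp [Config.tick, add_assoc]
      by_cases heq : s.mem (10 + l) = s.mem (10 + l₁)
      · refine Or.inr ⟨1 + 1 + 1, ?_, l, by simp, hl, heq⟩
        rw [Runs, Prog.run, if_pos heq.le, Prog.run, if_pos (by simpa [mem_tick] using heq.ge),
          Prog.run, htick, htick]
      · have hrun : ∃ c, (Prog.ite (10 + l) (10 + l₁) (.ite (10 + l₁) (10 + l) .skip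
            (guardProg l₁ p L)) (guardProg l₁ p L)).run H s =
            (guardProg l₁ p L).run H (s.tick c) := by
          rcases lt_or_gt_of_ne heq with h | h
          · refine ⟨1 + 1, ?_⟩
            rw [Prog.run, if_pos h.le, Prog.run, if_neg (by simpa [Config.tick] using h), htick]
          · refine ⟨1, ?_⟩
            rw [Prog.run, if_neg (by simpa using h)]
        obtain ⟨c, hc⟩ := hrun
        rcases ih (s.tick c) with ⟨c', h1, h2⟩ | ⟨c', h1, l', hl', h2⟩
        · refine Or.inl ⟨c + c', by rw [hc, h1, htick], ?_⟩
          intro l' hl' hne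
          rw [List.mem_cons] at hl'
          rcases hl' with rfl | hl'
          · exact heq
          · exact h2 l' hl' hne
        · refine Or.inr ⟨c + c', ?_, l', List.mem_cons_of_mem _ hl', h2⟩
          rw [Runs, hc, h1, htick]

variable (l₀ : Fin k)

/-- The registers sent in the code test for slot `l₁` of the tuple sent to prover `t`. -/
def testRegs (t : Fin 5) (l₁ : Fin k) (t' : Fin 5) : List ℕ :=
  if t' = t then tupleRegs k else
    (List.finRange k).map fun l => if l = l₀ then 10 + l₁ else 8

/-- The preparation of the code test. -/
noncomputable def codeRest (t : Fin 5) (l₁ : Fin k) : Prog k :=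
  .seq (sendTo (testRegs l₀ t l₁) (List.finRange 5))
    (.seq (.gate 5 decoder decoder_mem_unitary decoder_algebraic (blockWires (testSlots l₀ t l₁)))
      (.measureZeros (syndromeWires (testSlots l₀ t l₁))))

lemma runs_codeRest (t : Fin 5) (l₁ : Fin k) {s : Config k} (hs : s.IsInitial n m)
    {v : Fin k → Option (Fin n)} {i : Fin n} (hi : v l₁ = some i)
    (hv : ∀ l : Fin k, s.mem (10 + l) = slotCode (v l)) :
    ∃ s', Runs H (codeRest l₀ t l₁) s s' ∧ IsCodeTest enc l₀ v t l₁ i s' := by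
  obtain ⟨s₂, g1, g2, g3, g4, g5⟩ := runs_sendTo (H := H) (testRegs l₀ t l₁)
    (List.nodup_finRange 5) s
  refine ⟨_, g1.seq (Runs.seq rfl rfl), ?_, ?_, rfl⟩
  · ext1 t'
    change s₂.msg t' = _
    rw [g5, if_pos (List.mem_finRange t'), hs.msg, List.nil_append, testRegs, testMsg]
    by_cases h : t' = t
    · subst h
      rw [if_pos rfl, Function.update_self, flatMap_tupleRegs hv]
    · rw [if_neg h, Function.update_of_ne h, enc, List.flatMap_map]
      congr 1
      ext1 l
      by_cases hl : l = l₀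
      · subst hl; simp [single, hv, hi]
      · simp [single, hl, hs.mem_eight, slotCode]
  · change _ * s₂.circuit = _
    rw [g3, hs.circuit, mul_one]

/-- The part of the code test that follows the choice of the tuple. -/
noncomputable def codeGuarded (t : Fin 5) (l₁ : Fin k) : Prog k :=
  .ite 2 (10 + l₁) (guardProg l₁ (codeRest l₀ t l₁) (List.finRange k)) .skip

lemma isInitial_tick {s : Config k} (hs : s.IsInitial n m) (c : ℕ) : (s.tick c).IsInitial n m :=
  ⟨hs.1, hs.2, hs.3, hs.4, hs.5, hs.6, hs.7⟩

lemma runs_codeGuarded (t : Fin 5) (l₁ : Fin k) {s : Config k} (hs : s.IsInitial n m)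
    {v : Fin k → Option (Fin n)} (hv : ∀ l : Fin k, s.mem (10 + l) = slotCode (v l)) :
    ∃ s', Runs H (codeGuarded l₀ t l₁) s s' ∧
      ((∃ i, Asks v l₁ i ∧ IsCodeTest enc l₀ v t l₁ i s') ∨
        ((¬ ∃ i, Asks v l₁ i) ∧ s.Same s')) := by
  rw [codeGuarded]
  cases hi : v l₁ with
  | none =>
    refine ⟨(s.tick 1).tick 1, ?_, Or.inr ⟨?_, ⟨rfl, rfl, rfl⟩⟩⟩
    · rw [Runs, Prog.run, if_neg (by simp [hs.mem_two, hv, hi, slotCode])]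
      rfl
    · rintro ⟨i, h, -⟩; simp [hi] at h
  | some i =>
    have hrun : ∀ p q : Prog k, (Prog.ite 2 (10 + l₁) p q).run H s = p.run H (s.tick 1) := by
      intro p q
      rw [Prog.run, if_pos (by simp [hs.mem_two, hv, hi, slotCode])]
    rcases runs_guardProg (H := H) l₁ (codeRest l₀ t l₁) (List.finRange k) (s.tick 1) with
      ⟨c, h1, h2⟩ | ⟨c, h1, l, -, hl, h2⟩
    · obtain ⟨s', h3, h4⟩ := runs_codeRest (H := H) l₀ t l₁
        (isInitial_tick (isInitial_tick hs 1) c) hi hv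
      refine ⟨s', ?_, Or.inl ⟨i, ⟨hi, fun l hl h => ?_⟩, h4⟩⟩
      · rw [Runs, hrun, h1]; exact h3
      · refine h2 l (List.mem_finRange l) hl ?_
        change s.mem _ = s.mem _
        rw [hv, hv, h, hi]
    · refine ⟨(s.tick 1).tick c, ?_, Or.inr ⟨?_, ⟨rfl, rfl, rfl⟩⟩⟩
      · rw [Runs, hrun]; exact h1
      · rintro ⟨i', h, h'⟩
        change s.mem _ = s.mem _ at h2
        rw [hv, hv] at h2
        exact h' l hl ((slotCode_injective h2).trans h)

/-- Choose a random tuple. -/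
def randTuple (L : List (Fin k)) : Prog k := seqs (L.map fun l : Fin k => .rand (10 + l) 0)

lemma isInitial_write {s : Config k} (hs : s.IsInitial n m) (l : Fin k) (a : ℕ) :
    (s.write (10 + l) a).IsInitial n m := by
  refine ⟨hs.1, hs.2, hs.3, ?_, ?_, ?_, ?_⟩
  · rw [← hs.4]; exact Function.update_of_ne (by omega) _ _
  · rw [← hs.5]; exact Function.update_of_ne (by omega) _ _
  · rw [← hs.6]; exact Function.update_of_ne (by omega) _ _
  · rw [← hs.7]; exact Function.update_of_ne (by omega) _ _

lemma support_randTuple {L : List (Fin k)} {s s' : Config k} (hs : s.IsInitial n m)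
    (h : s' ∈ ((randTuple L).run H s).support) (h0 : ∀ l ∉ L, s.mem (10 + l) ≤ n) :
    s'.IsInitial n m ∧ ∀ l : Fin k, s'.mem (10 + l) ≤ n := by
  induction L generalizing s with
  | nil =>
    have : s' = s.tick 1 := by simpa [randTuple, seqs, Prog.run] using h
    subst this
    exact ⟨isInitial_tick hs 1, fun l => h0 l (by simp)⟩
  | cons l L ih =>
    obtain ⟨s₁, h₁, h₂⟩ := mem_support_seq.1 h
    obtain ⟨a, ha, rfl⟩ := mem_support_rand.1 h₁
    refine ih (isInitial_write hs l a) h₂ fun l' hl' => ?_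
    by_cases hll : l' = l
    · subst hll
      simpa [Config.write, hs.mem_zero] using ha
    · have : (10 + l' : ℕ) ≠ 10 + l := fun h => hll (Fin.ext (by omega))
      rw [mem_write_of_ne _ _ this]
      exact h0 l' (by simp [hll, hl'])

/-- Every tuple is chosen with the same probability. As the empty choice is allowed in each slot,
there are `n + 1` choices for it. -/
lemma mean_randTuple_ge {L : List (Fin k)} {s : Config k} (hs : s.IsInitial n m)
    {a : Fin k → ℕ} (ha : ∀ l, a l ≤ n) (h0 : ∀ l ∉ L, s.mem (10 + l) = a l) {c : ENNReal}
    {f : Config k → ENNReal}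
    (hf : ∀ s' : Config k, s'.IsInitial n m → (∀ l : Fin k, s'.mem (10 + l) = a l) → c ≤ f s') :
    ((n + 1 : ℕ) : ENNReal)⁻¹ ^ L.length * c ≤ mean ((randTuple L).run H s) f := by
  induction L generalizing s with
  | nil =>
    have : (randTuple (k := k) []).run H s = PMF.pure (s.tick 1) := rfl
    rw [this, mean_pure]
    simpa using hf _ (isInitial_tick hs 1) fun l => h0 l (by simp)
  | cons l L ih =>
    have : randTuple (l :: L) = .seq (.rand (10 + l) 0) (randTuple L) := rfl
    rw [this, mean_seq, mean_rand, hs.mem_zero, List.length_cons, pow_succ', mul_assoc]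
    gcongr
    have h1 := ih (isInitial_write hs l (a l)) fun l' hl' => by
      by_cases hll : l' = l
      · subst hll; simp [Config.write]
      · have : (10 + l' : ℕ) ≠ 10 + l := fun h => hll (Fin.ext (by omega))
        rw [mem_write_of_ne _ _ this]
        exact h0 l' (by simp [hll, hl'])
    refine h1.trans ?_
    exact Finset.single_le_sum (f := fun x : Fin (n + 1) =>
      mean ((randTuple L).run H (s.write (10 + l) x)) f) (fun _ _ => bot_le)
      (Finset.mem_univ (⟨a l, Nat.lt_succ_iff.2 (ha l)⟩ : Fin (n + 1)))

/-- The code test for slot `l₁` of a random tuple that is sent to prover `t`. -/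
noncomputable def codeProg (p : Fin 5 × Fin k) : Prog k :=
  .seq (randTuple (List.finRange k)) (codeGuarded l₀ p.1 p.2)

/-- Choose one of the programs in a list by coin tosses: register `5` is a fair coin. After a
sequence of ones, nothing is done. -/
def choose : List (Prog k) → Prog k
  | [] => .skip
  | p :: L => .seq (.rand 5 2) (.ite 5 8 p (choose L))

/-- The verifier makes the energy test with probability one half, and otherwise at most one of the
code tests, the `i`-th of them with probability `2 ^ (-i - 1)`. -/
noncomputable def verifier : Prog k :=
  .seq (.const 2 1)
    (choose (energyProg k :: (Finset.univ : Finset (Fin 5 × Fin k)).toList.map (codeProg l₀)))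

end Verifier

/-! ### The outcome of the verifier -/

section Outcome

variable {k n m : ℕ} {H : LocalHamiltonian k n m} {l₀ : Fin k}

lemma mean_energyProg (hm : 1 ≤ m) {s : Config k} (hs : s.IsInitial n m) {F : Fin m → ENNReal}
    {f : Config k → ENNReal} (hf : ∀ j s', IsEnergy enc H j s' → f s' = F j) :
    mean ((energyProg k).run H s) f = (m : ENNReal)⁻¹ * ∑ j, F j := by
  have h1 : (Prog.sub 3 1 2 : Prog k).run H s = PMF.pure (s.write 3 (m - 1)) := by
    rw [Prog.run, hs.mem_one, hs.mem_two]
  obtain ⟨m, rfl⟩ : ∃ m', m = m' + 1 := ⟨m - 1, by omega⟩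
  rw [energyProg, mean_seq, h1, mean_pure, mean_seq, mean_rand, mem_write_self]
  congr 1
  refine Finset.sum_congr rfl fun j _ => ?_
  obtain ⟨s', h2, h3⟩ := runs_energyRest (H := H) j
    (s := (s.write 3 (m + 1 - 1)).write 4 j) hs.msg hs.circuit
    (by rw [mem_write_of_ne _ _ (by norm_num), mem_write_of_ne _ _ (by norm_num), hs.mem_two])
    (mem_write_self ..)
  rw [h2, mean_pure, hf j s' h3]

lemma support_energyProg (hm : 1 ≤ m) {s s' : Config k} (hs : s.IsInitial n m)
    (h : s' ∈ ((energyProg k).run H s).support) : ∃ j, IsEnergy enc H j s' := by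
  have h1 : (Prog.sub 3 1 2 : Prog k).run H s = PMF.pure (s.write 3 (m - 1)) := by
    rw [Prog.run, hs.mem_one, hs.mem_two]
  obtain ⟨s₁, h2, h⟩ := mem_support_seq.1 h
  rw [h1, PMF.support_pure, Set.mem_singleton_iff] at h2
  subst h2
  obtain ⟨s₂, h2, h⟩ := mem_support_seq.1 h
  obtain ⟨j, hj, rfl⟩ := mem_support_rand.1 h2
  rw [mem_write_self] at hj
  obtain ⟨s₃, h2, h3⟩ := runs_energyRest (H := H) ⟨j, by omega⟩
    (s := (s.write 3 (m - 1)).write 4 j) hs.msg hs.circuit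
    (by rw [mem_write_of_ne _ _ (by norm_num), mem_write_of_ne _ _ (by norm_num), hs.mem_two])
    (mem_write_self ..)
  rw [h2, PMF.support_pure, Set.mem_singleton_iff] at h
  exact ⟨_, h ▸ h3⟩

variable (H l₀) in
/-- The configurations reached in the code tests: either a code test has been prepared or the
verifier accepts without asking. -/
def IsCodeBranch (s : Config k) : Prop :=
  (∃ v t l i, Asks v l i ∧ IsCodeTest (n := n) enc l₀ v t l i s) ∨
    (s.msg = (fun _ => []) ∧ s.circuit = 1 ∧ s.verdict = .accept)

lemma support_codeProg {p : Fin 5 × Fin k} {s s' : Config k} (hs : s.IsInitial n m)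
    (hs0 : ∀ l : Fin k, s.mem (10 + l) ≤ n)
    (h : s' ∈ ((codeProg l₀ p).run H s).support) : IsCodeBranch (n := n) l₀ s' := by
  obtain ⟨s₁, h₁, h₂⟩ := mem_support_seq.1 h
  obtain ⟨h3, h4⟩ := support_randTuple hs h₁ fun l _ => hs0 l
  choose v hv using fun l => exists_slotCode (h4 l)
  obtain ⟨s₂, h5, h6⟩ := runs_codeGuarded (H := H) l₀ p.1 p.2 h3 fun l => (hv l).symm
  rw [h5, PMF.support_pure, Set.mem_singleton_iff] at h₂
  subst h₂
  rcases h6 with ⟨i, h6, h7⟩ | ⟨-, h6⟩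
  · exact Or.inl ⟨v, p.1, p.2, i, h6, h7⟩
  · exact Or.inr ⟨h6.1.trans h3.1, h6.2.trans h3.2, h6.3.trans h3.3⟩

lemma mean_codeProg_ge {v : Fin k → Option (Fin n)} {t : Fin 5} {l : Fin k} {i : Fin n}
    (hv : Asks v l i) {s : Config k} (hs : s.IsInitial n m) {c : ENNReal}
    {f : Config k → ENNReal} (hf : ∀ s', IsCodeTest enc l₀ v t l i s' → c ≤ f s') :
    ((n + 1 : ℕ) : ENNReal)⁻¹ ^ k * c ≤ mean ((codeProg l₀ (t, l)).run H s) f := by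
  rw [codeProg, mean_seq]
  have := mean_randTuple_ge (H := H) (L := List.finRange k) hs (a := fun l => slotCode (v l))
    (fun l => slotCode_le _) (fun l hl => absurd (List.mem_finRange l) hl) (c := c)
    (f := fun s' => mean ((codeGuarded l₀ t l).run H s') f) fun s₁ h1 h2 => by
      obtain ⟨s', h3, h4⟩ := runs_codeGuarded (H := H) l₀ t l h1 h2
      rw [h3, mean_pure]
      rcases h4 with ⟨i', h4, h5⟩ | ⟨h4, -⟩
      · have : i' = i := Option.some.inj (h4.1.symm.trans hv.1)
        subst this
        exact hf s' h5
      · exact absurd ⟨i, hv⟩ h4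
  rwa [List.length_finRange] at this

/-- Initial configurations in which the registers for the questions are empty. -/
def Config.IsBlank (n m : ℕ) (s : Config k) : Prop :=
  s.IsInitial n m ∧ ∀ l : Fin k, s.mem (10 + l) = 0

lemma isBlank_coin {s : Config k} (hs : s.IsBlank n m) (a : ℕ) :
    ((s.write 5 a).tick 1).IsBlank n m := by
  obtain ⟨hs, h⟩ := hs
  refine ⟨⟨hs.1, hs.2, hs.3, ?_, ?_, ?_, ?_⟩, fun l => ?_⟩
  · rw [mem_tick, mem_write_of_ne _ _ (by norm_num), hs.4]
  · rw [mem_tick, mem_write_of_ne _ _ (by norm_num), hs.5]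
  · rw [mem_tick, mem_write_of_ne _ _ (by norm_num), hs.6]
  · rw [mem_tick, mem_write_of_ne _ _ (by norm_num), hs.7]
  · rw [mem_tick, mem_write_of_ne _ _ (by omega), h]

lemma run_choose_coin (p q : Prog k) {s : Config k} (hs : s.IsBlank n m) (a : ℕ) :
    (Prog.ite 5 8 p q).run H (s.write 5 a) =
      if a = 0 then p.run H ((s.write 5 a).tick 1) else q.run H ((s.write 5 a).tick 1) := by
  rw [Prog.run, mem_write_self, mem_write_of_ne _ _ (by norm_num), hs.1.mem_eight]
  simp only [Nat.le_zero]

lemma mean_choose (p : Prog k) (L : List (Prog k)) {s : Config k} (hs : s.IsBlank n m)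
    (f : Config k → ENNReal) :
    mean ((choose (p :: L)).run H s) f =
      2⁻¹ * (mean (p.run H ((s.write 5 0).tick 1)) f +
        mean ((choose L).run H ((s.write 5 1).tick 1)) f) := by
  rw [choose, mean_seq, mean_rand, hs.1.mem_two]
  simp [Fin.sum_univ_two, run_choose_coin p (choose L) hs]

lemma support_choose (p : Prog k) (L : List (Prog k)) {s s' : Config k} (hs : s.IsBlank n m)
    (h : s' ∈ ((choose (p :: L)).run H s).support) : ∃ s₁ : Config k, s₁.IsBlank n m ∧
      (s' ∈ (p.run H s₁).support ∨ s' ∈ ((choose L).run H s₁).support) := by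
  obtain ⟨s₁, h₁, h₂⟩ := mem_support_seq.1 h
  obtain ⟨a, -, rfl⟩ := mem_support_rand.1 h₁
  refine ⟨_, isBlank_coin hs a, ?_⟩
  rw [run_choose_coin p (choose L) hs] at h₂
  split_ifs at h₂
  · exact Or.inl h₂
  · exact Or.inr h₂

lemma support_choose_code (L : List (Fin 5 × Fin k)) {s s' : Config k} (hs : s.IsBlank n m)
    (h : s' ∈ ((choose (L.map (codeProg l₀))).run H s).support) : IsCodeBranch (n := n) l₀ s' := by
  induction L generalizing s with
  | nil =>
    have : s' = s.tick 1 := by simpa [choose, Prog.run] using h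
    subst this
    exact Or.inr ⟨hs.1.1, hs.1.2, hs.1.3⟩
  | cons p L ih =>
    obtain ⟨s₁, hs₁, h | h⟩ := support_choose _ _ hs h
    · exact support_codeProg hs₁.1 (fun l => by rw [hs₁.2]; exact Nat.zero_le _) h
    · exact ih hs₁ h

lemma mean_choose_code_ge {v : Fin k → Option (Fin n)} {t : Fin 5} {l : Fin k} {i : Fin n}
    (hv : Asks v l i) {L : List (Fin 5 × Fin k)} (hL : (t, l) ∈ L) {s : Config k}
    (hs : s.IsBlank n m) {c : ENNReal} {f : Config k → ENNReal}
    (hf : ∀ s', IsCodeTest enc l₀ v t l i s' → c ≤ f s') :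
    2⁻¹ ^ L.length * (((n + 1 : ℕ) : ENNReal)⁻¹ ^ k * c) ≤
      mean ((choose (L.map (codeProg l₀))).run H s) f := by
  induction L generalizing s with
  | nil => simp at hL
  | cons p L ih =>
    rw [List.map_cons, mean_choose _ _ hs, List.length_cons, pow_succ', mul_assoc]
    refine mul_le_mul_right ?_ _
    rcases List.mem_cons.1 hL with h | h
    · subst h
      refine le_add_right ((mul_le_of_le_one_left' ?_).trans
        (mean_codeProg_ge hv (isBlank_coin hs 0).1 hf))
      exact pow_le_one' (by simp) _
    · exact le_add_left (ih h (isBlank_coin hs 1))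

lemma start_write : ((Config.start k n m).write 2 1).IsBlank n m := by
  refine ⟨⟨rfl, rfl, rfl, rfl, rfl, rfl, rfl⟩, fun l => ?_⟩
  rw [mem_write_of_ne _ _ (by omega)]
  change (if 10 + (l : ℕ) = 0 then n else if 10 + (l : ℕ) = 1 then m else 0) = 0
  rw [if_neg (by omega), if_neg (by omega)]

/-- The verifier makes an energy test or a code test, or accepts. -/
lemma support_outcome (hm : 1 ≤ m) {s : Config k} (h : s ∈ ((verifier l₀).outcome H).support) :
    (∃ j, IsEnergy enc H j s) ∨ IsCodeBranch (n := n) l₀ s := by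
  obtain ⟨s₁, h₁, h₂⟩ := mem_support_seq.1 h
  rw [Prog.run, PMF.support_pure, Set.mem_singleton_iff] at h₁
  subst h₁
  obtain ⟨s₁, hs₁, h | h⟩ := support_choose _ _ start_write h₂
  · exact Or.inl (support_energyProg hm hs₁.1 h)
  · exact Or.inr (support_choose_code _ hs₁ h)

lemma mean_outcome (f : Config k → ENNReal) : ∃ s₀ s₁ : Config k, s₀.IsBlank n m ∧ s₁.IsBlank n m ∧
    mean ((verifier l₀).outcome H) f = 2⁻¹ * (mean ((energyProg k).run H s₀) f +
      mean ((choose ((Finset.univ : Finset (Fin 5 × Fin k)).toList.map (codeProg l₀))).run H s₁)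
        f) := by
  refine ⟨_, _, isBlank_coin start_write 0, isBlank_coin start_write 1, ?_⟩
  rw [Prog.outcome, verifier, mean_seq]
  have : (Prog.const 2 1 : Prog k).run H (Config.start k n m) =
      PMF.pure ((Config.start k n m).write 2 1) := rfl
  rw [this, mean_pure, mean_choose _ _ start_write]

/-- The energy tests contribute half of the average of their values. -/
lemma mean_outcome_ge_energy (hm : 1 ≤ m) {F : Fin m → ENNReal} {f : Config k → ENNReal}
    (hf : ∀ j s', IsEnergy enc H j s' → f s' = F j) :
    2⁻¹ * ((m : ENNReal)⁻¹ * ∑ j, F j) ≤ mean ((verifier l₀).outcome H) f := by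
  obtain ⟨s₀, s₁, h0, -, h⟩ := mean_outcome (H := H) (l₀ := l₀) f
  rw [h, mean_energyProg hm h0.1 hf]
  exact mul_le_mul_right (le_add_right le_rfl) _

lemma mean_outcome_eq_energy (hm : 1 ≤ m) {F : Fin m → ENNReal} {f : Config k → ENNReal}
    (hf : ∀ j s', IsEnergy enc H j s' → f s' = F j)
    (hf0 : ∀ s', IsCodeBranch (n := n) l₀ s' → f s' = 0) :
    mean ((verifier l₀).outcome H) f = 2⁻¹ * ((m : ENNReal)⁻¹ * ∑ j, F j) := by
  obtain ⟨s₀, s₁, h0, h1, h⟩ := mean_outcome (H := H) (l₀ := l₀) f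
  rw [h, mean_energyProg hm h0.1 hf, mean_congr (g := fun _ => 0)
    (fun s hs => hf0 s (support_choose_code _ h1 hs)), mean_const, add_zero]

/-- Every code test is made with a probability that is polynomially small at worst. -/
lemma mean_outcome_ge_code {v : Fin k → Option (Fin n)} {t : Fin 5} {l : Fin k} {i : Fin n}
    (hv : Asks v l i) {c : ENNReal} {f : Config k → ENNReal}
    (hf : ∀ s', IsCodeTest enc l₀ v t l i s' → c ≤ f s') :
    2⁻¹ * (2⁻¹ ^ (5 * k) * (((n + 1 : ℕ) : ENNReal)⁻¹ ^ k * c)) ≤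
      mean ((verifier l₀).outcome H) f := by
  obtain ⟨s₀, s₁, -, h1, h⟩ := mean_outcome (H := H) (l₀ := l₀) f
  rw [h]
  refine mul_le_mul_right (le_add_left ?_) _
  have := mean_choose_code_ge (H := H) hv
    (L := (Finset.univ : Finset (Fin 5 × Fin k)).toList) (by simp) h1 hf
  simpa using this

/-! ### Resources of the verifier -/

lemma length_encodeNat_le {a : ℕ} (h : a ≤ n) : (encodeNat a).length ≤ 3 * (Nat.log 2 n + 1) := by
  have h1 : (encodeNat a).length = 2 * (Nat.bits a).length + 1 := by
    simp [encodeNat, List.length_flatMap]; ring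
  have h2 : (Nat.bits a).length ≤ Nat.log 2 n + 1 := by
    rw [Nat.size_eq_bits_len, Nat.size_le]
    exact lt_of_le_of_lt h (Nat.lt_pow_succ_log_self (by norm_num) n)
  omega

lemma length_enc_le (v : Fin k → Option (Fin n)) :
    (enc v).length ≤ 3 * k * (Nat.log 2 n + 1) := by
  rw [enc, List.length_flatMap]
  refine (List.sum_le_card_nsmul _ (3 * (Nat.log 2 n + 1)) ?_).trans ?_
  · intro a ha
    obtain ⟨l, -, rfl⟩ := List.mem_map.1 ha
    exact length_encodeNat_le (slotCode_le _)
  · simp; ring_nf; rfl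

lemma length_msg_le (hm : 1 ≤ m) {s : Config k} (h : s ∈ ((verifier l₀).outcome H).support)
    (t : Fin 5) : (s.msg t).length ≤ 3 * k * (Nat.log 2 n + 1) := by
  rcases support_outcome hm h with ⟨j, h⟩ | ⟨v, t', l, i, -, h⟩ | ⟨h, -⟩
  · rw [h.msg]; exact length_enc_le _
  · rw [h.msg, testMsg]
    by_cases ht : t = t'
    · subst ht; simpa using length_enc_le _
    · simpa [ht] using length_enc_le _
  · simp [h]

lemma loopFree_sendTo (R : Fin 5 → List ℕ) (T : List (Fin 5)) :
    (sendTo R T : Prog k).LoopFree := by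
  refine loopFree_seqs fun p hp => ?_
  obtain ⟨t, -, rfl⟩ := List.mem_map.1 hp
  refine loopFree_seqs fun p hp => ?_
  obtain ⟨x, -, rfl⟩ := List.mem_map.1 hp
  trivial

lemma loopFree_guardProg (l₁ : Fin k) {p : Prog k} (hp : p.LoopFree) (L : List (Fin k)) :
    (guardProg l₁ p L).LoopFree := by
  induction L with
  | nil => exact hp
  | cons l L ih =>
    rw [guardProg]
    split_ifs
    · exact ih
    · exact ⟨⟨trivial, ih⟩, ih⟩

lemma loopFree_choose {L : List (Prog k)} (h : ∀ p ∈ L, p.LoopFree) : (choose L).LoopFree := by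
  induction L with
  | nil => trivial
  | cons p L ih => exact ⟨trivial, h p (by simp), ih fun q hq => h q (by simp [hq])⟩

lemma loopFree_verifier : (verifier l₀).LoopFree := by
  refine ⟨trivial, loopFree_choose fun p hp => ?_⟩
  rcases List.mem_cons.1 hp with rfl | hp
  · refine ⟨trivial, trivial, trivial, loopFree_seqs fun p hp => ?_, loopFree_sendTo _ _,
      loopFree_seqs fun p hp => ?_, trivial⟩
    · obtain ⟨l, -, rfl⟩ := List.mem_map.1 hp
      exact ⟨trivial, ⟨trivial, trivial⟩, trivial⟩
    · obtain ⟨l, -, rfl⟩ := List.mem_map.1 hp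
      trivial
  · obtain ⟨q, -, rfl⟩ := List.mem_map.1 hp
    have hc : (codeRest l₀ q.1 q.2).LoopFree := ⟨loopFree_sendTo _ _, trivial, trivial⟩
    refine ⟨loopFree_seqs fun p hp => ?_, loopFree_guardProg _ hc _, trivial⟩
    obtain ⟨l, -, rfl⟩ := List.mem_map.1 hp
    trivial

/-- The verifier makes a constant number of steps, apart from sending the questions. -/
lemma time_outcome_le (hm : 1 ≤ m) {s : Config k} (h : s ∈ ((verifier l₀).outcome H).support) :
    s.time ≤ 5 * (3 * k * (n + m + 1)) + (verifier l₀).ops := by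
  have h1 := time_le loopFree_verifier h
  have h2 : ∑ t, (s.msg t).length ≤ 5 * (3 * k * (n + m + 1)) := by
    refine (Finset.sum_le_card_nsmul _ _ (3 * k * (n + m + 1)) fun t _ => ?_).trans (by simp)
    refine (length_msg_le hm h t).trans ?_
    gcongr
    exact (Nat.log_le_self 2 n).trans (by omega)
  have h3 : (Config.start k n m).time = 0 := rfl
  omega

lemma circuit_mem_unitary (hm : 1 ≤ m) {s : Config k}
    (h : s ∈ ((verifier l₀).outcome H).support) :
    s.circuit ∈ Matrix.unitaryGroup (Wire k → Bool) ℂ := by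
  rcases support_outcome hm h with ⟨j, h⟩ | ⟨v, t', l, i, -, h⟩ | ⟨-, h, -⟩
  · rw [h.circuit]; exact decodeAll_mem_unitary _
  · rw [h.circuit]; exact lift_mem_unitary _ decoder_mem_unitary
  · rw [h]; exact one_mem _

/-- The probability of acceptance in terms of the average probability of rejection. -/
lemma acceptProb_eq (hm : 1 ≤ m) {σ : Strategy k} (hσ : σ.IsQuantum) :
    acceptProb (verifier l₀) H σ = 1 -
      (mean ((verifier l₀).outcome H) fun s => ENNReal.ofReal (1 - acceptIn H σ s)).toReal ∧
    mean ((verifier l₀).outcome H) (fun s => ENNReal.ofReal (1 - acceptIn H σ s)) ≤ 1 := by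
  set μ := (verifier l₀).outcome H
  have h1 : mean μ (fun s => ENNReal.ofReal (acceptIn H σ s)) +
      mean μ (fun s => ENNReal.ofReal (1 - acceptIn H σ s)) = 1 := by
    rw [← mean_add, ← mean_const μ 1]
    refine mean_congr fun s hs => ?_
    have h2 := acceptIn_mem hσ H (circuit_mem_unitary hm hs)
    rw [← ENNReal.ofReal_add h2.1 (by linarith)]
    simp
  have h3 : mean μ (fun s => ENNReal.ofReal (acceptIn H σ s)) ≠ ⊤ := fun h => by
    simp [h] at h1
  have h4 : mean μ (fun s => ENNReal.ofReal (1 - acceptIn H σ s)) ≠ ⊤ := fun h => by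
    simp [h] at h1
  refine ⟨?_, h1 ▸ le_add_left le_rfl⟩
  have h5 := congrArg ENNReal.toReal h1
  rw [ENNReal.toReal_add h3 h4, ENNReal.toReal_one] at h5
  exact eq_sub_of_add_eq h5

/-! ### Decoding of questions -/

lemma flatMap_bits_inj {L L' : List Bool} {r r' : List Bool}
    (h : L.flatMap (fun b => [true, b]) ++ [false] ++ r =
      L'.flatMap (fun b => [true, b]) ++ [false] ++ r') : L = L' ∧ r = r' := by
  induction L generalizing L' with
  | nil => cases L' <;> simp_all
  | cons b L ih =>
    cases L' with
    | nil => simp at h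
    | cons b' L' =>
      simp only [List.flatMap_cons, List.cons_append, List.nil_append, List.cons.injEq,
        true_and] at h
      obtain ⟨rfl, h⟩ := h
      obtain ⟨rfl, rfl⟩ := ih h
      exact ⟨rfl, rfl⟩

lemma encodeNat_append_inj {a b : ℕ} {r r' : List Bool}
    (h : encodeNat a ++ r = encodeNat b ++ r') : a = b ∧ r = r' := by
  obtain ⟨h1, h2⟩ := flatMap_bits_inj h
  refine ⟨?_, h2⟩
  have h3 : Nat.digits 2 a = Nat.digits 2 b := by
    rw [Nat.digits_two_eq_bits, Nat.digits_two_eq_bits, h1]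
  exact Nat.digits_inj_iff.1 h3

lemma enc_injective : Function.Injective (enc : (Fin k → Option (Fin n)) → List Bool) := by
  intro v v' h
  have key : ∀ L : List (Fin k), (L.flatMap fun l => encodeNat (slotCode (v l))) =
      (L.flatMap fun l => encodeNat (slotCode (v' l))) → ∀ l ∈ L, v l = v' l := by
    intro L
    induction L with
    | nil => simp
    | cons l L ih =>
      intro h
      obtain ⟨h1, h2⟩ := encodeNat_append_inj h
      intro l' hl'
      rcases List.mem_cons.1 hl' with rfl | hl'
      · exact slotCode_injective h1
      · exact ih h2 l' hl'
  exact funext fun l => key _ h l (List.mem_finRange l)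

open Classical in
/-- The tuple of qubits that a question asks for. -/
noncomputable def askOf (n : ℕ) (q : List Bool) (l : Fin k) : Option (Fin n) :=
  if h : ∃ v : Fin k → Option (Fin n), enc v = q then h.choose l else none

lemma askOf_enc (v : Fin k → Option (Fin n)) : askOf n (enc v) = v := by
  ext1 l
  have h : ∃ v' : Fin k → Option (Fin n), enc v' = enc v := ⟨v, rfl⟩
  rw [askOf, dif_pos h, enc_injective h.choose_spec]

end Outcome

/-! ### The encoding -/

section Encoding

variable {n : ℕ}

/-- The isometry of the five-qubit code. -/
noncomputable def codeMat : Matrix (Fin 5 → Bool) Bool ℂ := Matrix.of fun x b => codeword b x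

/-- The label in the decoder of the logical basis state `b`: syndrome zero. -/
def logicalString (b : Bool) : Fin 5 → Bool := Function.update (fun _ => false) 0 b

lemma codeMat_eq : codeMat = (decoder.submatrix logicalString id).transpose := by
  ext x b; exact codeword_eq_decoder b x

lemma sig_transpose (p : Bool) : (sig p).transpose = sig p := by
  ext b c
  cases p <;> cases b <;> cases c <;> simp [sig]

lemma stab_transpose (w i : Fin 5) : (stab w i).transpose = stab w i := by
  rw [stab]; split_ifs <;> simp [sig_transpose]

lemma tens_mul_codeMat {S : Fin 5 → Matrix Bool Bool ℂ} (hS : ∀ t, (S t).transpose = S t) :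
    tens S * codeMat = ((decoder * tens S).submatrix logicalString id).transpose := by
  have h : (tens S).transpose = tens S := by
    ext x y
    simp only [Matrix.transpose_apply, tens_apply]
    refine Finset.prod_congr rfl fun t _ => ?_
    conv_rhs => rw [← hS t]
    rfl
  have h1 : (decoder * tens S).submatrix logicalString id =
      decoder.submatrix logicalString id * tens S := rfl
  rw [codeMat_eq, h1, Matrix.transpose_mul, h]

lemma tens_stab_mul_codeMat {w : Fin 5} (hw : w ≠ 0) : tens (stab w) * codeMat = codeMat := by
  rw [tens_mul_codeMat (stab_transpose w), decoder_mul_stab hw, codeMat_eq]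
  ext x b
  simp [pauli_true_mul, logicalString, hw]

lemma tens_sig_mul_codeMat (p : Bool) : tens (fun _ : Fin 5 => sig p) * codeMat =
    codeMat * sig p := by
  rw [tens_mul_codeMat fun _ => sig_transpose p, ← pauli_mul_decoder, codeMat_eq]
  ext x b
  have h : toggle (logicalString b) 0 = logicalString !b := by
    ext i
    by_cases hi : i = 0
    · subst hi; simp [logicalString]
    · simp [logicalString, hi]
  cases p
  · rw [Matrix.transpose_apply, Matrix.submatrix_apply, pauli_false_mul, h, Matrix.mul_apply]
    cases b <;> simp [sig]
  · rw [Matrix.transpose_apply, Matrix.submatrix_apply, pauli_true_mul, Matrix.mul_apply]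
    cases b <;> simp [sig, logicalString]

lemma codeMat_isometry : codeMat.conjTranspose * codeMat = 1 := by
  have h := congrArg Matrix.transpose (Matrix.mem_unitaryGroup_iff.1 decoder_mem_unitary)
  rw [Matrix.transpose_one] at h
  ext b c
  have h1 : (codeMat.conjTranspose * codeMat) b c =
      (decoder * star decoder).transpose (logicalString b) (logicalString c) := by
    simp only [codeMat_eq, Matrix.mul_apply, Matrix.conjTranspose_apply, Matrix.transpose_apply,
      Matrix.submatrix_apply, id, Matrix.star_apply]
    exact Finset.sum_congr rfl fun x _ => mul_comm _ _
  have h2 : logicalString b = logicalString c ↔ b = c :=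
    ⟨fun h => by simpa [logicalString] using congrFun h 0, fun h => h ▸ rfl⟩
  rw [h1, h, Matrix.one_apply, Matrix.one_apply]
  exact if_congr h2 rfl rfl

variable (n) in
/-- The encoding of `n` qubits as a matrix. -/
noncomputable def encMat : Matrix (Fin 5 → Fin n → Bool) (Fin n → Bool) ℂ :=
  (tens fun _ : Fin n => codeMat).submatrix (Equiv.piComm fun (_ : Fin 5) (_ : Fin n) => Bool) id

lemma encode_eq (Γ : (Fin n → Bool) → ℂ) : encode Γ = (encMat n).mulVec Γ := by
  ext x
  simp only [encode, Matrix.mulVec, dotProduct]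
  rfl

lemma tens_tens_mul_encMat (c : Fin 5 → Fin n → Matrix Bool Bool ℂ) :
    (tens fun t => tens (c t)) * encMat n =
      (tens fun i => (tens fun t => c t i) * codeMat).submatrix
        (Equiv.piComm fun (_ : Fin 5) (_ : Fin n) => Bool) id := by
  have h : (tens fun t => tens (c t)) = (tens fun i => tens fun t => c t i).submatrix
      (Equiv.piComm fun (_ : Fin 5) (_ : Fin n) => Bool)
      (Equiv.piComm fun (_ : Fin 5) (_ : Fin n) => Bool) := by
    ext x y
    simp only [Matrix.submatrix_apply, tens_apply, Equiv.piComm_apply]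
    exact Finset.prod_comm
  rw [h, encMat, Matrix.submatrix_mul_equiv, tens_mul]

lemma encMat_isometry : (encMat n).conjTranspose * encMat n = 1 := by
  rw [encMat, Matrix.conjTranspose_submatrix, Matrix.submatrix_mul_equiv, tens_conjTranspose,
    tens_mul]
  simp only [codeMat_isometry]
  rw [tens_one]
  exact Matrix.submatrix_id_id _

lemma tens_stab_mul_encMat (i : Fin n) {w : Fin 5} (hw : w ≠ 0) :
    (tens fun t => tens (Function.update 1 i (stab w t)) :
      Matrix (Fin 5 → Fin n → Bool) (Fin 5 → Fin n → Bool) ℂ) * encMat n = encMat n := by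
  rw [tens_tens_mul_encMat, encMat]
  congr 2
  ext1 i'
  by_cases h : i' = i
  · subst h
    simp only [Function.update_self]
    exact tens_stab_mul_codeMat hw
  · simp only [Function.update_of_ne h, Pi.one_apply]
    rw [tens_one, Matrix.one_mul]

lemma tens_pauli_mul_encMat (p : Bool × Fin n) :
    (tens fun _ : Fin 5 => pauli p : Matrix (Fin 5 → Fin n → Bool) (Fin 5 → Fin n → Bool) ℂ) *
      encMat n = encMat n * pauli p := by
  set c : Fin n → Matrix Bool Bool ℂ := Function.update 1 p.2 (sig p.1) with hc
  have h : encMat n * pauli p = (tens fun i => codeMat * c i).submatrix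
      (Equiv.piComm fun (_ : Fin 5) (_ : Fin n) => Bool) id := by
    rw [← tens_mul]; rfl
  rw [h]
  have h' := tens_tens_mul_encMat fun _ => c
  refine h'.trans ?_
  congr 2
  ext1 i'
  by_cases h : i' = p.2
  · subst h
    simp only [hc, Function.update_self]
    exact tens_sig_mul_codeMat p.1
  · simp only [hc, Function.update_of_ne h, Pi.one_apply]
    rw [tens_one, Matrix.one_mul, Matrix.mul_one]

lemma tens_wordOp_mul_encMat (L : List (Bool × Fin n)) :
    (tens fun _ : Fin 5 => wordOp pauli L :
      Matrix (Fin 5 → Fin n → Bool) (Fin 5 → Fin n → Bool) ℂ) * encMat n =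
      encMat n * wordOp pauli L := by
  induction L with
  | nil => simp [wordOp, tens_one]
  | cons p L ih =>
    have h : (tens fun _ : Fin 5 => wordOp pauli (p :: L) :
        Matrix (Fin 5 → Fin n → Bool) (Fin 5 → Fin n → Bool) ℂ) =
        (tens fun _ : Fin 5 => pauli p) * tens fun _ : Fin 5 => wordOp pauli L := by
      rw [tens_mul]; simp [wordOp]
    have h' : wordOp pauli (p :: L) = pauli p * wordOp pauli L := by simp [wordOp]
    rw [h, h', Matrix.mul_assoc, ih, ← Matrix.mul_assoc, tens_pauli_mul_encMat, Matrix.mul_assoc]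

end Encoding

/-! ### The honest provers -/

section Honest

open scoped InnerProductSpace

variable {k n m : ℕ}

/-- The bits that are sent for the tuple `v` of qubits. A slot without a qubit is filled with
zero. -/
def sentBits (v : Fin k → Option (Fin n)) (x : Fin n → Bool) : Fin k → Bool :=
  fun l => ((v l).map x).getD false

/-- The bits that are kept; those that are sent are replaced by zeros. -/
def keptBits (v : Fin k → Option (Fin n)) (x : Fin n → Bool) : Fin n → Bool :=
  fun i => if ∃ l, v l = some i then false else x i

/-- The isometry of the honest provers. -/
noncomputable def honestMat (v : Fin k → Option (Fin n)) :
    Matrix ((Fin k → Bool) × (Fin n → Bool)) (Fin n → Bool) ℂ :=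
  Matrix.of fun z x => if z = (sentBits v x, keptBits v x) then 1 else 0

variable {Γ : (Fin n → Bool) → ℂ} {ask : List Bool → Fin k → Option (Fin n)}

lemma honest_W (t : Fin 5) (q : List Bool) : (honest ask Γ).W t q = honestMat (ask q) := by
  ext z x
  simp only [honestMat, Matrix.of_apply, Prod.ext_iff]
  rfl

lemma sent_kept_injective (v : Fin k → Option (Fin n)) :
    Function.Injective fun x => (sentBits v x, keptBits v x) := by
  intro x y h
  obtain ⟨h1, h2⟩ := Prod.ext_iff.1 h
  ext i
  by_cases hi : ∃ l, v l = some i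
  · obtain ⟨l, hl⟩ := hi
    simpa [sentBits, hl] using congrFun h1 l
  · simpa [keptBits, hi] using congrFun h2 i

lemma honestMat_isometry (v : Fin k → Option (Fin n)) :
    (honestMat v).conjTranspose * honestMat v = 1 := by
  ext x y
  rw [Matrix.mul_apply, Finset.sum_eq_single (sentBits v x, keptBits v x)]
  · have h : (sentBits v x, keptBits v x) = (sentBits v y, keptBits v y) ↔ x = y :=
      (sent_kept_injective v).eq_iff
    simp only [Matrix.conjTranspose_apply, honestMat, Matrix.of_apply, if_true, star_one, one_mul,
      h, Matrix.one_apply]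
  · intro z _ hz
    simp [honestMat, hz]
  · simp

lemma isQuantum_honest (hΓ : IsState Γ) : (honest ask Γ).IsQuantum := by
  refine ⟨?_, fun t q => ?_⟩
  · change IsState (encode Γ)
    rw [isState_iff] at hΓ ⊢
    rw [encode_eq, ← hΓ]
    exact norm_cl_of_isometry encMat_isometry (WithLp.toLp 2 Γ)
  · rw [honest_W]; exact honestMat_isometry _

lemma amp_mul_apply {X A Y : Type*} [Fintype X] [DecidableEq X] [Fintype A] (B : Matrix X X ℂ)
    (M : Matrix (X × A) Y ℂ) (x : X) (e : A) (y : Y) :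
    (amp A B * M) (x, e) y = ∑ x', B x x' * M (x', e) y :=
  amp_mulVec B (fun p => M p y) x e

lemma sentBits_toggle {v : Fin k → Option (Fin n)} {l : Fin k} {i : Fin n} (h : Asks v l i)
    (x : Fin n → Bool) : sentBits v (toggle x i) = toggle (sentBits v x) l := by
  ext l'
  by_cases hl : l' = l
  · subst hl; simp [sentBits, h.1]
  · rw [toggle_of_ne _ hl, sentBits, sentBits]
    cases hv : v l' with
    | none => rfl
    | some i' =>
      have : i' ≠ i := fun h' => h.2 l' hl (h' ▸ hv)
      simp [this]

lemma keptBits_toggle {v : Fin k → Option (Fin n)} {l : Fin k} {i : Fin n} (h : Asks v l i)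
    (x : Fin n → Bool) : keptBits v (toggle x i) = keptBits v x := by
  ext i'
  by_cases hi : i' = i
  · subst hi
    have : ∃ l, v l = some i' := ⟨l, h.1⟩
    simp [keptBits, this]
  · simp [keptBits, hi]

/-- An operator on the qubits that are sent, as an operator on all qubits of a prover. -/
noncomputable abbrev ampSent (n : ℕ) (B : Op (Fin k)) :
    Matrix ((Fin k → Bool) × (Fin n → Bool)) ((Fin k → Bool) × (Fin n → Bool)) ℂ :=
  amp (Fin n → Bool) B

/-- The Pauli operators on a qubit act in the same way before and after it is sent. -/
lemma amp_pauli_mul_honestMat {v : Fin k → Option (Fin n)} {l : Fin k} {i : Fin n}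
    (h : Asks v l i) (p : Bool) :
    ampSent n (pauli (p, l)) * honestMat v = honestMat v * pauli (p, i) := by
  ext ⟨z, e⟩ x
  rw [amp_mul_apply]
  cases p
  · rw [mul_pauli_false]
    simp only [pauli_false, ite_mul, one_mul, zero_mul, Finset.sum_ite_eq', Finset.mem_univ,
      if_true]
    simp only [honestMat, Matrix.of_apply, Prod.mk.injEq, sentBits_toggle h, keptBits_toggle h]
    refine if_congr (and_congr_left' ?_) rfl rfl
    rw [eq_comm, eq_toggle_comm]
  · rw [mul_pauli_true]
    simp only [pauli_true, ite_mul, zero_mul]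
    rw [Finset.sum_eq_single z (fun z' _ hz' => if_neg hz'.symm) (by simp), if_pos rfl]
    simp only [honestMat, Matrix.of_apply, Prod.mk.injEq]
    split_ifs with hz
    · have : z l = x i := by rw [hz.1]; simp [sentBits, h.1]
      rw [this, mul_comm]
    · simp

lemma amp_update_mul_honestMat {v : Fin k → Option (Fin n)} {l : Fin k} {i : Fin n}
    (h : Asks v l i) (w t : Fin 5) :
    ampSent n (tens (Function.update 1 l (stab w t))) * honestMat v =
      honestMat v * (tens (Function.update 1 i (stab w t)) : Op (Fin n)) := by
  rw [stab]
  split_ifs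
  · exact amp_pauli_mul_honestMat h false
  · exact amp_pauli_mul_honestMat h true
  · have h1 : (tens (Function.update 1 l 1) : Op (Fin k)) = 1 := by
      have : Function.update (1 : Fin k → Matrix Bool Bool ℂ) l 1 = 1 := Function.update_eq_self _ _
      rw [this]; exact tens_one
    have h2 : (tens (Function.update 1 i 1) : Op (Fin n)) = 1 := by
      have : Function.update (1 : Fin n → Matrix Bool Bool ℂ) i 1 = 1 := Function.update_eq_self _ _
      rw [this]; exact tens_one
    rw [h1, h2, ampSent, amp_one, Matrix.one_mul, Matrix.mul_one]

lemma amp_wordOp_mul_honestMat {v : Fin k → Option (Fin n)} {s : ℕ} (e : Fin s → Fin k)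
    (f : Fin s → Fin n) (hv : ∀ a, Asks v (e a) (f a)) (L : List (Bool × Fin s)) :
    ampSent n (wordOp (fun p => pauli (p.1, e p.2)) L) * honestMat v =
      honestMat v * wordOp pauli (L.map fun p => (p.1, f p.2)) := by
  induction L with
  | nil => simp [wordOp, amp_one]
  | cons p L ih =>
    have h : wordOp (fun p : Bool × Fin s => pauli (p.1, e p.2)) (p :: L) =
        pauli (p.1, e p.2) * wordOp (fun p => pauli (p.1, e p.2)) L := by simp [wordOp]
    have h' : wordOp pauli ((p :: L).map fun p => (p.1, f p.2)) =
        pauli (p.1, f p.2) * wordOp pauli (L.map fun p => (p.1, f p.2)) := by simp [wordOp]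
    rw [h, h', ampSent, amp_mul, Matrix.mul_assoc, ih, ← Matrix.mul_assoc, amp_pauli_mul_honestMat (hv _),
      Matrix.mul_assoc]

/-- Operators on the answers, moved through the isometries of the provers. -/
lemma amp_tensW_mul_answerMap {σ : Strategy k} {q : Fin 5 → List Bool} {B : Fin 5 → Op (Fin k)}
    {C : ∀ t, Matrix (σ.P t) (σ.P t) ℂ}
    (h : ∀ t, amp (σ.A t) (B t) * σ.W t (q t) = σ.W t (q t) * C t) :
    amp (∀ t, σ.A t) (tensW B) * σ.answerMap q = σ.answerMap q * tens C := by
  have h1 : σ.answerMap q = (tens fun t => σ.W t (q t)).submatrix (groupEquiv σ.A).symm id := rfl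
  rw [amp_tensW, h1, Matrix.submatrix_mul_equiv, tens_mul]
  simp only [h]
  rw [← tens_mul]
  rfl

lemma stab_mulVec_answer {q : Fin 5 → List Bool} {l : Fin 5 → Fin k} {i : Fin n}
    (h : ∀ t, Asks (ask (q t)) (l t) i) {w : Fin 5} (hw : w ≠ 0) (e : Fin 5 → Fin n → Bool) :
    (tensW fun t => tens (Function.update 1 (l t) (stab w t))).mulVec
      ((honest ask Γ).answer q e) = (honest ask Γ).answer q e := by
  set σ := honest ask Γ with hσ
  have h1 := amp_tensW_mul_answerMap (σ := σ) (q := q)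
    (B := fun t => tens (Function.update 1 (l t) (stab w t)))
    (C := fun t => tens (Function.update 1 i (stab w t))) fun t => by
      have hW : σ.W t (q t) = honestMat (ask (q t)) := honest_W t (q t)
      rw [hW]; exact amp_update_mul_honestMat (h t) w t
  have h2 : ∀ (e : ∀ t, σ.A t) x, σ.answer q e x = (σ.answerMap q).mulVec σ.state (x, e) :=
    fun _ _ => rfl
  have h3 : (tens fun t => tens (Function.update 1 i (stab w t)) :
      Matrix (Fin 5 → Fin n → Bool) (Fin 5 → Fin n → Bool) ℂ).mulVec (encode Γ) = encode Γ := by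
    rw [encode_eq, Matrix.mulVec_mulVec, tens_stab_mul_encMat i hw]
  ext x
  have h4 := congrFun (congrArg (fun M => M.mulVec σ.state) h1) (x, e)
  simp only [← Matrix.mulVec_mulVec] at h4
  rw [amp_mulVec] at h4
  refine h4.trans ?_
  rw [h2]
  exact congrFun (congrArg (σ.answerMap q).mulVec h3) (x, e)

/-- The honest provers pass the code tests. -/
lemma acceptIn_honest_codeTest (hΓ : IsState Γ) (H : LocalHamiltonian k n m) {l₀ : Fin k}
    {v : Fin k → Option (Fin n)} {t : Fin 5} {l : Fin k} {i : Fin n} (hv : Asks v l i)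
    {s : Config k} (hs : IsCodeTest enc l₀ v t l i s) :
    acceptIn H (honest (askOf n) Γ) s = 1 := by
  refine acceptIn_eq_one (isQuantum_honest hΓ) H _ hs.circuit hs.verdict fun w hw e => ?_
  refine stab_mulVec_answer (i := i) (fun t' => ?_) hw e
  rw [hs.msg, testMsg, testSlots]
  by_cases h : t' = t
  · subst h
    rw [Function.update_self, Function.update_self, askOf_enc]
    exact hv
  · rw [Function.update_of_ne h, Function.update_of_ne h, askOf_enc]
    exact asks_single l₀ i

/-- The energy tests of the honest provers measure the energy of their state. -/
lemma energyRej_honest (H : LocalHamiltonian k n m) (j : Fin m) :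
    energyRej (honest (askOf n) Γ) enc H j =
      expect (lift (H.supp j).toEmbedding (H.term j)) Γ := by
  obtain ⟨c, -, hc⟩ := exists_pauli_expansion (H.term j)
  set σ := honest (askOf n) Γ with hσ
  rw [energyRej, conj_decodeAll (H.size_le j) hc, pull_sum_smul]
  set W := fun g => (letters (H.size j)).filter g
  have h1 : ∀ g, σ.pull (fun _ => enc (termTuple H j)) (tensW fun _ =>
      wordOp (fun p => pauli (p.1, Fin.castLE (H.size_le j) p.2)) (W g)) =
      tens fun _ : Fin 5 => wordOp pauli ((W g).map fun p => (p.1, H.supp j p.2)) := by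
    intro g
    rw [pull_tensW]
    congr 1
    ext1 t
    have hW : σ.W t (enc (termTuple H j)) = honestMat (termTuple H j) := by
      rw [← askOf_enc (termTuple H j), askOf_enc]
      exact (honest_W t _).trans (by rw [askOf_enc])
    rw [Strategy.localPull, Matrix.mul_assoc, hW]
    have := amp_wordOp_mul_honestMat (Fin.castLE (H.size_le j)) (H.supp j)
      (asks_termTuple H j) (W g)
    rw [this, ← Matrix.mul_assoc, honestMat_isometry, Matrix.one_mul]
  have h2 : σ.vec = cl (encMat n) (WithLp.toLp 2 Γ) := by
    rw [cl_apply]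
    exact congrArg (WithLp.toLp 2) (encode_eq Γ)
  have h3 : ∑ g, c g • cl (σ.pull (fun _ => enc (termTuple H j)) (tensW fun _ =>
      wordOp (fun p => pauli (p.1, Fin.castLE (H.size_le j) p.2)) (W g))) σ.vec =
      cl (encMat n) (cl (lift (H.supp j).toEmbedding (H.term j)) (WithLp.toLp 2 Γ)) := by
    have h4 : lift (H.supp j).toEmbedding (H.term j) =
        ∑ g, c g • wordOp pauli ((W g).map fun p => (p.1, H.supp j p.2)) := by
      conv_lhs => rw [hc]
      rw [lift_sum]
      refine Finset.sum_congr rfl fun g _ => ?_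
      rw [lift_smul, lift_wordOp]
      rfl
    rw [h4, cl_sum, map_sum]
    refine Finset.sum_congr rfl fun g _ => ?_
    rw [h1, h2, cl_smul, map_smul, ← cl_mul, ← cl_mul, tens_wordOp_mul_encMat]
  rw [h3, h2, inner_cl, ← cl_mul, encMat_isometry, cl_one, expect_eq]
  rfl

end Honest

/-! ### Completeness and soundness -/

section Value

variable {k n m : ℕ} {H : LocalHamiltonian k n m} {l₀ : Fin k} {σ : Strategy k}

lemma acceptIn_congr {s s' : Config k} (h1 : s.msg = s'.msg) (h2 : s.circuit = s'.circuit)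
    (h3 : s.verdict = s'.verdict) : acceptIn H σ s = acceptIn H σ s' := by
  rw [acceptIn, acceptIn, h1, h2, h3]

/-- The probability that the verifier rejects. -/
noncomputable def rejProb (l₀ : Fin k) (H : LocalHamiltonian k n m) (σ : Strategy k) : ℝ :=
  (mean ((verifier l₀).outcome H) fun s => ENNReal.ofReal (1 - acceptIn H σ s)).toReal

lemma rejProb_nonneg : 0 ≤ rejProb l₀ H σ := ENNReal.toReal_nonneg

lemma ofReal_one_sub_acceptIn_energy (hσ : σ.IsQuantum) (j : Fin m) (s : Config k)
    (hs : IsEnergy enc H j s) :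
    ENNReal.ofReal (1 - acceptIn H σ s) = ENNReal.ofReal (energyRej σ enc H j) := by
  rw [one_sub_acceptIn_energy hσ hs, energyRej]

lemma toReal_average :
    (2⁻¹ * ((m : ENNReal)⁻¹ * ∑ j, ENNReal.ofReal (energyRej σ enc H j))).toReal =
      2⁻¹ * ((m : ℝ)⁻¹ * ∑ j, energyRej σ enc H j) := by
  rw [← ENNReal.ofReal_sum_of_nonneg fun j _ => energyRej_nonneg H j, ENNReal.toReal_mul,
    ENNReal.toReal_mul, ENNReal.toReal_ofReal (Finset.sum_nonneg fun j _ => energyRej_nonneg H j)]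
  simp

lemma sum_energyRej_le (hm : 1 ≤ m) (hσ : σ.IsQuantum) :
    ∑ j, energyRej σ enc H j ≤ 2 * m * rejProb l₀ H σ := by
  have h1 := mean_outcome_ge_energy (l₀ := l₀) hm (ofReal_one_sub_acceptIn_energy (H := H) hσ)
  have h2 := ENNReal.toReal_mono
    (ne_top_of_le_ne_top ENNReal.one_ne_top (acceptProb_eq hm hσ).2) h1
  rw [toReal_average] at h2
  have hm' : (0 : ℝ) < m := by exact_mod_cast hm
  rw [rejProb]
  have h3 : ∑ j, energyRej σ enc H j = 2 * m * (2⁻¹ * ((m : ℝ)⁻¹ * ∑ j, energyRej σ enc H j)) := by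
    field_simp
  rw [h3]
  gcongr

/-- Every code test is made with a probability of at least `2⁻¹ ^ (5 * k + 1) * (n + 1)⁻¹ ^ k`, so
that it is passed by a strategy that is seldom rejected. -/
lemma stabBound (hm : 1 ≤ m) (hσ : σ.IsQuantum) :
    StabBound (n := n) enc l₀ σ (2 ^ (5 * k + 1) * (n + 1) ^ k * rejProb l₀ H σ) := by
  intro v t l i hv w hw
  set s : Config k :=
    { mem := fun _ => 0
      msg := testMsg enc l₀ v t i
      circuit := lift (blockWires (testSlots l₀ t l)) decoder
      verdict := .zeros (syndromeWires (testSlots l₀ t l))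
      time := 0 } with hs
  have h1 := one_sub_stab_le hσ H (s := s) (testSlots l₀ t l) rfl rfl hw
  refine h1.trans (mul_le_mul_of_nonneg_left ?_ zero_le_two)
  have h2 := mean_outcome_ge_code (H := H) (l₀ := l₀) hv
    (c := ENNReal.ofReal (1 - acceptIn H σ s))
    (f := fun s => ENNReal.ofReal (1 - acceptIn H σ s)) fun s' hs' => by
      rw [acceptIn_congr (s := s) (s' := s') hs'.msg.symm hs'.circuit.symm hs'.verdict.symm]
  have h3 := ENNReal.toReal_mono
    (ne_top_of_le_ne_top ENNReal.one_ne_top (acceptProb_eq hm hσ).2) h2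
  have h4 : 0 ≤ 1 - acceptIn H σ s := by
    have := (acceptIn_mem hσ H (s := s) (lift_mem_unitary _ decoder_mem_unitary)).2
    linarith
  simp only [ENNReal.toReal_mul, ENNReal.toReal_pow, ENNReal.toReal_inv, ENNReal.toReal_natCast,
    ENNReal.toReal_ofNat, ENNReal.toReal_ofReal h4] at h3
  have h5 : 1 - acceptIn H σ s = 2 ^ (5 * k + 1) * (n + 1) ^ k *
      (2⁻¹ * (2⁻¹ ^ (5 * k) * (((n + 1 : ℕ) : ℝ)⁻¹ ^ k * (1 - acceptIn H σ s)))) := by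
    have : ((n + 1 : ℕ) : ℝ) ≠ 0 := by positivity
    push_cast at this ⊢
    rw [pow_succ, inv_pow, inv_pow]
    field_simp
  rw [h5, rejProb]
  gcongr

/-- The constant in the soundness bound: `energy_le_of_stabBound`, in which `ρ` is the probability
of rejection times `2 ^ (5 * k + 1) * (n + 1) ^ k`, and `n + 1 ≤ 2 * n`. -/
noncomputable def soundConst (k : ℕ) : ℝ :=
  16 + 32 * (4 ^ k * (310 * k)) ^ 2 * (2 ^ (5 * k + 1) * 2 ^ k)

lemma soundConst_pos : 0 < soundConst k := by
  rw [soundConst]; positivity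

lemma soundness (hn : 1 ≤ n) (hm : 1 ≤ m) (hσ : σ.IsQuantum) {b : ℝ}
    (hb : ∀ Ψ, IsState Ψ → b * m ≤ expect H.op Ψ) :
    b ≤ soundConst k * (n : ℝ) ^ (k + 2) * rejProb l₀ H σ := by
  set ε := rejProb l₀ H σ
  have hε : 0 ≤ ε := rejProb_nonneg
  have hm' : (0 : ℝ) < m := by exact_mod_cast hm
  have hn' : (1 : ℝ) ≤ n := by exact_mod_cast hn
  have hE := sum_energyRej_le (l₀ := l₀) (H := H) hm hσ
  have h16 : (1 : ℝ) ≤ (n : ℝ) ^ (k + 2) := one_le_pow₀ hn'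
  have hk0 := l₀.pos
  rcases Nat.lt_or_ge k 2 with hk | hk
  · obtain rfl : k = 1 := by omega
    have h1 : b * m ≤ 2 * ε * m := (energy_le_of_one hσ hn H hb).trans (hE.trans_eq (by ring))
    have h2 : b ≤ 2 * ε := le_of_mul_le_mul_right h1 hm'
    have h3 : (2 : ℝ) ≤ soundConst 1 := by rw [soundConst]; norm_num
    calc b ≤ 2 * ε := h2
      _ ≤ soundConst 1 * (n : ℝ) ^ (1 + 2) * ε := by
        gcongr
        nlinarith
  · have h1 := energy_le_of_stabBound hσ hk (by positivity) (stabBound (l₀ := l₀) (H := H) hm hσ)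
      hn H hb
    have h2 : ((n : ℝ) + 1) ^ k ≤ 2 ^ k * (n : ℝ) ^ k := by
      rw [← mul_pow]
      gcongr
      linarith
    have h3 : b * m ≤ (16 * ε + 32 * (4 ^ k * (310 * k)) ^ 2 * n ^ 2 *
        (2 ^ (5 * k + 1) * (2 ^ k * (n : ℝ) ^ k) * ε)) * m := by
      refine h1.trans ?_
      calc _ ≤ 8 * (2 * m * ε) + m * (32 * (4 ^ k * (310 * k)) ^ 2 * n ^ 2 *
            (2 ^ (5 * k + 1) * (2 ^ k * (n : ℝ) ^ k) * ε)) := by gcongr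
        _ = _ := by ring
    refine (le_of_mul_le_mul_right h3 hm').trans ?_
    have h4 : 16 * ε ≤ 16 * (n : ℝ) ^ (k + 2) * ε := by
      gcongr
      nlinarith
    calc _ ≤ 16 * (n : ℝ) ^ (k + 2) * ε + 32 * (4 ^ k * (310 * k)) ^ 2 * n ^ 2 *
          (2 ^ (5 * k + 1) * (2 ^ k * (n : ℝ) ^ k) * ε) := by gcongr
      _ = _ := by rw [soundConst]; ring

lemma acceptProb_le (hn : 1 ≤ n) (hm : 1 ≤ m) (hσ : σ.IsQuantum) {b : ℝ}
    (hb : ∀ Ψ, IsState Ψ → b * m ≤ expect H.op Ψ) :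
    acceptProb (verifier l₀) H σ ≤ 1 - (soundConst k)⁻¹ * b / (n : ℝ) ^ (k + 2) := by
  have hn' : (0 : ℝ) < (n : ℝ) ^ (k + 2) := by positivity
  have hC : 0 < soundConst k := soundConst_pos
  have h := soundness (l₀ := l₀) hn hm hσ hb
  have h1 : (soundConst k)⁻¹ * b / (n : ℝ) ^ (k + 2) ≤ rejProb l₀ H σ := by
    rw [div_le_iff₀ hn', inv_mul_le_iff₀ hC]
    linarith
  rw [(acceptProb_eq hm hσ).1]
  exact sub_le_sub_left h1 1

lemma acceptIn_of_accept (hσ : σ.IsQuantum) {s : Config k} (hc : s.circuit = 1)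
    (hv : s.verdict = .accept) : acceptIn H σ s = 1 := by
  have h := sum_norm_answer hσ s.msg (one_mem (Matrix.unitaryGroup (Wire k → Bool) ℂ))
  rw [acceptIn, hc, hv, ← h]
  exact Finset.sum_congr rfl fun e _ => expect_one _

lemma completeness (hm : 1 ≤ m) {a : ℝ} {Γ : (Fin n → Bool) → ℂ} (hΓ : IsState Γ)
    (ha : expect H.op Γ ≤ a * m) :
    1 - a / 2 ≤ acceptProb (verifier l₀) H (honest (askOf n) Γ) := by
  have hσ : (honest (askOf n) Γ : Strategy k).IsQuantum := isQuantum_honest hΓ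
  have h1 := mean_outcome_eq_energy (l₀ := l₀) hm (ofReal_one_sub_acceptIn_energy (H := H) hσ)
    fun s hs => by
      have : acceptIn H (honest (askOf n) Γ) s = 1 := by
        rcases hs with ⟨v, t, l, i, hv, hs⟩ | ⟨-, hc, hv⟩
        · exact acceptIn_honest_codeTest hΓ H hv hs
        · exact acceptIn_of_accept hσ hc hv
      rw [this]; simp
  have hm' : (0 : ℝ) < m := by exact_mod_cast hm
  rw [(acceptProb_eq hm hσ).1, h1, toReal_average]
  have h2 : ∑ j, energyRej (honest (askOf n) Γ) enc H j = expect H.op Γ := by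
    rw [expect_op]
    exact Finset.sum_congr rfl fun j _ => energyRej_honest H j
  rw [h2]
  have h3 : (m : ℝ)⁻¹ * expect H.op Γ ≤ a := by
    rw [inv_mul_le_iff₀ hm']; linarith
  linarith

end Value

end LHGame

theorem theorem1 (k : ℕ) (hk : 1 ≤ k) :
    ∃ (C : ℝ) (c : ℕ), 0 < C ∧ 0 < c ∧
    -- one verifier, its running time, and the constant in the length of its questions
    ∃ (V : LHGame.Prog k) (p : Polynomial ℕ) (K : ℕ),
      ∀ n : ℕ, 1 ≤ n →
      ∃ ask : List Bool → Fin k → Option (Fin n),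
      ∀ m : ℕ, 1 ≤ m → ∀ H : LHGame.LocalHamiltonian k n m,
        -- the verifier runs in polynomial time and sends questions of length `O(log n)`
        (∀ s ∈ (V.outcome H).support,
          s.time ≤ p.eval (n + m) ∧
          ∀ t, (s.msg t).length ≤ K * (Nat.log 2 n + 1)) ∧
        -- completeness
        (∀ (a : ℝ) (Γ : (Fin n → Bool) → ℂ), LHGame.IsState Γ →
          LHGame.expect H.op Γ ≤ a * m →
          (LHGame.honest ask Γ).IsQuantum ∧
          1 - a / 2 ≤ LHGame.acceptProb V H (LHGame.honest ask Γ)) ∧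
        -- soundness
        (∀ b : ℝ,
          (∀ Ψ : (Fin n → Bool) → ℂ, LHGame.IsState Ψ → b * m ≤ LHGame.expect H.op Ψ) →
          ∀ σ : LHGame.Strategy k, σ.IsQuantum →
            LHGame.acceptProb V H σ ≤ 1 - C * b / (n : ℝ) ^ c) := by
  set l₀ : Fin k := ⟨0, hk⟩
  refine ⟨(LHGame.soundConst k)⁻¹, k + 2, inv_pos.2 LHGame.soundConst_pos, by omega,
    LHGame.verifier l₀, Polynomial.C (5 * (3 * k)) * (Polynomial.X + 1) +
      Polynomial.C (LHGame.verifier l₀).ops, 3 * k, fun n hn => ⟨LHGame.askOf n, fun m hm H =>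
    ⟨fun s hs => ⟨?_, LHGame.length_msg_le hm hs⟩,
      fun a Γ hΓ ha => ⟨LHGame.isQuantum_honest hΓ, LHGame.completeness hm hΓ ha⟩,
      fun b hb σ hσ => LHGame.acceptProb_le hn hm hσ hb⟩⟩⟩
  refine (LHGame.time_outcome_le hm hs).trans (le_of_eq ?_)
  simp
  ring
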